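/- Let $(U_k)_{k\ge 1}$ be i.i.d. random variables, uniformly distributed on $[-1,1]$. For a square integrable functional $X=F(U_1,U_2,\dots)$ and $t\ge 0$ let $$\nabla_t X = X\circ\Phi_t-\frac12\int_{2\lfloor t/2\rfloor}^{2\lfloor t/2\rfloor+2}X\circ\Phi_s\,ds ,$$ where $X\circ\Phi_t$ is obtained from $F(U_1,U_2,\dots)$ by replacing $U_{\lfloor t/2\rfloor+1}$ with $t-1-2\lfloor t/2\rfloor$ and leaving the other coordinates unchanged. For $d\ge1$ let $\widehat L^2(\mathbb R_+^d)$ be the space of square integrable symmetric functions on $\mathbb R_+^d$ that vanish outside the union of the boxes $[2k_1-2,2k_1]\times\cdots\times[2k_d-2,2k_d]$ over pairwise distinct $k_1,\dots,k_d\ge1$. For $f\in\widehat L^2(\mathbb R_+^d)$ with bounded support let $$I_d(f)=\sum_{r=0}^d\Big(-\frac12\Big)^{d-r}\binom dr\sum_{\substack{k_1,\dots,k_r\ge1\\ \text{pairwise distinct}}}\int_{\mathbb R_+^{d-r}} f(2k_1-1+U_{k_1},\dots,2k_r-1+U_{k_r},y_1,\dots,y_{d-r})\,dy_1\cdots dy_{d-r},$$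 and extend $I_d$ by $L^2$-continuity to all of $\widehat L^2(\mathbb R_+^d)$. Let $\mathcal N$ be a standard normal random variable and $d_K(X,\mathcal N)=\sup_{x\in\mathbb R}|P(X\le x)-P(\mathcal N\le x)|$. Let $d\ge1$, let $f_d\in\widehat L^2(\mathbb R_+^d)$, and let $X=I_d(f_d)$. Then both of the following bounds hold (with right-hand sides in $[0,\infty]$): $$d_K(X,\mathcal N)\le |1-\mathbb E[X^2]|+\frac1d\sqrt{\mathrm{Var}\Big[\int_0^\infty(\nabla_tX)^2\,\frac{dt}{2}\Big]}+\frac{12+5\sqrt[4]{\mathbb E[X^4]}}{\sqrt d}\sqrt{\mathbb E\Big[\int_0^\infty(\nabla_tX)^4\,dt\Big]},$$ $$d_K(X,\mathcal N)\le |1-\mathbb E[X^2]|+\sqrt{\mathrm{Var}\Big[\int_0^\infty(\nabla_tX)^2\,\frac{dt}{2}\Big]}+24\sqrt{\mathbb E\Big[\int_0^\infty(\nabla_tX)^4\,dt\Big]}.$$ -/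

import Mathlib

open MeasureTheory ProbabilityTheory Filter Topology
open scoped ENNReal

noncomputable section

namespace IndepChaos

/-- The measure `dx / 2` on the half-line `ℝ₊ = [0, ∞)`. -/
def halfLebesgue : Measure ℝ := (2⁻¹ : ℝ≥0∞) • volume.restrict (Set.Ici 0)

/-- The measure `(dx / 2)^{⊗ n}` on `ℝ₊ⁿ`. -/
def halfLebesguePi (n : ℕ) : Measure (Fin n → ℝ) := Measure.pi fun _ => halfLebesgue

/-- `U 0, U 1, …` is an i.i.d. sequence of uniform random variables on `[-1, 1]`.
(The sequence is indexed from `0`, so that `U k` lives on the block `[2k, 2k + 2]`.) -/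
structure IsIIDUniform {Ω : Type*} [MeasurableSpace Ω] (P : Measure Ω) (U : ℕ → Ω → ℝ) :
    Prop where
  measurable : ∀ k, Measurable (U k)
  uniform : ∀ k, pdf.IsUniform (U k) (Set.Icc (-1) 1) P volume
  indep : iIndepFun U P

/-- The shift `Φ_t` on sequences: the coordinate of index `⌊t/2⌋` is replaced by
`t - 1 - 2⌊t/2⌋ ∈ [-1, 1)`, the others are kept (`t ≥ 0`). -/
def shift (t : ℝ) (u : ℕ → ℝ) : ℕ → ℝ :=
  Function.update u ⌊t / 2⌋₊ (t - 1 - 2 * (⌊t / 2⌋₊ : ℝ))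

/-- The finite difference gradient at time `t ≥ 0` of a functional `F` of the sequence:
`∇_t F = F ∘ Φ_t - (1/2) ∫_{2⌊t/2⌋}^{2⌊t/2⌋+2} F ∘ Φ_s ds`. -/
def discreteGradient (F : (ℕ → ℝ) → ℝ) (t : ℝ) (u : ℕ → ℝ) : ℝ :=
  F (shift t u) -
    (1 / 2) * ∫ s in (2 * (⌊t / 2⌋₊ : ℝ))..(2 * (⌊t / 2⌋₊ : ℝ) + 2), F (shift s u)

/-- `Δ_n`: the union of the boxes `[2k_1, 2k_1 + 2] × ⋯ × [2k_n, 2k_n + 2]` over pairwise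
distinct `k_1, …, k_n ∈ ℕ`. -/
def offDiagonal (n : ℕ) : Set (Fin n → ℝ) :=
  {x | ∃ k : Fin n ↪ ℕ, ∀ i, x i ∈ Set.Icc (2 * (k i : ℝ)) (2 * (k i : ℝ) + 2)}

/-- The space of square integrable symmetric functions on `ℝ₊ⁿ` that vanish outside `Δ_n`
(functions are extended by `0` to `ℝⁿ`). -/
structure IsSymmKernel (n : ℕ) (f : (Fin n → ℝ) → ℝ) : Prop where
  memLp : MemLp f 2 (halfLebesguePi n)
  symm : ∀ (σ : Equiv.Perm (Fin n)) (x : Fin n → ℝ), f (fun i => x (σ i)) = f x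
  vanish : ∀ x, x ∉ offDiagonal n → f x = 0

/-- The point `(p_1, …, p_r, y_1, …, y_{n-r})` of `ℝⁿ`, for `r ≤ n`. -/
def joinCoords (n r : ℕ) (p : Fin r → ℝ) (y : Fin (n - r) → ℝ) : Fin n → ℝ := fun i =>
  if h : (i : ℕ) < r then p ⟨i, h⟩ else y ⟨(i : ℕ) - r, by have := i.isLt; omega⟩

/-- The multiple stochastic integral of a function `f` of `n` variables with bounded support,
evaluated at a sequence `u`:
`∑_{r=0}^n (-1/2)^{n-r} (n choose r) ∑_{k_1, …, k_r distinct}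
  ∫_{ℝ₊^{n-r}} f (2k_1 + 1 + u_{k_1}, …, 2k_r + 1 + u_{k_r}, y_1, …, y_{n-r}) dy`.
For bounded support and `u` in `[-1, 1]^ℕ` the sum has finitely many nonzero terms. -/
def multipleIntegralElem (n : ℕ) (f : (Fin n → ℝ) → ℝ) (u : ℕ → ℝ) : ℝ :=
  ∑ r ∈ Finset.range (n + 1), (-(1 / 2) : ℝ) ^ (n - r) * (n.choose r : ℝ) *
    ∑' k : Fin r ↪ ℕ, ∫ y in {y : Fin (n - r) → ℝ | ∀ i, 0 ≤ y i},
      f (joinCoords n r (fun i => 2 * (k i : ℝ) + 1 + u (k i)) y)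

/-- `X = I_n(f)`: the random variable `X` is (a version of) the multiple stochastic integral
of the square integrable symmetric kernel `f`, where `I_n` is the extension by continuity, from
`L²(ℝ₊ⁿ, (dx/2)^{⊗ n})` to `L²(Ω)`, of the explicit formula on kernels with bounded support. -/
def IsMultipleIntegral {Ω : Type*} [MeasurableSpace Ω] (P : Measure Ω) (U : ℕ → Ω → ℝ)
    (n : ℕ) (f : (Fin n → ℝ) → ℝ) (X : Ω → ℝ) : Prop :=
  IsSymmKernel n f ∧ MemLp X 2 P ∧
    ∃ g : ℕ → (Fin n → ℝ) → ℝ,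
      (∀ m, IsSymmKernel n (g m) ∧ ∃ R : ℝ, ∀ x, (∃ i, R < x i) → g m x = 0) ∧
      Tendsto (fun m => eLpNorm (fun x => g m x - f x) 2 (halfLebesguePi n)) atTop (𝓝 0) ∧
      Tendsto (fun m => eLpNorm
        (fun ω => multipleIntegralElem n (g m) (fun k => U k ω) - X ω) 2 P) atTop (𝓝 0)

/-- The Kolmogorov distance `sup_x |P(X ≤ x) - P(𝒩 ≤ x)|` between a random variable `X` and
the standard normal distribution. -/
def kolmogorovDistNormal {Ω : Type*} [MeasurableSpace Ω] (P : Measure Ω) (X : Ω → ℝ) : ℝ :=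
  ⨆ x : ℝ, |P.real {ω | X ω ≤ x} - (gaussianReal 0 1).real (Set.Iic x)|

/-- `Var[∫_0^∞ (∇_t X)² dt/2] ∈ [0, ∞]` for `X = F(U_0, U_1, …)`. -/
def varGradientSq {Ω : Type*} [MeasurableSpace Ω] (P : Measure Ω) (U : ℕ → Ω → ℝ)
    (F : (ℕ → ℝ) → ℝ) : ℝ≥0∞ :=
  evariance (fun ω => ∫ t, (discreteGradient F t fun k => U k ω) ^ 2 ∂halfLebesgue) P

/-- `E[∫_0^∞ (∇_t X)⁴ dt] ∈ [0, ∞]` for `X = F(U_0, U_1, …)`. -/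
def gradientFourth {Ω : Type*} [MeasurableSpace Ω] (P : Measure Ω) (U : ℕ → Ω → ℝ)
    (F : (ℕ → ℝ) → ℝ) : ℝ≥0∞ :=
  ∫⁻ ω, (∫⁻ t in Set.Ici (0 : ℝ), ENNReal.ofReal ((discreteGradient F t fun k => U k ω) ^ 4)) ∂P

/-- `E[X⁴] ∈ [0, ∞]`. -/
def fourthMoment {Ω : Type*} [MeasurableSpace Ω] (P : Measure Ω) (X : Ω → ℝ) : ℝ≥0∞ :=
  ∫⁻ ω, ENNReal.ofReal (X ω ^ 4) ∂P

end IndepChaos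

end

/-! Write `E_k` for averaging over the `k`-th coordinate and `D_k = 1 - E_k`. The `D_k` are
commuting orthogonal projections of `L²`, and the chaos of order `d` lies in the eigenspace `∑_k D_k
X = d X`. This relation is all the normal approximation uses of the multiple integral. It comes from
rewriting `I_d` as `∑_r (-1)^(d-r) (d choose r) P_r`, where `P_r` keeps `r` coordinates and averages
the other `d - r`. Since `∑_k D_k P_r = r (P_r - P_{r-1})`, the alternating sum is an eigenvector
(`isEigen_chaosSum`), and the relation passes to `L²` limits (`isChaos_of_tendsto`).

The bound itself is Stein's method. If `g` solves `g'(w) - w g(w) = 1_{w ≤ x} - Φ(x)`, then `P(X ≤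
x) - Φ(x) = E[g'(X)] - E[X g(X)]` and `d E[X g(X)] = ∑_k E[D_k X g(X)]`. Let `X'` be `X` with
coordinate `k` resampled. As `D_k X` is centred in coordinate `k`, `E[D_k X g(X)] = E[D_k X' (g(X')
- g(X))]`, and `X' - X = D_k X' - D_k X`. The first order term of the expansion of `g` gives `E[V_k
g'(X)]`, where `V_k = E_k[(D_k X)²]`.

Smoothness of `g` is not needed for the remainder: it is at most `(h(X') - h(X)) (X' - X)` with `h`
nondecreasing and `|h| ≤ 1` (`abs_steinSol_sub_sub_le`). Exchanging `X` and `X'` turns the resulting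
error into `2 E[D_k(D_k X |D_k X|) h(X)]` (`abs_integral_coordDiff_mul_steinSol_sub_le`). Summed
over `k`, this is at most `2 √E[Z²]` with the divergence `Z = ∑_k D_k(D_k X |D_k X|)`. An
isometry-type inequality, together with the eigenvalue relation applied to `D_k X`, gives `E[Z²] ≤
(4/3) d ∑_k E[(D_k X)⁴]` (`integral_sum_coordDiff_mul_abs_sq_le`).

Hence the distance is at most `E|1 - d⁻¹ ∑_k V_k| + (2/d) √((4/3) d ∑_k E[(D_k X)⁴])`. Finally `∑_k
V_k` is `∫ (∇_t X)² dt/2` and has mean `d E[X²]`, while `E ∫ (∇_t X)⁴ dt = 2 ∑_k E[(D_k X)⁴]`. Both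
inequalities follow with room to spare in the constants, and the term with `E[X⁴]` is pure slack. -/

namespace IndepChaos

/-! ### Resampling coordinates, and averages as conditional expectations on a product space. -/

section Resampling

variable {ι E : Type*}

open Classical in
/-- The configuration `u` with the coordinates in `S` replaced by those of `w`. -/
noncomputable def resample (S : Set ι) (u w : ι → E) : ι → E := S.piecewise w u

theorem resample_mem {S : Set ι} {i : ι} (h : i ∈ S) (u w : ι → E) : resample S u w i = w i := by
  simp [resample, h]

theorem resample_notMem {S : Set ι} {i : ι} (h : i ∉ S) (u w : ι → E) :
    resample S u w i = u i := by
  simp [resample, h]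

theorem resample_resample (S T : Set ι) (u w z : ι → E) :
    resample T (resample S u w) z = resample (S ∪ T) u (resample T w z) := by
  funext i
  by_cases hT : i ∈ T <;> by_cases hS : i ∈ S <;> simp [resample, hT, hS]

theorem resample_resample_of_subset {S T : Set ι} (h : S ⊆ T) (u w z : ι → E) :
    resample T (resample S u w) z = resample T u z := by
  funext i
  by_cases hT : i ∈ T
  · simp [resample, hT]
  · have hS : i ∉ S := fun hi => hT (h hi)
    simp [resample, hT, hS]

theorem resample_swap_swap (S : Set ι) (u w : ι → E) :
    resample S (resample S u w) (resample S w u) = u := by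
  funext i
  by_cases hS : i ∈ S <;> simp [resample, hS]

variable [MeasurableSpace E]

/-- Integrating out the coordinates in `S` with respect to the product measure. -/
noncomputable def avg (μ : Measure (ι → E)) (S : Set ι) (F : (ι → E) → ℝ) (u : ι → E) : ℝ :=
  ∫ w, F (resample S u w) ∂μ

theorem measurable_resample (S : Set ι) :
    Measurable fun p : (ι → E) × (ι → E) => resample S p.1 p.2 := by
  refine measurable_pi_iff.2 fun i => ?_
  by_cases h : i ∈ S
  · simp only [resample_mem h]; fun_prop
  · simp only [resample_notMem h]; fun_prop

theorem avg_resample (μ : Measure (ι → E)) {S T : Set ι} (h : S ⊆ T) (F : (ι → E) → ℝ)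
    (u w : ι → E) : avg μ T F (resample S u w) = avg μ T F u := by
  simp only [avg, resample_resample_of_subset h]

theorem avg_const_mul (μ : Measure (ι → E)) {F : (ι → E) → ℝ} (S : Set ι) (c : ℝ) :
    avg μ S (fun u => c * F u) = fun u => c * avg μ S F u := by
  funext u
  exact integral_const_mul _ _

variable (ν : Measure E) [IsProbabilityMeasure ν]

local notation "μ∞" => Measure.infinitePi (fun _ : ι => ν)

/-- Exchanging the coordinates in `S` of two independent copies preserves their law. -/
theorem measurePreserving_resample_swap (S : Set ι) :
    MeasurePreserving (fun p : (ι → E) × (ι → E) => (resample S p.1 p.2, resample S p.2 p.1))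
      (μ∞.prod μ∞) (μ∞.prod μ∞) := by
  classical
  have hm : Measurable fun p : (ι → E) × (ι → E) => (resample S p.1 p.2, resample S p.2 p.1) :=
    (measurable_resample S).prodMk ((measurable_resample S).comp measurable_swap)
  refine ⟨hm, ?_⟩
  symm
  have hgen := generateFrom_squareCylinders (α := fun _ : ι => E)
  have hpi := isPiSystem_squareCylinders (α := fun _ : ι => E)
    (C := fun _ => {s | MeasurableSet s}) (fun _ => MeasurableSpace.isPiSystem_measurableSet)
    (fun _ => MeasurableSet.univ)
  have hspan : μ∞.FiniteSpanningSetsIn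
      (squareCylinders fun _ : ι => {s : Set E | MeasurableSet s}) :=
    { set := fun _ => Set.univ
      set_mem := fun _ => ⟨∅, fun _ => Set.univ, by simp, by simp⟩
      finite := fun _ => measure_lt_top _ _
      spanning := Set.iUnion_const _ }
  -- It suffices to compare the measures on products of two cylinders.
  refine Measure.prod_eq_generateFrom hgen hgen hpi hpi hspan hspan ?_
  rintro _ ⟨a, A, hA, rfl⟩ _ ⟨b, B, hB, rfl⟩
  simp only [Set.mem_univ_pi, Set.mem_ofPred_eq] at hA hB
  -- Padding with `Set.univ` puts both cylinders on the same finite set of coordinates; the exchange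
  -- then only swaps the factors `ν (A' i)` and `ν (B' i)` for `i ∈ S`.
  set A' : ι → Set E := fun i => if i ∈ a then A i else Set.univ with hA'
  set B' : ι → Set E := fun i => if i ∈ b then B i else Set.univ with hB'
  have hA'm : ∀ i, MeasurableSet (A' i) := fun i => by
    simp only [hA']; split_ifs; exacts [hA i, .univ]
  have hB'm : ∀ i, MeasurableSet (B' i) := fun i => by
    simp only [hB']; split_ifs; exacts [hB i, .univ]
  have eA : (a : Set ι).pi A = ((a ∪ b : Finset ι) : Set ι).pi A' := by
    ext x; simp only [Set.mem_pi, Finset.coe_union, Set.mem_union, Finset.mem_coe, hA']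
    refine ⟨fun h i _ => ?_, fun h i hi => ?_⟩
    · split_ifs with hi
      exacts [h i hi, trivial]
    · simpa [hi] using h i (Or.inl hi)
  have eB : (b : Set ι).pi B = ((a ∪ b : Finset ι) : Set ι).pi B' := by
    ext x; simp only [Set.mem_pi, Finset.coe_union, Set.mem_union, Finset.mem_coe, hB']
    refine ⟨fun h i _ => ?_, fun h i hi => ?_⟩
    · split_ifs with hi
      exacts [h i hi, trivial]
    · simpa [hi] using h i (Or.inr hi)
  rw [eA, eB]
  generalize a ∪ b = c
  have hpre : (fun p : (ι → E) × (ι → E) => (resample S p.1 p.2, resample S p.2 p.1)) ⁻¹'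
      (((c : Set ι).pi A') ×ˢ ((c : Set ι).pi B')) =
      ((c : Set ι).pi fun i => if i ∈ S then B' i else A' i) ×ˢ
        ((c : Set ι).pi fun i => if i ∈ S then A' i else B' i) := by
    ext ⟨u, w⟩
    simp only [Set.mem_preimage, Set.mem_prod, Set.mem_pi, Finset.mem_coe, ← forall₂_and]
    refine forall₂_congr fun i _ => ?_
    by_cases h : i ∈ S
    · simp [resample, h, and_comm]
    · simp [resample, h]
  have hmeas : MeasurableSet (((c : Set ι).pi A') ×ˢ ((c : Set ι).pi B')) :=
    (MeasurableSet.pi c.countable_toSet fun i _ => hA'm i).prod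
      (MeasurableSet.pi c.countable_toSet fun i _ => hB'm i)
  rw [Measure.map_apply hm hmeas, hpre, Measure.prod_prod, Measure.infinitePi_pi,
    Measure.infinitePi_pi, Measure.infinitePi_pi, Measure.infinitePi_pi,
    ← Finset.prod_mul_distrib, ← Finset.prod_mul_distrib]
  · refine Finset.prod_congr rfl fun i _ => ?_
    by_cases h : i ∈ S <;> simp [h, mul_comm]
  · exact fun i _ => hB'm i
  · exact fun i _ => hA'm i
  · intro i _; split_ifs; exacts [hA'm i, hB'm i]
  · intro i _; split_ifs; exacts [hB'm i, hA'm i]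

theorem measurePreserving_resample (S : Set ι) :
    MeasurePreserving (fun p : (ι → E) × (ι → E) => resample S p.1 p.2) (μ∞.prod μ∞) μ∞ :=
  measurePreserving_fst.comp (measurePreserving_resample_swap ν S)

variable {ν}

theorem ae_resample {p : (ι → E) → Prop} (S : Set ι) (h : ∀ᵐ u ∂μ∞, p u) :
    ∀ᵐ u ∂μ∞, ∀ᵐ w ∂μ∞, p (resample S u w) :=
  Measure.ae_ae_of_ae_prod ((measurePreserving_resample ν S).quasiMeasurePreserving.ae h)

theorem avg_congr {F G : (ι → E) → ℝ} (S : Set ι) (h : F =ᵐ[μ∞] G) :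
    avg μ∞ S F =ᵐ[μ∞] avg μ∞ S G := by
  filter_upwards [ae_resample S h] with u hu
  exact integral_congr_ae hu

theorem integrable_comp_resample {F : (ι → E) → ℝ} (S : Set ι) (hF : Integrable F μ∞) :
    Integrable (fun p : (ι → E) × (ι → E) => F (resample S p.1 p.2)) (μ∞.prod μ∞) :=
  (measurePreserving_resample ν S).integrable_comp_of_integrable hF

theorem ae_integrable_comp_resample {F : (ι → E) → ℝ} (S : Set ι) (hF : Integrable F μ∞) :
    ∀ᵐ u ∂μ∞, Integrable (fun w => F (resample S u w)) μ∞ :=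
  (integrable_comp_resample S hF).prod_right_ae

theorem aestronglyMeasurable_comp_resample {F : (ι → E) → ℝ} (S : Set ι)
    (hF : AEStronglyMeasurable F μ∞) :
    AEStronglyMeasurable (fun p : (ι → E) × (ι → E) => F (resample S p.1 p.2)) (μ∞.prod μ∞) :=
  hF.comp_measurePreserving (measurePreserving_resample ν S)

theorem aestronglyMeasurable_avg {F : (ι → E) → ℝ} (S : Set ι)
    (hF : AEStronglyMeasurable F μ∞) : AEStronglyMeasurable (avg μ∞ S F) μ∞ :=
  (aestronglyMeasurable_comp_resample S hF).integral_prod_right'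

theorem integrable_avg {F : (ι → E) → ℝ} (S : Set ι) (hF : Integrable F μ∞) :
    Integrable (avg μ∞ S F) μ∞ :=
  (integrable_comp_resample S hF).integral_prod_left

theorem integral_comp_resample {F : (ι → E) → ℝ} (S : Set ι) (hF : AEStronglyMeasurable F μ∞) :
    ∫ p, F (resample S p.1 p.2) ∂(μ∞.prod μ∞) = ∫ u, F u ∂μ∞ := by
  have h := measurePreserving_resample ν S
  rw [← h.map_eq] at hF
  conv_rhs => rw [← h.map_eq]
  exact (integral_map h.aemeasurable hF).symm

theorem integral_avg {F : (ι → E) → ℝ} (S : Set ι) (hF : Integrable F μ∞) :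
    ∫ u, avg μ∞ S F u ∂μ∞ = ∫ u, F u ∂μ∞ := by
  rw [← integral_comp_resample S hF.1, integral_prod _ (integrable_comp_resample S hF)]
  rfl

theorem measurable_avg {F : (ι → E) → ℝ} (S : Set ι) (hF : Measurable F) :
    Measurable (avg μ∞ S F) :=
  ((hF.comp (measurable_resample S)).stronglyMeasurable.integral_prod_right').measurable

/-- Only almost sure: for exceptional `u` the section of `F` may fail to be integrable, and Fubini
fails with it. -/
theorem avg_avg {F : (ι → E) → ℝ} (S T : Set ι) (hF : Integrable F μ∞) :
    avg μ∞ S (avg μ∞ T F) =ᵐ[μ∞] avg μ∞ (S ∪ T) F := by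
  filter_upwards [ae_integrable_comp_resample (S ∪ T) hF] with u hu
  have h1 := integral_avg T hu
  simpa only [avg, resample_resample] using h1

theorem avg_comm {F : (ι → E) → ℝ} (S T : Set ι) (hF : Integrable F μ∞) :
    avg μ∞ S (avg μ∞ T F) =ᵐ[μ∞] avg μ∞ T (avg μ∞ S F) := by
  refine (avg_avg S T hF).trans ?_
  rw [Set.union_comm]
  exact (avg_avg T S hF).symm

theorem avg_sub {F G : (ι → E) → ℝ} (S : Set ι) (hF : Integrable F μ∞) (hG : Integrable G μ∞) :
    avg μ∞ S (fun u => F u - G u) =ᵐ[μ∞] fun u => avg μ∞ S F u - avg μ∞ S G u := by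
  filter_upwards [ae_integrable_comp_resample S hF, ae_integrable_comp_resample S hG] with u h1 h2
  exact integral_sub h1 h2

theorem avg_finsetSum {α : Type*} (s : Finset α) {F : α → (ι → E) → ℝ} (S : Set ι)
    (hF : ∀ a ∈ s, Integrable (F a) μ∞) :
    avg μ∞ S (fun u => ∑ a ∈ s, F a u) =ᵐ[μ∞] fun u => ∑ a ∈ s, avg μ∞ S (F a) u := by
  have h : ∀ᵐ u ∂μ∞, ∀ a ∈ s, Integrable (fun w => F a (resample S u w)) μ∞ :=
    (ae_ball_iff s.countable_toSet).2 fun a ha => ae_integrable_comp_resample S (hF a ha)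
  filter_upwards [h] with u hu
  exact integral_finsetSum _ hu

/-- The `L^p` contraction property, for `p = n` a natural number. -/
theorem lintegral_enorm_avg_pow_le {F : (ι → E) → ℝ} (S : Set ι) {n : ℕ} (hn : n ≠ 0)
    (hF : AEStronglyMeasurable F μ∞) :
    ∫⁻ u, ‖avg μ∞ S F u‖ₑ ^ n ∂μ∞ ≤ ∫⁻ u, ‖F u‖ₑ ^ n ∂μ∞ := by
  have h := measurePreserving_resample ν S
  have hFS := aestronglyMeasurable_comp_resample S hF
  have h0 : ∫⁻ u, ‖F u‖ₑ ^ n ∂μ∞ = ∫⁻ u, ∫⁻ w, ‖F (resample S u w)‖ₑ ^ n ∂μ∞ ∂μ∞ := by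
    rw [← lintegral_prod (fun p : (ι → E) × (ι → E) => ‖F (resample S p.1 p.2)‖ₑ ^ n)
      (hFS.enorm.pow_const n)]
    have hF' := hF
    rw [← h.map_eq] at hF'
    conv_lhs => rw [← h.map_eq]
    exact lintegral_map' (hF'.enorm.pow_const n) h.aemeasurable
  rw [h0]
  refine lintegral_mono_ae ?_
  filter_upwards [hFS.prodMk_left] with u hu
  -- Jensen's inequality, in the form that the `L¹` norm is at most the `Lⁿ` norm on a probability
  -- space.
  have h1 : ‖avg μ∞ S F u‖ₑ ≤ eLpNorm (fun w => F (resample S u w)) n μ∞ := by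
    refine (enorm_integral_le_lintegral_enorm _).trans ?_
    rw [← eLpNorm_one_eq_lintegral_enorm]
    refine eLpNorm_le_eLpNorm_of_exponent_le ?_ hu
    exact_mod_cast Nat.one_le_iff_ne_zero.2 hn
  refine (pow_le_pow_left₀ zero_le h1 n).trans (le_of_eq ?_)
  rw [eLpNorm_eq_lintegral_rpow_enorm_toReal (by exact_mod_cast hn) (by simp)]
  rw [← ENNReal.rpow_natCast, ← ENNReal.rpow_mul]
  simp [hn]

theorem memLp_natCast_iff {α : Type*} [MeasurableSpace α] {μ : Measure α} {F : α → ℝ} {n : ℕ}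
    (hn : n ≠ 0) (hF : AEStronglyMeasurable F μ) :
    MemLp F n μ ↔ ∫⁻ u, ‖F u‖ₑ ^ n ∂μ < ∞ := by
  have h := eLpNorm_lt_top_iff_lintegral_rpow_enorm_lt_top (f := F) (μ := μ) (p := (n : ℝ≥0∞))
    (by exact_mod_cast hn) (by simp)
  rw [MemLp, h]
  simp [hF]

theorem memLp_avg {F : (ι → E) → ℝ} (S : Set ι) {n : ℕ} (hn : n ≠ 0) (hF : MemLp F n μ∞) :
    MemLp (avg μ∞ S F) n μ∞ := by
  rw [memLp_natCast_iff hn (aestronglyMeasurable_avg S hF.1)]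
  exact (lintegral_enorm_avg_pow_le S hn hF.1).trans_lt ((memLp_natCast_iff hn hF.1).1 hF)

/-- Resampling is a reversible operation. -/
theorem integral_comp_resample_swap {H : (ι → E) → (ι → E) → ℝ} (S : Set ι)
    (hH : AEStronglyMeasurable (fun p : (ι → E) × (ι → E) => H p.1 (resample S p.1 p.2))
      (μ∞.prod μ∞)) :
    ∫ p, H (resample S p.1 p.2) p.1 ∂(μ∞.prod μ∞) =
      ∫ p, H p.1 (resample S p.1 p.2) ∂(μ∞.prod μ∞) := by
  have h := measurePreserving_resample_swap ν S
  have hH' := hH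
  rw [← h.map_eq] at hH'
  conv_rhs => rw [← h.map_eq]
  rw [integral_map h.aemeasurable hH']
  simp only [resample_swap_swap]

end Resampling

/-! ### The projections `D_k`: commutation, self-adjointness and the carré du champ identity. -/

section Difference

variable {ι E : Type*} [MeasurableSpace E]

/-- The difference between a functional and its average over the coordinate `k`. -/
noncomputable def coordDiff (μ : Measure (ι → E)) (k : ι) (F : (ι → E) → ℝ) (u : ι → E) : ℝ :=
  F u - avg μ {k} F u

variable {ν : Measure E} [IsProbabilityMeasure ν]

local notation "μ∞" => Measure.infinitePi (fun _ : ι => ν)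

/-- The average over coordinate `k` does not see that coordinate, so it cancels. This replaces
increments of `X` by increments of `D_k X` in the Stein expansion. -/
theorem coordDiff_resample_sub (μ : Measure (ι → E)) (k : ι) (F : (ι → E) → ℝ) (u w : ι → E) :
    coordDiff μ k F (resample {k} u w) - coordDiff μ k F u = F (resample {k} u w) - F u := by
  simp only [coordDiff, avg_resample μ le_rfl]
  ring

theorem memLp_coordDiff {F : (ι → E) → ℝ} (k : ι) {n : ℕ} (hn : n ≠ 0) (hF : MemLp F n μ∞) :
    MemLp (coordDiff μ∞ k F) n μ∞ :=
  hF.sub (memLp_avg {k} hn hF)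

theorem integrable_coordDiff {F : (ι → E) → ℝ} (k : ι) (hF : Integrable F μ∞) :
    Integrable (coordDiff μ∞ k F) μ∞ :=
  hF.sub (integrable_avg {k} hF)

theorem measurable_coordDiff {F : (ι → E) → ℝ} (k : ι) (hF : Measurable F) :
    Measurable (coordDiff μ∞ k F) :=
  hF.sub (measurable_avg {k} hF)

theorem coordDiff_congr {F G : (ι → E) → ℝ} (k : ι) (h : F =ᵐ[μ∞] G) :
    coordDiff μ∞ k F =ᵐ[μ∞] coordDiff μ∞ k G :=
  h.sub (avg_congr {k} h)

theorem avg_coordDiff_comm {F : (ι → E) → ℝ} (S : Set ι) (k : ι) (hF : Integrable F μ∞) :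
    avg μ∞ S (coordDiff μ∞ k F) =ᵐ[μ∞] coordDiff μ∞ k (avg μ∞ S F) := by
  refine (avg_sub S hF (integrable_avg {k} hF)).trans ?_
  filter_upwards [avg_comm S {k} hF] with u hu
  rw [hu, coordDiff]

/-- `E_S E_k = E_S` when `k ∈ S`. With `S = {k}`, this centring makes terms of the Stein expansion
vanish. -/
theorem avg_coordDiff {F : (ι → E) → ℝ} {S : Set ι} {k : ι} (hk : k ∈ S) (hF : Integrable F μ∞) :
    avg μ∞ S (coordDiff μ∞ k F) =ᵐ[μ∞] 0 := by
  refine (avg_sub S hF (integrable_avg {k} hF)).trans ?_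
  have h := avg_avg S {k} hF
  rw [Set.union_eq_self_of_subset_right (by simpa using hk)] at h
  filter_upwards [h] with u hu
  simp [hu]

theorem coordDiff_sub {F G : (ι → E) → ℝ} (k : ι) (hF : Integrable F μ∞) (hG : Integrable G μ∞) :
    coordDiff μ∞ k (fun u => F u - G u) =ᵐ[μ∞]
      fun u => coordDiff μ∞ k F u - coordDiff μ∞ k G u := by
  filter_upwards [avg_sub {k} hF hG] with u hu
  simp only [coordDiff, hu]
  ring

theorem coordDiff_const_mul (μ : Measure (ι → E)) {F : (ι → E) → ℝ} (k : ι) (c : ℝ) :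
    coordDiff μ k (fun u => c * F u) = fun u => c * coordDiff μ k F u := by
  funext u
  simp only [coordDiff, avg_const_mul]
  ring

theorem coordDiff_finsetSum {α : Type*} (s : Finset α) {F : α → (ι → E) → ℝ} (k : ι)
    (hF : ∀ a ∈ s, Integrable (F a) μ∞) :
    coordDiff μ∞ k (fun u => ∑ a ∈ s, F a u) =ᵐ[μ∞] fun u => ∑ a ∈ s, coordDiff μ∞ k (F a) u := by
  filter_upwards [avg_finsetSum s {k} hF] with u hu
  simp only [coordDiff, hu, Finset.sum_sub_distrib]

theorem coordDiff_comm {F : (ι → E) → ℝ} (k l : ι) (hF : Integrable F μ∞) :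
    coordDiff μ∞ k (coordDiff μ∞ l F) =ᵐ[μ∞] coordDiff μ∞ l (coordDiff μ∞ k F) := by
  filter_upwards [coordDiff_sub k hF (integrable_avg {l} hF), avg_coordDiff_comm {l} k hF]
    with u h1 h2
  change coordDiff μ∞ k (fun u => F u - avg μ∞ {l} F u) u = _
  rw [h1, coordDiff.eq_def μ∞ l, h2]

theorem coordDiff_coordDiff {F : (ι → E) → ℝ} (k : ι) (hF : Integrable F μ∞) :
    coordDiff μ∞ k (coordDiff μ∞ k F) =ᵐ[μ∞] coordDiff μ∞ k F := by
  filter_upwards [avg_coordDiff (Set.mem_singleton k) hF] with u hu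
  rw [coordDiff.eq_def μ∞ k (coordDiff μ∞ k F), hu]
  simp

theorem integral_avg_mul {Y W : (ι → E) → ℝ} (S : Set ι)
    (hYW : Integrable (fun p : (ι → E) × (ι → E) => Y (resample S p.1 p.2) * W p.1)
      (μ∞.prod μ∞)) :
    ∫ u, avg μ∞ S Y u * W u ∂μ∞ =
      ∫ p, Y (resample S p.1 p.2) * W p.1 ∂(μ∞.prod μ∞) := by
  rw [integral_prod _ hYW]
  simp only [integral_mul_const, avg]

theorem memLp_comp_resample {F : (ι → E) → ℝ} {q : ℝ≥0∞} (S : Set ι) (hF : MemLp F q μ∞) :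
    MemLp (fun p : (ι → E) × (ι → E) => F (resample S p.1 p.2)) q (μ∞.prod μ∞) :=
  hF.comp_measurePreserving (measurePreserving_resample ν S)

theorem memLp_comp_resample_fst {F : (ι → E) → ℝ} {q : ℝ≥0∞} (hF : MemLp F q μ∞) :
    MemLp (fun p : (ι → E) × (ι → E) => F p.1) q (μ∞.prod μ∞) :=
  hF.comp_measurePreserving measurePreserving_fst

/-- The averaging operators are self-adjoint. -/
theorem integral_avg_mul_comm {Y W : (ι → E) → ℝ} (S : Set ι) (hY : MemLp Y 2 μ∞)
    (hW : MemLp W 2 μ∞) :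
    ∫ u, avg μ∞ S Y u * W u ∂μ∞ = ∫ u, Y u * avg μ∞ S W u ∂μ∞ := by
  have h1 : Integrable (fun p : (ι → E) × (ι → E) => Y (resample S p.1 p.2) * W p.1)
      (μ∞.prod μ∞) := (memLp_comp_resample S hY).integrable_mul (memLp_comp_resample_fst hW)
  have h2 : Integrable (fun p : (ι → E) × (ι → E) => W (resample S p.1 p.2) * Y p.1)
      (μ∞.prod μ∞) := (memLp_comp_resample S hW).integrable_mul (memLp_comp_resample_fst hY)
  have h3 : Integrable (fun p : (ι → E) × (ι → E) => Y p.1 * W (resample S p.1 p.2))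
      (μ∞.prod μ∞) := by simpa only [mul_comm] using h2
  rw [integral_avg_mul S h1]
  simp only [mul_comm (Y _) (avg μ∞ S W _)]
  rw [integral_avg_mul S h2, integral_comp_resample_swap (H := fun a b => Y a * W b) S h3.1]
  simp only [mul_comm]

theorem integral_coordDiff_mul_comm {Y W : (ι → E) → ℝ} (k : ι) (hY : MemLp Y 2 μ∞)
    (hW : MemLp W 2 μ∞) :
    ∫ u, coordDiff μ∞ k Y u * W u ∂μ∞ = ∫ u, Y u * coordDiff μ∞ k W u ∂μ∞ := by
  have hYW : Integrable (fun u => Y u * W u) μ∞ := hY.integrable_mul hW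
  have hY' : MemLp (avg μ∞ {k} Y) 2 μ∞ := memLp_avg (n := 2) {k} two_ne_zero hY
  have hW' : MemLp (avg μ∞ {k} W) 2 μ∞ := memLp_avg (n := 2) {k} two_ne_zero hW
  have h1 : Integrable (fun u => avg μ∞ {k} Y u * W u) μ∞ := hY'.integrable_mul hW
  have h2 : Integrable (fun u => Y u * avg μ∞ {k} W u) μ∞ := hY.integrable_mul hW'
  simp only [coordDiff, sub_mul, mul_sub]
  rw [integral_sub hYW h1, integral_sub hYW h2, integral_avg_mul_comm {k} hY hW]

/-- The carré du champ identity for the resampling of one coordinate. -/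
theorem integral_coordDiff_mul {Y W : (ι → E) → ℝ} (k : ι)
    (hYW : Integrable (fun u => Y u * W u) μ∞)
    (hYW' : Integrable (fun p : (ι → E) × (ι → E) => Y (resample {k} p.1 p.2) * W p.1)
      (μ∞.prod μ∞)) :
    Integrable (fun p : (ι → E) × (ι → E) => (Y (resample {k} p.1 p.2) - Y p.1) *
      (W (resample {k} p.1 p.2) - W p.1)) (μ∞.prod μ∞) ∧
    ∫ p, (Y (resample {k} p.1 p.2) - Y p.1) * (W (resample {k} p.1 p.2) - W p.1)
      ∂(μ∞.prod μ∞) = 2 * ∫ u, coordDiff μ∞ k Y u * W u ∂μ∞ := by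
  -- The exchange of the two copies carries one mixed product to the other.
  have hYW'' : Integrable (fun p : (ι → E) × (ι → E) => Y p.1 * W (resample {k} p.1 p.2))
      (μ∞.prod μ∞) := by
    have h := (measurePreserving_resample_swap ν {k}).integrable_comp_of_integrable hYW'
    simpa only [Function.comp_def, resample_swap_swap] using h
  have h1 := integrable_comp_resample {k} hYW
  have h2 : Integrable (fun p : (ι → E) × (ι → E) => Y p.1 * W p.1) (μ∞.prod μ∞) :=
    hYW.comp_fst _
  have e : (fun p : (ι → E) × (ι → E) => (Y (resample {k} p.1 p.2) - Y p.1) *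
      (W (resample {k} p.1 p.2) - W p.1)) = fun p =>
      (Y (resample {k} p.1 p.2) * W (resample {k} p.1 p.2) + Y p.1 * W p.1) -
      (Y (resample {k} p.1 p.2) * W p.1 + Y p.1 * W (resample {k} p.1 p.2)) := by
    funext p; ring
  rw [e]
  refine ⟨(h1.add h2).sub (hYW'.add hYW''), ?_⟩
  have hA : Integrable (fun u => avg μ∞ {k} Y u * W u) μ∞ := by
    have := hYW'.integral_prod_left
    simpa only [integral_mul_const, avg] using this
  rw [integral_sub (h1.fun_add h2) (hYW'.fun_add hYW''), integral_add h1 h2, integral_add hYW' hYW'',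
    integral_comp_resample (F := fun u => Y u * W u) {k} hYW.1,
    integral_fun_fst (f := fun u => Y u * W u),
    ← integral_comp_resample_swap (H := fun a b => Y a * W b) {k} hYW''.1,
    ← integral_avg_mul {k} hYW']
  simp only [coordDiff, sub_mul]
  rw [integral_sub hYW hA]
  simp only [probReal_univ, one_smul]
  ring

/-- `D_k` is self-adjoint and idempotent. -/
theorem integral_coordDiff_sq {Y : (ι → E) → ℝ} (k : ι) (hY : MemLp Y 2 μ∞) :
    ∫ u, coordDiff μ∞ k Y u ^ 2 ∂μ∞ = ∫ u, coordDiff μ∞ k Y u * Y u ∂μ∞ := by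
  have hD : MemLp (coordDiff μ∞ k Y) 2 μ∞ := memLp_coordDiff (n := 2) k two_ne_zero hY
  rw [integral_coordDiff_mul_comm k hY hY]
  have h := integral_coordDiff_mul_comm k hY hD
  simp only [sq]
  rw [h]
  refine integral_congr_ae ?_
  filter_upwards [coordDiff_coordDiff k (hY.integrable one_le_two)] with u hu
  rw [hu]

/-- Pythagoras: `E[Y²] - E[(D_k Y)²] = E[(Y - D_k Y)²]`. -/
theorem integral_coordDiff_sq_le_integral_sq {Y : (ι → E) → ℝ} (k : ι) (hY : MemLp Y 2 μ∞) :
    ∫ u, coordDiff μ∞ k Y u ^ 2 ∂μ∞ ≤ ∫ u, Y u ^ 2 ∂μ∞ := by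
  have hD : MemLp (coordDiff μ∞ k Y) 2 μ∞ := memLp_coordDiff (n := 2) k two_ne_zero hY
  have h1 := integral_coordDiff_sq k hY
  have h2 : 0 ≤ ∫ u, (Y u - coordDiff μ∞ k Y u) ^ 2 ∂μ∞ := integral_nonneg fun u => sq_nonneg _
  have e : (fun u => (Y u - coordDiff μ∞ k Y u) ^ 2) = fun u =>
      Y u ^ 2 - 2 * (coordDiff μ∞ k Y u * Y u) + coordDiff μ∞ k Y u ^ 2 := by
    funext u; ring
  have i1 : Integrable (fun u => coordDiff μ∞ k Y u * Y u) μ∞ := hD.integrable_mul hY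
  have i2 : Integrable (fun u => Y u ^ 2 - 2 * (coordDiff μ∞ k Y u * Y u)) μ∞ :=
    hY.integrable_sq.sub (i1.const_mul 2)
  rw [e, integral_add i2 hD.integrable_sq,
    integral_sub hY.integrable_sq (i1.const_mul 2), integral_const_mul, h1] at h2
  linarith

end Difference

/-! ### Elementary inequalities for `a |a|` and integrability of fourth order products. -/

/-- The constant is that of Cauchy-Schwarz: `a|a| - b|b|` is the integral of `2|s|` from `b` to `a`,
and the integral of `4s²` is `(4/3)(a³ - b³)`. -/
theorem sq_mul_abs_sub_mul_abs_le (a b : ℝ) :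
    (a * |a| - b * |b|) ^ 2 ≤ 4 / 3 * ((a - b) * (a ^ 3 - b ^ 3)) := by
  rcases abs_cases a with ⟨ha, h1⟩ | ⟨ha, h1⟩ <;> rcases abs_cases b with ⟨hb, h2⟩ | ⟨hb, h2⟩ <;>
    rw [ha, hb]
  · nlinarith [sq_nonneg ((a - b) * (a - b))]
  · nlinarith [mul_nonneg h1 (neg_nonneg.2 h2.le), mul_nonneg (mul_nonneg h1 (neg_nonneg.2 h2.le))
      (sq_nonneg (a + b)), sq_nonneg (a ^ 2 - b ^ 2), sq_nonneg (a ^ 2), sq_nonneg (b ^ 2)]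
  · nlinarith [mul_nonneg h2 (neg_nonneg.2 h1.le), mul_nonneg (mul_nonneg h2 (neg_nonneg.2 h1.le))
      (sq_nonneg (a + b)), sq_nonneg (a ^ 2 - b ^ 2), sq_nonneg (a ^ 2), sq_nonneg (b ^ 2)]
  · nlinarith [sq_nonneg ((a - b) * (a - b))]

/-- For equal signs the left side is at most `a|a| - b|b|` itself; the factor 2 pays for opposite
signs, through `(|a| + |b|)² ≤ 2(a² + b²)`. -/
theorem abs_add_abs_mul_sub_le {a b : ℝ} (h : b ≤ a) :
    (|a| + |b|) * (a - b) ≤ 2 * (a * |a| - b * |b|) := by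
  rcases abs_cases a with ⟨ha, h1⟩ | ⟨ha, h1⟩ <;> rcases abs_cases b with ⟨hb, h2⟩ | ⟨hb, h2⟩ <;>
    rw [ha, hb] <;> nlinarith [sq_nonneg (a + b), sq_nonneg (a - b)]

theorem integrable_pow_four {α : Type*} [MeasurableSpace α] {μ : Measure α} {F : α → ℝ}
    (hF : MemLp F 4 μ) : Integrable (fun u => F u ^ 4) μ := by
  have h := hF.integrable_norm_pow (p := 4) (by norm_num)
  refine h.congr (ae_of_all _ fun u => ?_)
  simp only [Real.norm_eq_abs]
  exact (even_two_mul 2).pow_abs (F u)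

theorem memLp_four_of_integrable_pow {α : Type*} [MeasurableSpace α] {μ : Measure α} {F : α → ℝ}
    (hF : AEStronglyMeasurable F μ) (h : Integrable (fun u => F u ^ 4) μ) : MemLp F 4 μ := by
  refine (memLp_natCast_iff (n := 4) (by norm_num) hF).2 ?_
  have h2 := h.2
  rw [hasFiniteIntegral_iff_enorm] at h2
  simpa only [enorm_pow] using h2

theorem integrable_mul_pow_three {α : Type*} [MeasurableSpace α] {μ : Measure α} {F G : α → ℝ}
    (hF : MemLp F 4 μ) (hG : MemLp G 4 μ) : Integrable (fun u => F u * G u ^ 3) μ := by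
  refine ((integrable_pow_four hF).add (integrable_pow_four hG)).mono
    (hF.1.mul (hG.1.pow 3)) (ae_of_all _ fun u => ?_)
  simp only [Pi.add_apply, Real.norm_eq_abs]
  rw [abs_of_nonneg (by positivity : 0 ≤ F u ^ 4 + G u ^ 4), abs_le]
  constructor <;>
  nlinarith [sq_nonneg (F u ^ 2 - G u ^ 2), sq_nonneg (F u * G u + G u ^ 2),
    sq_nonneg (F u * G u - G u ^ 2), sq_nonneg (F u ^ 2), sq_nonneg (G u ^ 2)]

theorem memLp_two_mul_abs {α : Type*} [MeasurableSpace α] {μ : Measure α} {F : α → ℝ}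
    (hF : MemLp F 4 μ) : MemLp (fun u => F u * |F u|) 2 μ := by
  refine (memLp_two_iff_integrable_sq (hF.1.mul hF.1.norm)).2 ?_
  refine (integrable_pow_four hF).congr (ae_of_all _ fun u => ?_)
  simp only [Pi.mul_apply, Real.norm_eq_abs]
  rw [mul_pow, sq_abs]; ring

/-! ### Eigenvectors of the number operator and the second moment of a divergence. -/

section Chaos

variable {ι E : Type*} [MeasurableSpace E] {ν : Measure E} [IsProbabilityMeasure ν]

local notation "μ∞" => Measure.infinitePi (fun _ : ι => ν)

/-- A discrete form of the Skorokhod isometry. Since `Z_k = D_k Z_k` and the projections commute and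
are self-adjoint, `E[Z_k Z_l] = E[D_l Z_k · D_k Z_l]`; then `ab ≤ (a² + b²)/2` and the symmetry of
the double sum conclude. -/
theorem integral_sum_sq_le (K : Finset ι) {Z : ι → (ι → E) → ℝ} (hZ : ∀ k ∈ K, MemLp (Z k) 2 μ∞)
    (hD : ∀ k ∈ K, coordDiff μ∞ k (Z k) =ᵐ[μ∞] Z k) :
    ∫ u, (∑ k ∈ K, Z k u) ^ 2 ∂μ∞ ≤ ∑ k ∈ K, ∑ l ∈ K, ∫ u, coordDiff μ∞ l (Z k) u ^ 2 ∂μ∞ := by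
  have hint : ∀ k ∈ K, ∀ l ∈ K, Integrable (fun u => Z k u * Z l u) μ∞ := fun k hk l hl =>
    (hZ k hk).integrable_mul (hZ l hl)
  have hDZ : ∀ k ∈ K, ∀ l, MemLp (coordDiff μ∞ l (Z k)) 2 μ∞ := fun k hk l =>
    memLp_coordDiff (n := 2) l two_ne_zero (hZ k hk)
  have hkl : ∀ k ∈ K, ∀ l ∈ K, ∫ u, Z k u * Z l u ∂μ∞ ≤
      (1 / 2) * ∫ u, coordDiff μ∞ l (Z k) u ^ 2 ∂μ∞ +
      (1 / 2) * ∫ u, coordDiff μ∞ k (Z l) u ^ 2 ∂μ∞ := by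
    intro k hk l hl
    have e1 : ∫ u, Z k u * Z l u ∂μ∞ = ∫ u, Z k u * coordDiff μ∞ k (Z l) u ∂μ∞ := by
      rw [← integral_coordDiff_mul_comm k (hZ k hk) (hZ l hl)]
      refine integral_congr_ae ?_
      filter_upwards [hD k hk] with u hu
      rw [hu]
    -- `D_k Z_l = D_k D_l Z_l = D_l D_k Z_l`, and the outer `D_l` is moved onto `Z_k`.
    have e2 : ∫ u, Z k u * coordDiff μ∞ k (Z l) u ∂μ∞ =
        ∫ u, coordDiff μ∞ l (Z k) u * coordDiff μ∞ k (Z l) u ∂μ∞ := by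
      rw [integral_coordDiff_mul_comm l (hZ k hk) (hDZ l hl k)]
      refine integral_congr_ae ?_
      filter_upwards [coordDiff_congr k (hD l hl),
        coordDiff_comm k l ((hZ l hl).integrable one_le_two)] with u h1 h2
      rw [← h1, h2]
    rw [e1, e2, ← integral_const_mul, ← integral_const_mul,
      ← integral_add ((hDZ k hk l).integrable_sq.const_mul _)
        ((hDZ l hl k).integrable_sq.const_mul _)]
    refine integral_mono ((hDZ k hk l).integrable_mul (hDZ l hl k))
      (((hDZ k hk l).integrable_sq.const_mul _).add
        ((hDZ l hl k).integrable_sq.const_mul _)) fun u => ?_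
    change coordDiff μ∞ l (Z k) u * coordDiff μ∞ k (Z l) u ≤
      (1 / 2) * coordDiff μ∞ l (Z k) u ^ 2 + (1 / 2) * coordDiff μ∞ k (Z l) u ^ 2
    nlinarith [sq_nonneg (coordDiff μ∞ l (Z k) u - coordDiff μ∞ k (Z l) u)]
  have e : (fun u => (∑ k ∈ K, Z k u) ^ 2) = fun u => ∑ k ∈ K, ∑ l ∈ K, Z k u * Z l u := by
    funext u
    rw [sq, Finset.sum_mul_sum]
  rw [e, integral_finsetSum _ fun k hk => integrable_finsetSum _ fun l hl => hint k hk l hl]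
  have e' : ∀ k ∈ K, ∫ u, ∑ l ∈ K, Z k u * Z l u ∂μ∞ = ∑ l ∈ K, ∫ u, Z k u * Z l u ∂μ∞ :=
    fun k hk => integral_finsetSum _ fun l hl => hint k hk l hl
  rw [Finset.sum_congr rfl e']
  refine (Finset.sum_le_sum fun k hk => Finset.sum_le_sum fun l hl => hkl k hk l hl).trans ?_
  simp only [Finset.sum_add_distrib, ← Finset.mul_sum]
  rw [Finset.sum_comm (f := fun k l => ∫ u, coordDiff μ∞ k (Z l) u ^ 2 ∂μ∞)]
  linarith

/-- By the carré du champ identity both sides are expectations over a pair that differs in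
coordinate `l`, so the pointwise inequality `sq_mul_abs_sub_mul_abs_le` suffices. The right side is
linear in `D_l F`, which allows the eigenvalue relation to be used after summing over `l`. -/
theorem integral_coordDiff_mul_abs_sq_le {F : (ι → E) → ℝ} (l : ι) (hF : MemLp F 4 μ∞) :
    ∫ u, coordDiff μ∞ l (fun v => F v * |F v|) u ^ 2 ∂μ∞ ≤
      4 / 3 * ∫ u, coordDiff μ∞ l F u * F u ^ 3 ∂μ∞ := by
  have hφ := memLp_two_mul_abs hF
  rw [integral_coordDiff_sq l hφ]
  obtain ⟨i1, e1⟩ := integral_coordDiff_mul l (Y := fun v => F v * |F v|)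
    (W := fun v => F v * |F v|) (hφ.integrable_mul hφ)
    ((memLp_comp_resample {l} hφ).integrable_mul (memLp_comp_resample_fst hφ))
  obtain ⟨i2, e2⟩ := integral_coordDiff_mul l (Y := F) (W := fun v => F v ^ 3)
    (integrable_mul_pow_three hF hF)
    (integrable_mul_pow_three (memLp_comp_resample {l} hF) (memLp_comp_resample_fst hF))
  have h := integral_mono i1 (i2.const_mul (4 / 3)) fun p => by
    have := sq_mul_abs_sub_mul_abs_le (F (resample {l} p.1 p.2)) (F p.1)
    simpa only [sq] using this
  rw [integral_const_mul, e1, e2] at h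
  linarith

/-- The spectral relation `∑_k (F - E_k F) = d F`, in terms of the coordinates in `K`. -/
def IsEigen (μ : Measure (ι → E)) (K : Finset ι) (d : ℝ) (F : (ι → E) → ℝ) : Prop :=
  (fun u => ∑ k ∈ K, coordDiff μ k F u) =ᵐ[μ] fun u => d * F u

/-- `D_k` commutes with every `D_l`, hence with their sum. -/
theorem IsEigen.coordDiff {K : Finset ι} {d : ℝ} {F : (ι → E) → ℝ} (h : IsEigen μ∞ K d F)
    (hF : Integrable F μ∞) (k : ι) : IsEigen μ∞ K d (coordDiff μ∞ k F) := by
  have h1 := coordDiff_congr k h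
  have h2 := coordDiff_finsetSum K k (F := fun l => IndepChaos.coordDiff μ∞ l F)
    fun l _ => integrable_coordDiff l hF
  have h3 : ∀ᵐ u ∂μ∞, ∀ l ∈ K, IndepChaos.coordDiff μ∞ k (IndepChaos.coordDiff μ∞ l F) u =
      IndepChaos.coordDiff μ∞ l (IndepChaos.coordDiff μ∞ k F) u :=
    (ae_ball_iff K.countable_toSet).2 fun l _ => coordDiff_comm k l hF
  filter_upwards [h1, h2, h3] with u e1 e2 e3
  rw [← Finset.sum_congr rfl e3, ← e2, e1, coordDiff_const_mul]

theorem sum_integral_coordDiff_mul_abs_sq_le {K : Finset ι} {d : ℝ} {F : (ι → E) → ℝ}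
    (h : IsEigen μ∞ K d F) (hF : MemLp F 4 μ∞) :
    ∑ l ∈ K, ∫ u, IndepChaos.coordDiff μ∞ l (fun v => F v * |F v|) u ^ 2 ∂μ∞ ≤
      4 / 3 * (d * ∫ u, F u ^ 4 ∂μ∞) := by
  refine (Finset.sum_le_sum fun l _ => integral_coordDiff_mul_abs_sq_le l hF).trans (le_of_eq ?_)
  rw [← Finset.mul_sum, ← integral_finsetSum _ fun l _ =>
    integrable_mul_pow_three (memLp_coordDiff (n := 4) l (by norm_num) hF) hF,
    ← integral_const_mul d]
  congr 1
  refine integral_congr_ae ?_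
  filter_upwards [h] with u hu
  rw [← Finset.sum_mul, hu]
  ring

/-- The second moment of the divergence of the field `k ↦ D_k F |D_k F|`. -/
theorem integral_sum_coordDiff_mul_abs_sq_le {K : Finset ι} {d : ℝ} {X : (ι → E) → ℝ}
    (h : IsEigen μ∞ K d X) (hX : Integrable X μ∞)
    (h4 : ∀ k ∈ K, MemLp (coordDiff μ∞ k X) 4 μ∞) :
    ∫ u, (∑ k ∈ K, coordDiff μ∞ k (fun v => coordDiff μ∞ k X v * |coordDiff μ∞ k X v|) u) ^ 2 ∂μ∞
      ≤ 4 / 3 * (d * ∑ k ∈ K, ∫ u, coordDiff μ∞ k X u ^ 4 ∂μ∞) := by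
  have hφ : ∀ k ∈ K, MemLp (fun v => coordDiff μ∞ k X v * |coordDiff μ∞ k X v|) 2 μ∞ :=
    fun k hk => memLp_two_mul_abs (h4 k hk)
  refine (integral_sum_sq_le K (fun k hk => memLp_coordDiff (n := 2) k two_ne_zero (hφ k hk))
    fun k hk => coordDiff_coordDiff k ((hφ k hk).integrable one_le_two)).trans ?_
  rw [Finset.mul_sum, Finset.mul_sum]
  refine Finset.sum_le_sum fun k hk => ?_
  refine (Finset.sum_le_sum fun l _ => ?_).trans
    (sum_integral_coordDiff_mul_abs_sq_le (h.coordDiff hX k) (h4 k hk))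
  have hl : MemLp (coordDiff μ∞ l fun v => coordDiff μ∞ k X v * |coordDiff μ∞ k X v|) 2 μ∞ :=
    memLp_coordDiff (n := 2) l two_ne_zero (hφ k hk)
  -- `D_l D_k = D_k D_l`, and the outer `D_k` is dropped since it contracts `L²`.
  refine le_trans (le_of_eq ?_) (integral_coordDiff_sq_le_integral_sq k hl)
  refine integral_congr_ae ?_
  filter_upwards [coordDiff_comm l k ((hφ k hk).integrable one_le_two)] with u hu
  rw [hu]

end Chaos

/-! ### The Mills ratio and the solution of Stein's equation for a half-line. -/

section Stein

/-- The distribution function of the standard normal law. -/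
noncomputable def stdCdf (x : ℝ) : ℝ := (gaussianReal 0 1).real (Set.Iic x)

theorem stdCdf_nonneg (x : ℝ) : 0 ≤ stdCdf x := measureReal_nonneg

theorem stdCdf_le_one (x : ℝ) : stdCdf x ≤ 1 := measureReal_le_one

theorem gaussianPDFReal_std (x : ℝ) :
    gaussianPDFReal 0 1 x = (√(2 * Real.pi))⁻¹ * Real.exp (-(x ^ 2 / 2)) := by
  simp [gaussianPDFReal, neg_div]

theorem stdCdf_eq_integral (x : ℝ) : stdCdf x = ∫ t in Set.Iic x, gaussianPDFReal 0 1 t := by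
  rw [stdCdf, Measure.real, gaussianReal_apply_eq_integral 0 one_ne_zero,
    ENNReal.toReal_ofReal (integral_nonneg fun t => gaussianPDFReal_nonneg 0 1 t)]

theorem hasDerivAt_stdCdf (x : ℝ) : HasDerivAt stdCdf (gaussianPDFReal 0 1 x) x := by
  have hc : Continuous (gaussianPDFReal 0 1) := by
    simp only [funext gaussianPDFReal_std]; fun_prop
  have hi := integrable_gaussianPDFReal 0 1
  have e : stdCdf = fun y => stdCdf 0 + ∫ t in (0 : ℝ)..y, gaussianPDFReal 0 1 t := by
    funext y
    rw [stdCdf_eq_integral, stdCdf_eq_integral,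
      ← intervalIntegral.integral_Iic_sub_Iic hi.integrableOn hi.integrableOn]
    ring
  rw [e]
  exact (hc.integral_hasStrictDerivAt 0 x).hasDerivAt.const_add _

theorem continuous_stdCdf : Continuous stdCdf :=
  continuous_iff_continuousAt.2 fun x => (hasDerivAt_stdCdf x).continuousAt

theorem stdCdf_neg (x : ℝ) : stdCdf (-x) = 1 - stdCdf x := by
  have hi := integrable_gaussianPDFReal 0 1
  have h1 := integral_add_compl (measurableSet_Iic (a := x)) hi
  rw [integral_gaussianPDFReal_eq_one 0 one_ne_zero, ← stdCdf_eq_integral, Set.compl_Iic] at h1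
  have h2 := integral_comp_neg_Iic (-x) (gaussianPDFReal 0 1)
  rw [neg_neg] at h2
  rw [stdCdf_eq_integral, ← eq_sub_of_add_eq' h1, ← h2]
  refine integral_congr_ae (ae_of_all _ fun t => ?_)
  simp [gaussianPDFReal_std]

theorem tendsto_stdCdf_atBot : Tendsto stdCdf atBot (𝓝 0) := by
  have h := tendsto_cdf_atBot (gaussianReal 0 1)
  exact h.congr fun x => cdf_eq_real _ x

/-- The ratio between the distribution function and the density of the standard normal law. -/
noncomputable def millsRatio (w : ℝ) : ℝ :=
  √(2 * Real.pi) * Real.exp (w ^ 2 / 2) * stdCdf w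

theorem hasDerivAt_millsRatio (w : ℝ) :
    HasDerivAt millsRatio (w * millsRatio w + 1) w := by
  have h1 : HasDerivAt (fun w : ℝ => w ^ 2 / 2) w w := by
    exact ((hasDerivAt_pow 2 w).div_const 2).congr_deriv (by norm_num)
  have h := (h1.exp.const_mul √(2 * Real.pi)).mul (hasDerivAt_stdCdf w)
  refine h.congr_deriv ?_
  have hs : √(2 * Real.pi) ≠ 0 := (Real.sqrt_pos.2 (by positivity)).ne'
  have he : Real.exp (w ^ 2 / 2) ≠ 0 := (Real.exp_pos _).ne'
  rw [gaussianPDFReal_std, Real.exp_neg, millsRatio]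
  field_simp

theorem millsRatio_nonneg (w : ℝ) : 0 ≤ millsRatio w :=
  mul_nonneg (by positivity) (stdCdf_nonneg w)

theorem tendsto_gaussianPDFReal_atBot : Tendsto (gaussianPDFReal 0 1) atBot (𝓝 0) := by
  have h1 : Tendsto (fun x : ℝ => -(x ^ 2 / 2)) atBot atBot := by
    refine tendsto_neg_atTop_atBot.comp (Tendsto.atTop_div_const two_pos ?_)
    have h := (tendsto_pow_atTop (α := ℝ) two_ne_zero).comp tendsto_neg_atBot_atTop
    exact h.congr fun x => by simp
  have h2 := (Real.tendsto_exp_atBot.comp h1).const_mul (√(2 * Real.pi))⁻¹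
  rw [mul_zero] at h2
  exact h2.congr fun x => (gaussianPDFReal_std x).symm

theorem hasDerivAt_gaussianPDFReal (w : ℝ) :
    HasDerivAt (gaussianPDFReal 0 1) (-(w * gaussianPDFReal 0 1 w)) w := by
  have h1 : HasDerivAt (fun w : ℝ => -(w ^ 2 / 2)) (-w) w := by
    exact ((hasDerivAt_pow 2 w).div_const 2).neg.congr_deriv (by norm_num)
  have h := h1.exp.const_mul (√(2 * Real.pi))⁻¹
  rw [funext gaussianPDFReal_std]
  refine h.congr_deriv ?_
  ring

theorem millsRatio_mul_pdf (w : ℝ) : millsRatio w * gaussianPDFReal 0 1 w = stdCdf w := by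
  have hs : √(2 * Real.pi) ≠ 0 := (Real.sqrt_pos.2 (by positivity)).ne'
  have he : Real.exp (w ^ 2 / 2) ≠ 0 := (Real.exp_pos _).ne'
  rw [gaussianPDFReal_std, Real.exp_neg, millsRatio]
  field_simp

/-- A nondecreasing function that starts from 0 at `-∞` is nonnegative. Both Mills ratio bounds are
reduced to this. -/
theorem nonneg_of_deriv_nonneg_of_tendsto {q q' : ℝ → ℝ} {a : ℝ}
    (h : ∀ w < a, HasDerivAt q (q' w) w) (h' : ∀ w < a, 0 ≤ q' w)
    (hlim : Tendsto q atBot (𝓝 0)) {w : ℝ} (hw : w < a) : 0 ≤ q w := by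
  have hmono : MonotoneOn q (Set.Iio a) := by
    refine monotoneOn_of_deriv_nonneg (convex_Iio a)
      (fun x hx => (h x hx).continuousAt.continuousWithinAt) ?_ ?_
    · rw [interior_Iio]
      exact fun x hx => (h x hx).differentiableAt.differentiableWithinAt
    · rw [interior_Iio]
      intro x hx
      rw [(h x hx).deriv]
      exact h' x hx
  refine le_of_tendsto hlim ?_
  filter_upwards [eventually_le_atBot w] with v hv
  exact hmono (lt_of_le_of_lt hv hw) hw hv

/-- The upper bound `ψ(w) ≤ 1 / |w|` for the Mills ratio. -/
theorem neg_one_le_mul_millsRatio (w : ℝ) : 0 ≤ w * millsRatio w + 1 := by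
  rcases le_or_gt 0 w with hw | hw
  · have := mul_nonneg hw (millsRatio_nonneg w)
    linarith
  have hp := gaussianPDFReal_pos 0 1 w one_ne_zero
  have h := nonneg_of_deriv_nonneg_of_tendsto (a := 0)
    -- The derivative of `φ(w)/w` is `-φ(w) - φ(w)/w²`, so only `φ(w)/w²` survives.
    (q := fun w => -(stdCdf w + gaussianPDFReal 0 1 w * w⁻¹))
    (q' := fun w => gaussianPDFReal 0 1 w * (w ^ 2)⁻¹) (fun w hw => ?_)
    (fun w _ => mul_nonneg (gaussianPDFReal_nonneg 0 1 w) (by positivity)) ?_ hw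
  · rw [← millsRatio_mul_pdf w] at h
    have h2 : gaussianPDFReal 0 1 w * (millsRatio w + w⁻¹) ≤ 0 := by linarith
    have h3 : millsRatio w + w⁻¹ ≤ 0 := nonpos_of_mul_nonpos_right h2 hp
    have h4 : w * (millsRatio w + w⁻¹) = w * millsRatio w + 1 := by
      rw [mul_add, mul_inv_cancel₀ hw.ne]
    rw [← h4]
    exact mul_nonneg_of_nonpos_of_nonpos hw.le h3
  · refine ((hasDerivAt_stdCdf w).add
      ((hasDerivAt_gaussianPDFReal w).mul (hasDerivAt_inv hw.ne))).neg.congr_deriv ?_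
    have := hw.ne
    field_simp
    ring
  · have h1 := tendsto_gaussianPDFReal_atBot.mul (tendsto_inv_atBot_zero (𝕜 := ℝ))
    have h2 := (tendsto_stdCdf_atBot.add h1).neg
    simpa using h2

/-- The lower bound `ψ(w) ≥ |w| / (1 + w²)` for the Mills ratio. -/
theorem millsRatio_lower (w : ℝ) : 0 ≤ millsRatio w + w * (w * millsRatio w + 1) := by
  have hp := gaussianPDFReal_pos 0 1 w one_ne_zero
  have h := nonneg_of_deriv_nonneg_of_tendsto (a := w + 1) (w := w)
    -- Here `Φ(w) + φ(w) w/(1 + w²)` has derivative `2φ(w)/(1 + w²)²`.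
    (q := fun w => stdCdf w + gaussianPDFReal 0 1 w * (w * (1 + w ^ 2)⁻¹))
    (q' := fun w => 2 * gaussianPDFReal 0 1 w * ((1 + w ^ 2) ^ 2)⁻¹) (fun w _ => ?_)
    (fun w _ => mul_nonneg (mul_nonneg two_pos.le (gaussianPDFReal_nonneg 0 1 w))
      (by positivity)) ?_ (by linarith)
  · rw [← millsRatio_mul_pdf w] at h
    have h1 : (1 + w ^ 2) ≠ 0 := by positivity
    have h2 : millsRatio w * gaussianPDFReal 0 1 w + gaussianPDFReal 0 1 w * (w * (1 + w ^ 2)⁻¹) =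
        gaussianPDFReal 0 1 w * (1 + w ^ 2)⁻¹ *
          (millsRatio w + w * (w * millsRatio w + 1)) := by
      field_simp
      ring
    rw [h2] at h
    exact nonneg_of_mul_nonneg_right h (by positivity)
  · have hne : (1 + w ^ 2) ≠ 0 := by positivity
    have h1 : HasDerivAt (fun w : ℝ => 1 + w ^ 2) (2 * w) w := by
      have := (hasDerivAt_pow 2 w).const_add 1
      simpa using this
    refine ((hasDerivAt_stdCdf w).add ((hasDerivAt_gaussianPDFReal w).mul
      ((hasDerivAt_id w).mul (h1.inv hne)))).congr_deriv ?_
    simp only [id, Pi.inv_apply, Pi.mul_apply]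
    field_simp
    ring
  · have h1 : Tendsto (fun w : ℝ => gaussianPDFReal 0 1 w * (w * (1 + w ^ 2)⁻¹)) atBot (𝓝 0) := by
      refine squeeze_zero_norm (fun w => ?_) tendsto_gaussianPDFReal_atBot
      rw [norm_mul, Real.norm_of_nonneg (gaussianPDFReal_nonneg 0 1 w)]
      refine mul_le_of_le_one_right (gaussianPDFReal_nonneg 0 1 w) ?_
      rw [Real.norm_eq_abs, abs_mul, abs_of_pos (by positivity : 0 < (1 + w ^ 2)⁻¹),
        ← div_eq_mul_inv, div_le_one (by positivity)]
      nlinarith [sq_nonneg (|w| - 1), sq_abs w]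
    simpa using tendsto_stdCdf_atBot.add h1

/-- With `ψ' = wψ + 1`, the derivative of `wψ` is `ψ + w(wψ + 1)`, which is the quantity bounded
below in `millsRatio_lower`. -/
theorem monotone_mul_millsRatio : Monotone fun w => w * millsRatio w := by
  have h : ∀ w, HasDerivAt (fun w => w * millsRatio w)
      (millsRatio w + w * (w * millsRatio w + 1)) w := fun w =>
    ((hasDerivAt_id w).mul (hasDerivAt_millsRatio w)).congr_deriv (by simp)
  exact monotone_of_deriv_nonneg (fun w => (h w).differentiableAt) fun w => by
    rw [(h w).deriv]; exact millsRatio_lower w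

/-- The solution of the Stein equation `g'(w) - w g(w) = 1_{w ≤ x} - Φ(x)`. -/
noncomputable def steinSol (x w : ℝ) : ℝ :=
  if w < x then (1 - stdCdf x) * millsRatio w else stdCdf x * millsRatio (-w)

/-- The derivative of `steinSol x`, as given by the Stein equation. -/
noncomputable def steinDeriv (x w : ℝ) : ℝ :=
  w * steinSol x w + (if w ≤ x then 1 else 0) - stdCdf x

/-- A nondecreasing function that controls the oscillations of `steinDeriv x`. -/
noncomputable def steinOsc (x w : ℝ) : ℝ :=
  w * steinSol x w + (if w ≤ x then 0 else 1) - stdCdf x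

theorem steinSol_of_le {x w : ℝ} (h : w ≤ x) : steinSol x w = (1 - stdCdf x) * millsRatio w := by
  rcases h.lt_or_eq with h | rfl
  · simp [steinSol, h]
  · simp only [steinSol, lt_irrefl, if_false, millsRatio, stdCdf_neg, neg_sq]
    ring

theorem steinSol_of_ge {x w : ℝ} (h : x ≤ w) : steinSol x w = stdCdf x * millsRatio (-w) := by
  simp [steinSol, not_lt.2 h]

/-- On each side of `x` this is a nonnegative multiple of `wψ(w)` or of `wψ(-w)`, both
nondecreasing, and the two formulas agree at `x`. -/
theorem monotone_mul_steinSol (x : ℝ) : Monotone fun w => w * steinSol x w := by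
  have h1 : MonotoneOn (fun w => w * steinSol x w) (Set.Iic x) := by
    intro a ha b hb hab
    simp only [steinSol_of_le ha, steinSol_of_le hb]
    have := mul_le_mul_of_nonneg_left (monotone_mul_millsRatio hab)
      (sub_nonneg.2 (stdCdf_le_one x))
    simp only at this
    linarith
  have h2 : MonotoneOn (fun w => w * steinSol x w) (Set.Ici x) := by
    intro a ha b hb hab
    simp only [steinSol_of_ge ha, steinSol_of_ge hb]
    have := mul_le_mul_of_nonneg_left (monotone_mul_millsRatio (neg_le_neg hab)) (stdCdf_nonneg x)
    simp only at this
    linarith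
  exact h1.Iic_union_Ici h2

/-- Monotonicity allows `w` to be replaced by `max w x`, where the right-hand formula applies and
`-vψ(v) ≤ 1` at `v = -(max w x)` gives the bound. -/
theorem mul_steinSol_le (x w : ℝ) : w * steinSol x w ≤ stdCdf x := by
  refine (monotone_mul_steinSol x (le_max_left w x)).trans ?_
  simp only
  rw [steinSol_of_ge (le_max_right w x)]
  have := mul_nonneg (stdCdf_nonneg x) (neg_one_le_mul_millsRatio (-(max w x)))
  linarith

theorem neg_le_mul_steinSol (x w : ℝ) : -(1 - stdCdf x) ≤ w * steinSol x w := by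
  refine le_trans ?_ (monotone_mul_steinSol x (min_le_left w x))
  simp only
  rw [steinSol_of_le (min_le_right w x)]
  have := mul_nonneg (sub_nonneg.2 (stdCdf_le_one x)) (neg_one_le_mul_millsRatio (min w x))
  linarith

theorem abs_steinDeriv_le (x w : ℝ) : |steinDeriv x w| ≤ 1 := by
  have h1 := mul_steinSol_le x w
  have h2 := neg_le_mul_steinSol x w
  have h3 := stdCdf_nonneg x
  have h4 := stdCdf_le_one x
  rw [steinDeriv, abs_le]
  split_ifs <;> constructor <;> linarith

theorem abs_steinOsc_le (x w : ℝ) : |steinOsc x w| ≤ 1 := by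
  have h1 := mul_steinSol_le x w
  have h2 := neg_le_mul_steinSol x w
  have h3 := stdCdf_nonneg x
  have h4 := stdCdf_le_one x
  rw [steinOsc, abs_le]
  split_ifs <;> constructor <;> linarith

/-- Unlike in `steinDeriv`, the jump at `x` is upward, in the same direction as the growth of `w
g(w)`. -/
theorem monotone_steinOsc (x : ℝ) : Monotone (steinOsc x) := by
  intro a b hab
  have h := monotone_mul_steinSol x hab
  simp only at h
  simp only [steinOsc]
  split_ifs with h1 h2 h2 <;> linarith

theorem continuous_millsRatio : Continuous millsRatio :=
  continuous_iff_continuousAt.2 fun w => (hasDerivAt_millsRatio w).continuousAt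

theorem continuous_steinSol (x : ℝ) : Continuous (steinSol x) := by
  have e : steinSol x = fun w =>
      if w ≤ x then (1 - stdCdf x) * millsRatio w else stdCdf x * millsRatio (-w) := by
    funext w
    split_ifs with h
    · exact steinSol_of_le h
    · exact steinSol_of_ge (not_le.1 h).le
  have hc := continuous_millsRatio
  rw [e]
  refine Continuous.if_le (by fun_prop) (by fun_prop) continuous_id continuous_const ?_
  rintro w rfl
  exact (steinSol_of_le le_rfl).symm.trans (steinSol_of_ge le_rfl)

/-- At `w = x` the right derivative uses the branch beyond `x`, hence the strict inequality here as
opposed to `steinDeriv`. Right derivatives are enough for the mean value inequality. -/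
theorem hasDerivWithinAt_steinSol (x w : ℝ) :
    HasDerivWithinAt (steinSol x)
      (w * steinSol x w + (if w < x then 1 else 0) - stdCdf x) (Set.Ici w) w := by
  split_ifs with h
  · have h1 := (hasDerivAt_millsRatio w).const_mul (1 - stdCdf x)
    have h2 : HasDerivAt (steinSol x) _ w := h1.congr_of_eventuallyEq (by
      filter_upwards [eventually_le_nhds h] with v hv
      exact steinSol_of_le hv)
    refine h2.hasDerivWithinAt.congr_deriv ?_
    rw [steinSol_of_le h.le]
    ring
  · rw [not_lt] at h
    have h1 : HasDerivAt (fun w => stdCdf x * millsRatio (-w)) _ w :=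
      ((hasDerivAt_millsRatio (-w)).scomp w (hasDerivAt_neg w)).const_mul (stdCdf x)
    have h2 := h1.hasDerivWithinAt (s := Set.Ici w)
    have h3 : HasDerivWithinAt (steinSol x) _ (Set.Ici w) w :=
      h2.congr (fun v hv => steinSol_of_ge (h.trans hv)) (steinSol_of_ge h)
    refine h3.congr_deriv ?_
    rw [steinSol_of_ge h, smul_eq_mul]
    ring

theorem abs_steinSol_sub_sub_le_of_le {x a b c C : ℝ} (hab : a ≤ b)
    (h : ∀ s ∈ Set.Ico a b, |s * steinSol x s + (if s < x then 1 else 0) - stdCdf x - c| ≤ C) :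
    |steinSol x b - steinSol x a - c * (b - a)| ≤ C * (b - a) := by
  have h1 := norm_image_sub_le_of_norm_deriv_right_le_segment (a := a) (b := b) (C := C)
    (f := fun s => steinSol x s - c * s)
    (f' := fun s => s * steinSol x s + (if s < x then 1 else 0) - stdCdf x - c)
    ((continuous_steinSol x).sub (continuous_const.mul continuous_id)).continuousOn
    (fun s _ => ((hasDerivWithinAt_steinSol x s).sub
      ((hasDerivAt_id s).const_mul c).hasDerivWithinAt).congr_deriv (by simp))
    (fun s hs => by simpa using h s hs) b ⟨hab, le_rfl⟩
  rw [Real.norm_eq_abs] at h1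
  convert h1 using 2
  ring

/-- First order expansion of the Stein solution. -/
theorem abs_steinSol_sub_sub_le (x a b : ℝ) :
    |steinSol x b - steinSol x a - steinDeriv x a * (b - a)| ≤
      (steinOsc x b - steinOsc x a) * (b - a) := by
  rcases le_total a b with hab | hab
  -- For `s` between the endpoints, the difference between the slope at `s` and `steinDeriv x a` is
  -- an increment of the nondecreasing `w g(w)` plus an indicator change bounded by the jump of
  -- `steinOsc`. Their signs may differ, but the sum of their sizes is at most the increment of
  -- `steinOsc`.
  · refine abs_steinSol_sub_sub_le_of_le hab fun s hs => ?_
    have h1 := monotone_mul_steinSol x hs.1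
    have h2 := monotone_mul_steinSol x hs.2.le
    simp only at h1 h2
    simp only [steinDeriv, steinOsc]
    have h3 := hs.1
    have h4 := hs.2
    rw [abs_le]
    split_ifs <;> constructor <;> linarith
  · have h := abs_steinSol_sub_sub_le_of_le (x := x) (c := steinDeriv x a)
      (C := steinOsc x a - steinOsc x b) hab fun s hs => ?_
    · rw [abs_sub_comm] at h
      convert h using 1
      · congr 1; ring
      · ring
    have h1 := monotone_mul_steinSol x hs.1
    have h2 := monotone_mul_steinSol x hs.2.le
    simp only at h1 h2
    simp only [steinDeriv, steinOsc]
    have h3 := hs.1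
    have h4 := hs.2
    rw [abs_le]
    split_ifs <;> constructor <;> linarith

/-- The slope of the solution is at most 1 in absolute value. The linear growth is used only to put
`g(X)` in `L²`. -/
theorem abs_steinSol_le (x w : ℝ) : |steinSol x w| ≤ |steinSol x 0| + |w| := by
  have key : ∀ a b : ℝ, a ≤ b → |steinSol x b - steinSol x a| ≤ b - a := fun a b hab => by
    have h := abs_steinSol_sub_sub_le_of_le (x := x) (c := 0) (C := 1) hab fun s _ => by
      have h1 := mul_steinSol_le x s
      have h2 := neg_le_mul_steinSol x s
      have h3 := stdCdf_nonneg x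
      have h4 := stdCdf_le_one x
      rw [abs_le]
      split_ifs <;> constructor <;> linarith
    simpa using h
  have h : |steinSol x w - steinSol x 0| ≤ |w| := by
    rcases le_total 0 w with hw | hw
    · simpa [abs_of_nonneg hw] using key 0 w hw
    · have := key w 0 hw
      rw [abs_sub_comm, abs_of_nonpos hw]
      simpa using this
  have h2 := abs_sub_abs_le_abs_sub (steinSol x w) (steinSol x 0)
  linarith

theorem measurable_steinDeriv (x : ℝ) : Measurable (steinDeriv x) :=
  ((measurable_id.mul (continuous_steinSol x).measurable).add
    (Measurable.ite measurableSet_Iic measurable_const measurable_const)).sub_const _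

end Stein

/-! ### Stein's method for an eigenvector depending on finitely many coordinates. -/

section NormalApproximation

variable {ι E : Type*} [MeasurableSpace E] {ν : Measure E} [IsProbabilityMeasure ν]

local notation "μ∞" => Measure.infinitePi (fun _ : ι => ν)

/-- The conditional variance of `X` given all coordinates but `k`. -/
noncomputable def coordVar (μ : Measure (ι → E)) (k : ι) (X : (ι → E) → ℝ) : (ι → E) → ℝ :=
  avg μ {k} fun v => coordDiff μ k X v ^ 2

theorem integrable_coordVar {X : (ι → E) → ℝ} (k : ι) (hX : MemLp X 2 μ∞) :
    Integrable (coordVar μ∞ k X) μ∞ :=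
  integrable_avg {k} (memLp_coordDiff (n := 2) k two_ne_zero hX).integrable_sq

theorem integrable_mul_of_memLp_two {α : Type*} [MeasurableSpace α] {μ : Measure α} {f g : α → ℝ}
    (hf : MemLp f 2 μ) (hg : MemLp g 2 μ) : Integrable (fun x => f x * g x) μ :=
  hf.integrable_mul hg

theorem integrable_mul_of_abs_le {α : Type*} [MeasurableSpace α] {μ : Measure α} {f g : α → ℝ}
    {c : ℝ} (hf : Integrable f μ) (hg : AEStronglyMeasurable g μ) (h : ∀ x, |g x| ≤ c) :
    Integrable (fun x => f x * g x) μ :=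
  hf.mul_bdd hg (ae_of_all _ fun x => (Real.norm_eq_abs (g x)).le.trans (h x))

/-- The Stein expansion with respect to one coordinate. -/
theorem abs_integral_coordDiff_mul_steinSol_sub_le (x : ℝ) {X : (ι → E) → ℝ} (k : ι)
    (hX : MemLp X 2 μ∞) (h4 : MemLp (coordDiff μ∞ k X) 4 μ∞) :
    |∫ u, coordDiff μ∞ k X u * steinSol x (X u) ∂μ∞ -
        ∫ u, coordVar μ∞ k X u * steinDeriv x (X u) ∂μ∞| ≤
      2 * ∫ u, coordDiff μ∞ k (fun v => coordDiff μ∞ k X v * |coordDiff μ∞ k X v|) u *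
        steinOsc x (X u) ∂μ∞ := by
  set F := coordDiff μ∞ k X with hF
  set π := μ∞.prod μ∞
  have hF2 : MemLp F 2 μ∞ := memLp_coordDiff (n := 2) k two_ne_zero hX
  have hF1 : Integrable F μ∞ := hF2.integrable one_le_two
  have hg : MemLp (fun u => steinSol x (X u)) 2 μ∞ := by
    refine ((memLp_const |steinSol x 0|).add hX.norm).mono
      ((continuous_steinSol x).comp_aestronglyMeasurable hX.1) (ae_of_all _ fun u => ?_)
    simp only [Real.norm_eq_abs, Pi.add_apply]
    rw [abs_of_nonneg (by positivity : 0 ≤ |steinSol x 0| + |X u|)]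
    exact abs_steinSol_le x (X u)
  have hq : AEStronglyMeasurable (fun u => steinDeriv x (X u)) μ∞ :=
    ((measurable_steinDeriv x).comp_aemeasurable hX.1.aemeasurable).aestronglyMeasurable
  have hh : AEStronglyMeasurable (fun u => steinOsc x (X u)) μ∞ :=
    ((monotone_steinOsc x).measurable.comp_aemeasurable hX.1.aemeasurable).aestronglyMeasurable
  have hh2 : MemLp (fun u => steinOsc x (X u)) 2 μ∞ :=
    MemLp.of_bound hh 1 (ae_of_all _ fun u => abs_steinOsc_le x (X u))
  have hφ := memLp_two_mul_abs h4
  have hFr := memLp_comp_resample {k} hF2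
  have hFf : MemLp (fun p : (ι → E) × (ι → E) => F p.1) 2 π := memLp_comp_resample_fst hF2
  have hgr := memLp_comp_resample {k} hg
  have hgf := memLp_comp_resample_fst hg
  have hqf : AEStronglyMeasurable (fun p : (ι → E) × (ι → E) => steinDeriv x (X p.1)) π := hq.comp_fst
  have hhf : AEStronglyMeasurable (fun p : (ι → E) × (ι → E) => steinOsc x (X p.1)) π := hh.comp_fst
  have hhr : AEStronglyMeasurable
      (fun p : (ι → E) × (ι → E) => steinOsc x (X (resample {k} p.1 p.2))) π :=
    aestronglyMeasurable_comp_resample {k} hh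
  have havg : avg μ∞ {k} F =ᵐ[μ∞] 0 := avg_coordDiff (Set.mem_singleton k) (hX.integrable one_le_two)
  -- the terms of the expansion
  have i1 : Integrable (fun p : (ι → E) × (ι → E) => F (resample {k} p.1 p.2) *
      steinSol x (X (resample {k} p.1 p.2))) π := hFr.integrable_mul hgr
  have i2 : Integrable (fun p : (ι → E) × (ι → E) => F (resample {k} p.1 p.2) *
      steinSol x (X p.1)) π := hFr.integrable_mul hgf
  have i3 : Integrable (fun p : (ι → E) × (ι → E) => F (resample {k} p.1 p.2) ^ 2 *
      steinDeriv x (X p.1)) π :=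
    integrable_mul_of_abs_le hFr.integrable_sq hqf fun p => abs_steinDeriv_le x _
  have i4 : Integrable (fun p : (ι → E) × (ι → E) => F (resample {k} p.1 p.2) *
      (F p.1 * steinDeriv x (X p.1))) π := by
    have := integrable_mul_of_abs_le (hFr.integrable_mul hFf) hqf fun p => abs_steinDeriv_le x _
    refine this.congr (ae_of_all _ fun p => ?_)
    simp only [Pi.mul_apply, mul_assoc]
  have e1 : ∫ p, F (resample {k} p.1 p.2) * steinSol x (X (resample {k} p.1 p.2)) ∂π =
      ∫ u, F u * steinSol x (X u) ∂μ∞ :=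
    integral_comp_resample (F := fun u => F u * steinSol x (X u)) {k} (hF2.1.mul hg.1)
  -- Given the original configuration, the resampled `D_k X` has mean zero; the same reason gives
  -- `e4`.
  have e2 : ∫ p, F (resample {k} p.1 p.2) * steinSol x (X p.1) ∂π = 0 := by
    rw [← integral_avg_mul {k} (W := fun u => steinSol x (X u)) i2]
    refine integral_eq_zero_of_ae ?_
    filter_upwards [havg] with u hu
    simp [hu]
  have e3 : ∫ p, F (resample {k} p.1 p.2) ^ 2 * steinDeriv x (X p.1) ∂π =
      ∫ u, coordVar μ∞ k X u * steinDeriv x (X u) ∂μ∞ :=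
    (integral_avg_mul {k} (Y := fun u => F u ^ 2) (W := fun u => steinDeriv x (X u)) i3).symm
  have e4 : ∫ p, F (resample {k} p.1 p.2) * (F p.1 * steinDeriv x (X p.1)) ∂π = 0 := by
    rw [← integral_avg_mul {k} (W := fun u => F u * steinDeriv x (X u)) i4]
    refine integral_eq_zero_of_ae ?_
    filter_upwards [havg] with u hu
    simp [hu]
  have e : ∫ u, F u * steinSol x (X u) ∂μ∞ - ∫ u, coordVar μ∞ k X u * steinDeriv x (X u) ∂μ∞ =
      ∫ p, F (resample {k} p.1 p.2) * (steinSol x (X (resample {k} p.1 p.2)) -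
        steinSol x (X p.1) - steinDeriv x (X p.1) * (X (resample {k} p.1 p.2) - X p.1)) ∂π := by
    have e5 : (fun p : (ι → E) × (ι → E) => F (resample {k} p.1 p.2) *
        (steinSol x (X (resample {k} p.1 p.2)) -
        steinSol x (X p.1) - steinDeriv x (X p.1) * (X (resample {k} p.1 p.2) - X p.1))) =
        fun p => (F (resample {k} p.1 p.2) * steinSol x (X (resample {k} p.1 p.2)) -
          F (resample {k} p.1 p.2) * steinSol x (X p.1)) -
          (F (resample {k} p.1 p.2) ^ 2 * steinDeriv x (X p.1) -
          F (resample {k} p.1 p.2) * (F p.1 * steinDeriv x (X p.1))) := by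
      funext p
      rw [← coordDiff_resample_sub μ∞ k X]
      simp only [← hF]
      ring
    have i12 : Integrable (fun p : (ι → E) × (ι → E) => F (resample {k} p.1 p.2) *
        steinSol x (X (resample {k} p.1 p.2)) - F (resample {k} p.1 p.2) * steinSol x (X p.1)) π :=
      i1.sub i2
    have i34 : Integrable (fun p : (ι → E) × (ι → E) =>
        F (resample {k} p.1 p.2) ^ 2 * steinDeriv x (X p.1) -
          F (resample {k} p.1 p.2) * (F p.1 * steinDeriv x (X p.1))) π := i3.sub i4
    rw [e5, integral_sub i12 i34, integral_sub i1 i2, integral_sub i3 i4,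
      e1, e2, e3, e4]
    ring
  rw [e]
  -- the remainder
  have j0 : Integrable (fun p : (ι → E) × (ι → E) =>
      |F (resample {k} p.1 p.2)| * (F (resample {k} p.1 p.2) - F p.1)) π :=
    hFr.norm.integrable_mul (hFr.sub hFf)
  have j1 : Integrable (fun p : (ι → E) × (ι → E) =>
      |F (resample {k} p.1 p.2)| * (F (resample {k} p.1 p.2) - F p.1) *
      (steinOsc x (X (resample {k} p.1 p.2)) - steinOsc x (X p.1))) π :=
    integrable_mul_of_abs_le (c := 2) j0 (hhr.sub hhf) fun p => by
      have h1 := abs_steinOsc_le x (X (resample {k} p.1 p.2))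
      have h2 := abs_steinOsc_le x (X p.1)
      have h3 := abs_sub (steinOsc x (X (resample {k} p.1 p.2))) (steinOsc x (X p.1))
      linarith
  have j2 : Integrable (fun p : (ι → E) × (ι → E) =>
      |F p.1| * (F p.1 - F (resample {k} p.1 p.2)) *
      (steinOsc x (X p.1) - steinOsc x (X (resample {k} p.1 p.2)))) π := by
    have h := (measurePreserving_resample_swap ν {k}).integrable_comp_of_integrable j1
    simpa only [Function.comp_def, resample_swap_swap] using h
  -- Exchanging the two copies rewrites the remainder with `|F|` in place of the resampled `|F|`;
  -- adding both versions produces the factor `|F'| + |F|`.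
  have j3 := integral_comp_resample_swap {k} (H := fun a b => |F a| * (F a - F b) *
      (steinOsc x (X a) - steinOsc x (X b))) j2.1
  obtain ⟨j4, j5⟩ := integral_coordDiff_mul k (Y := fun v => F v * |F v|)
    (W := fun v => steinOsc x (X v)) (hφ.integrable_mul hh2)
    ((memLp_comp_resample {k} hφ).integrable_mul (memLp_comp_resample_fst hh2))
  rw [← j5]
  refine (abs_integral_le_integral_abs).trans ?_
  have hb : ∫ p, |F (resample {k} p.1 p.2) * (steinSol x (X (resample {k} p.1 p.2)) -
        steinSol x (X p.1) - steinDeriv x (X p.1) * (X (resample {k} p.1 p.2) - X p.1))| ∂π ≤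
      ∫ p, |F (resample {k} p.1 p.2)| * (F (resample {k} p.1 p.2) - F p.1) *
      (steinOsc x (X (resample {k} p.1 p.2)) - steinOsc x (X p.1)) ∂π := by
    refine integral_mono_of_nonneg (ae_of_all _ fun p => abs_nonneg _) j1 (ae_of_all _ fun p => ?_)
    simp only
    rw [abs_mul, mul_assoc, coordDiff_resample_sub μ∞ k X, mul_comm (X _ - X _)]
    exact mul_le_mul_of_nonneg_left (abs_steinSol_sub_sub_le x _ _) (abs_nonneg _)
  have hs : ∫ p, |F (resample {k} p.1 p.2)| * (F (resample {k} p.1 p.2) - F p.1) *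
      (steinOsc x (X (resample {k} p.1 p.2)) - steinOsc x (X p.1)) ∂π +
      ∫ p, |F (resample {k} p.1 p.2)| * (F (resample {k} p.1 p.2) - F p.1) *
      (steinOsc x (X (resample {k} p.1 p.2)) - steinOsc x (X p.1)) ∂π ≤
      2 * ∫ p, (F (resample {k} p.1 p.2) * |F (resample {k} p.1 p.2)| - F p.1 * |F p.1|) *
        (steinOsc x (X (resample {k} p.1 p.2)) - steinOsc x (X p.1)) ∂π := by
    nth_rewrite 2 [j3]
    rw [← integral_add j1 j2, ← integral_const_mul]
    refine integral_mono (j1.add j2) (j4.const_mul 2) fun p => ?_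
    -- `X`, `steinOsc x (X ·)` and `F` move in the same direction under resampling, so one ordering
    -- settles the signs of all increments.
    rcases le_total (X p.1) (X (resample {k} p.1 p.2)) with hle | hle
    · have h1 := monotone_steinOsc x hle
      have h2 : F p.1 ≤ F (resample {k} p.1 p.2) := by
        have := coordDiff_resample_sub μ∞ k X p.1 p.2
        simp only [← hF] at this
        linarith
      have h3 := mul_le_mul_of_nonneg_right (abs_add_abs_mul_sub_le h2) (sub_nonneg.2 h1)
      linarith
    · have h1 := monotone_steinOsc x hle
      have h2 : F (resample {k} p.1 p.2) ≤ F p.1 := by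
        have := coordDiff_resample_sub μ∞ k X p.1 p.2
        simp only [← hF] at this
        linarith
      have h3 := mul_le_mul_of_nonneg_right (abs_add_abs_mul_sub_le h2) (sub_nonneg.2 h1)
      linarith
  linarith

/-- Nonnegativity of the variance of `|Z|`. -/
theorem integral_abs_le_sqrt_integral_sq {α : Type*} [MeasurableSpace α] {μ : Measure α}
    [IsProbabilityMeasure μ] {Z : α → ℝ} (hZ : MemLp Z 2 μ) :
    ∫ u, |Z u| ∂μ ≤ √(∫ u, Z u ^ 2 ∂μ) := by
  refine Real.le_sqrt_of_sq_le ?_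
  have hZ' : MemLp (fun u => |Z u|) 2 μ := hZ.norm
  have h1 := variance_nonneg (fun u => |Z u|) μ
  rw [variance_eq_sub hZ'] at h1
  simp only [Pi.pow_apply, sq_abs] at h1
  linarith

/-- Berry-Esseen bound for a functional in an eigenspace of the number operator, when finitely many
coordinates are involved. -/
theorem abs_measureReal_le_sub_stdCdf_le {K : Finset ι} {d : ℝ} (hd : 0 < d) {X : (ι → E) → ℝ}
    (hE : IsEigen μ∞ K d X) (hX : MemLp X 2 μ∞) (h4 : ∀ k ∈ K, MemLp (coordDiff μ∞ k X) 4 μ∞)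
    (x : ℝ) :
    |μ∞.real {u | X u ≤ x} - stdCdf x| ≤ ∫ u, |1 - d⁻¹ * ∑ k ∈ K, coordVar μ∞ k X u| ∂μ∞ +
      2 * d⁻¹ * √(4 / 3 * (d * ∑ k ∈ K, ∫ u, coordDiff μ∞ k X u ^ 4 ∂μ∞)) := by
  set Z : (ι → E) → ℝ := fun u =>
    ∑ k ∈ K, coordDiff μ∞ k (fun v => coordDiff μ∞ k X v * |coordDiff μ∞ k X v|) u with hZdef
  have hφ : ∀ k ∈ K, MemLp (coordDiff μ∞ k (fun v => coordDiff μ∞ k X v * |coordDiff μ∞ k X v|))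
      2 μ∞ := fun k hk => memLp_coordDiff (n := 2) k two_ne_zero (memLp_two_mul_abs (h4 k hk))
  have hZ : MemLp Z 2 μ∞ := memLp_finsetSum K hφ
  have hF2 : ∀ k, MemLp (coordDiff μ∞ k X) 2 μ∞ := fun k =>
    memLp_coordDiff (n := 2) k two_ne_zero hX
  have hg : MemLp (fun u => steinSol x (X u)) 2 μ∞ := by
    refine ((memLp_const |steinSol x 0|).add hX.norm).mono
      ((continuous_steinSol x).comp_aestronglyMeasurable hX.1) (ae_of_all _ fun u => ?_)
    simp only [Real.norm_eq_abs, Pi.add_apply]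
    rw [abs_of_nonneg (by positivity : 0 ≤ |steinSol x 0| + |X u|)]
    exact abs_steinSol_le x (X u)
  have hq : AEStronglyMeasurable (fun u => steinDeriv x (X u)) μ∞ :=
    ((measurable_steinDeriv x).comp_aemeasurable hX.1.aemeasurable).aestronglyMeasurable
  have hqi : Integrable (fun u => steinDeriv x (X u)) μ∞ :=
    Integrable.of_bound hq 1 (ae_of_all _ fun u => abs_steinDeriv_le x (X u))
  have hh : AEStronglyMeasurable (fun u => steinOsc x (X u)) μ∞ :=
    ((monotone_steinOsc x).measurable.comp_aemeasurable hX.1.aemeasurable).aestronglyMeasurable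
  have hh2 : MemLp (fun u => steinOsc x (X u)) 2 μ∞ :=
    MemLp.of_bound hh 1 (ae_of_all _ fun u => abs_steinOsc_le x (X u))
  have hV : Integrable (fun u => ∑ k ∈ K, coordVar μ∞ k X u) μ∞ :=
    integrable_finsetSum K fun k _ => integrable_coordVar k hX
  have hVq : ∀ k ∈ K, Integrable (fun u => coordVar μ∞ k X u * steinDeriv x (X u)) μ∞ :=
    fun k _ => integrable_mul_of_abs_le (integrable_coordVar k hX) hq
      fun u => abs_steinDeriv_le x _
  have hXg : Integrable (fun u => X u * steinSol x (X u)) μ∞ := hX.integrable_mul hg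
  -- Stein's equation, integrated.
  have e1 : μ∞.real {u | X u ≤ x} - stdCdf x =
      ∫ u, steinDeriv x (X u) ∂μ∞ - ∫ u, X u * steinSol x (X u) ∂μ∞ := by
    have hms : NullMeasurableSet {u | X u ≤ x} μ∞ :=
      nullMeasurableSet_le hX.1.aemeasurable aemeasurable_const
    rw [← integral_sub hqi hXg]
    have e : (fun u => steinDeriv x (X u) - X u * steinSol x (X u)) =
        fun u => Set.indicator {u | X u ≤ x} (fun _ => (1 : ℝ)) u - stdCdf x := by
      funext u
      simp only [steinDeriv, Set.indicator, Set.mem_ofPred_eq]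
      ring
    rw [e, integral_sub ((integrable_const 1).indicator₀ hms) (integrable_const _),
      integral_indicator₀ hms]
    simp
  -- The only place in this proof where the eigenvalue relation enters the main term; the remainder
  -- uses it once more, through the bound on `Z`.
  have e2 : d * ∫ u, X u * steinSol x (X u) ∂μ∞ =
      ∑ k ∈ K, ∫ u, coordDiff μ∞ k X u * steinSol x (X u) ∂μ∞ := by
    rw [← integral_finsetSum K fun k _ => integrable_mul_of_memLp_two (hF2 k) hg, ← integral_const_mul]
    refine integral_congr_ae ?_
    filter_upwards [hE] with u hu
    rw [← Finset.sum_mul, hu, mul_assoc]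
  have e3 : ∫ u, (1 - d⁻¹ * ∑ k ∈ K, coordVar μ∞ k X u) * steinDeriv x (X u) ∂μ∞ =
      ∫ u, steinDeriv x (X u) ∂μ∞ -
        d⁻¹ * ∑ k ∈ K, ∫ u, coordVar μ∞ k X u * steinDeriv x (X u) ∂μ∞ := by
    rw [← integral_finsetSum K hVq, ← integral_const_mul, ← integral_sub hqi
      ((integrable_finsetSum K hVq).const_mul _)]
    refine integral_congr_ae (ae_of_all _ fun u => ?_)
    simp only [← Finset.sum_mul]
    ring
  have e4 : ∑ k ∈ K, ∫ u, coordDiff μ∞ k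
      (fun v => coordDiff μ∞ k X v * |coordDiff μ∞ k X v|) u * steinOsc x (X u) ∂μ∞ =
      ∫ u, Z u * steinOsc x (X u) ∂μ∞ := by
    rw [← integral_finsetSum K fun k hk => integrable_mul_of_memLp_two (hφ k hk) hh2]
    simp only [hZdef, Finset.sum_mul]
  have hR : |∑ k ∈ K, (∫ u, coordDiff μ∞ k X u * steinSol x (X u) ∂μ∞ -
      ∫ u, coordVar μ∞ k X u * steinDeriv x (X u) ∂μ∞)| ≤
      2 * √(4 / 3 * (d * ∑ k ∈ K, ∫ u, coordDiff μ∞ k X u ^ 4 ∂μ∞)) := by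
    refine (Finset.abs_sum_le_sum_abs _ _).trans ?_
    refine (Finset.sum_le_sum fun k hk =>
      abs_integral_coordDiff_mul_steinSol_sub_le x k hX (h4 k hk)).trans ?_
    rw [← Finset.mul_sum, e4]
    refine mul_le_mul_of_nonneg_left ?_ two_pos.le
    refine le_trans ?_ (Real.sqrt_le_sqrt
      (integral_sum_coordDiff_mul_abs_sq_le hE (hX.integrable one_le_two) h4))
    -- The weight `steinOsc` is at most 1 in absolute value, so `E[Z h(X)] ≤ E|Z|`.
    refine le_trans ?_ (integral_abs_le_sqrt_integral_sq hZ)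
    refine integral_mono (hZ.integrable_mul hh2) (hZ.integrable one_le_two).abs fun u => ?_
    refine (le_abs_self _).trans ?_
    simp only [abs_mul]
    exact mul_le_of_le_one_right (abs_nonneg _) (abs_steinOsc_le x _)
  have hT : |∫ u, (1 - d⁻¹ * ∑ k ∈ K, coordVar μ∞ k X u) * steinDeriv x (X u) ∂μ∞| ≤
      ∫ u, |1 - d⁻¹ * ∑ k ∈ K, coordVar μ∞ k X u| ∂μ∞ := by
    refine abs_integral_le_integral_abs.trans ?_
    refine integral_mono_of_nonneg (ae_of_all _ fun u => abs_nonneg _)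
      ((integrable_const 1).sub (hV.const_mul _)).abs (ae_of_all _ fun u => ?_)
    simp only [abs_mul]
    exact mul_le_of_le_one_right (abs_nonneg _) (abs_steinDeriv_le x _)
  have e5 : μ∞.real {u | X u ≤ x} - stdCdf x =
      ∫ u, (1 - d⁻¹ * ∑ k ∈ K, coordVar μ∞ k X u) * steinDeriv x (X u) ∂μ∞ -
      d⁻¹ * ∑ k ∈ K, (∫ u, coordDiff μ∞ k X u * steinSol x (X u) ∂μ∞ -
      ∫ u, coordVar μ∞ k X u * steinDeriv x (X u) ∂μ∞) := by
    rw [e1, e3, Finset.sum_sub_distrib, ← e2]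
    field_simp
    ring
  rw [e5]
  refine (abs_sub _ _).trans (add_le_add hT ?_)
  rw [abs_mul, abs_of_pos (inv_pos.2 hd)]
  have := mul_le_mul_of_nonneg_left hR (inv_pos.2 hd).le
  linarith

end NormalApproximation

/-! ### Convergence of series in `L¹` and passage to the limit in distribution functions. -/

section Series

variable {α : Type*} [MeasurableSpace α] {μ : Measure α}

theorem tsum_lintegral_enorm_ne_top {F : ℕ → α → ℝ} (hF : ∀ k, Integrable (F k) μ)
    (hs : Summable fun k => ∫ u, |F k u| ∂μ) : ∑' k, ∫⁻ u, ‖F k u‖ₑ ∂μ ≠ ∞ := by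
  have e : ∀ k, ∫⁻ u, ‖F k u‖ₑ ∂μ = ENNReal.ofReal (∫ u, |F k u| ∂μ) := fun k =>
    (ofReal_integral_norm_eq_lintegral_enorm (hF k)).symm
  simp only [e]
  rw [← ENNReal.ofReal_tsum_of_nonneg (fun k => integral_nonneg fun u => abs_nonneg _) hs]
  exact ENNReal.ofReal_ne_top

theorem ae_summable_of_summable_integral_abs {F : ℕ → α → ℝ} (hF : ∀ k, Integrable (F k) μ)
    (hs : Summable fun k => ∫ u, |F k u| ∂μ) : ∀ᵐ u ∂μ, Summable fun k => |F k u| := by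
  have h := tsum_lintegral_enorm_ne_top hF hs
  rw [← lintegral_tsum fun k => (hF k).1.enorm] at h
  filter_upwards [ae_lt_top' (AEMeasurable.tsum fun k => (hF k).1.enorm) h] with u hu
  have h2 := ENNReal.summable_toReal hu.ne
  simpa using h2

theorem integrable_tsum_of_summable_integral_abs {F : ℕ → α → ℝ} (hF : ∀ k, Integrable (F k) μ)
    (hs : Summable fun k => ∫ u, |F k u| ∂μ) : Integrable (fun u => ∑' k, F k u) μ := by
  have hsum := ae_summable_of_summable_integral_abs hF hs
  refine ⟨?_, ?_⟩
  · refine aestronglyMeasurable_of_tendsto_ae atTop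
      (f := fun n u => ∑ k ∈ Finset.range n, F k u)
      (fun n => (integrable_finsetSum _ fun k _ => hF k).1) ?_
    filter_upwards [hsum] with u hu
    exact hu.of_abs.hasSum.tendsto_sum_nat
  · have h := tsum_lintegral_enorm_ne_top hF hs
    rw [← lintegral_tsum fun k => (hF k).1.enorm] at h
    rw [hasFiniteIntegral_iff_enorm]
    exact (lintegral_mono fun u => enorm_tsum_le_tsum_enorm).trans_lt h.lt_top

theorem integral_abs_tsum_le {F : ℕ → α → ℝ} (hF : ∀ k, Integrable (F k) μ)
    (hs : Summable fun k => ∫ u, |F k u| ∂μ) :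
    ∫ u, |∑' k, F k u| ∂μ ≤ ∑' k, ∫ u, |F k u| ∂μ := by
  have hFa : ∀ k, Integrable (fun u => ‖F k u‖) μ := fun k => (hF k).norm
  have hs' : Summable fun k => ∫ u, ‖(‖F k u‖)‖ ∂μ := by
    simpa only [Real.norm_eq_abs, abs_abs] using hs
  have e : ∑' k, ∫ u, ‖F k u‖ ∂μ = ∫ u, ∑' k, ‖F k u‖ ∂μ :=
    integral_tsum_of_summable_integral_norm hFa hs'
  have h : ∫ u, ‖∑' k, F k u‖ ∂μ ≤ ∫ u, ∑' k, ‖F k u‖ ∂μ := by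
    refine integral_mono_ae (integrable_tsum_of_summable_integral_abs hF hs).norm
      (integrable_tsum_of_summable_integral_abs hFa hs') ?_
    filter_upwards [ae_summable_of_summable_integral_abs hF hs] with u hu
    exact norm_tsum_le_tsum_norm hu
  exact h.trans e.ge

/-- Dominated convergence for series of functions in `L¹`. -/
theorem tendsto_integral_abs_sum_range_sub_tsum {V : ℕ → α → ℝ} {W : ℕ → ℕ → α → ℝ} {b : ℕ → ℝ}
    (hV : ∀ k, Integrable (V k) μ) (hVs : Summable fun k => ∫ u, |V k u| ∂μ)
    (hW : ∀ n k, Integrable (W n k) μ) (hb : Summable b)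
    (hWb : ∀ n k, k < n → ∫ u, |W n k u - V k u| ∂μ ≤ b k)
    (hlim : ∀ k, Tendsto (fun n => ∫ u, |W n k u - V k u| ∂μ) atTop (𝓝 0)) :
    Tendsto (fun n => ∫ u, |∑ k ∈ Finset.range n, W n k u - ∑' k, V k u| ∂μ) atTop (𝓝 0) := by
  -- The sum up to `n` is extended by zero to all `k`; beyond `n` the difference is `-V k`, whose
  -- `L¹` norm is summable.
  set D : ℕ → ℕ → α → ℝ := fun n k u => (if k < n then W n k u else 0) - V k u with hD
  have hDi : ∀ n k, Integrable (D n k) μ := fun n k => by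
    by_cases h : k < n
    · simp only [hD, h, if_true]
      exact (hW n k).sub (hV k)
    · simp only [hD, h, if_false, zero_sub]
      exact (hV k).neg
  set B : ℕ → ℝ := fun k => |b k| + ∫ u, |V k u| ∂μ with hB
  have hBs : Summable B := hb.abs.add hVs
  have hDb : ∀ n k, ∫ u, |D n k u| ∂μ ≤ B k := fun n k => by
    by_cases h : k < n
    · simp only [hD, h, if_true, hB]
      have h1 : 0 ≤ ∫ u, |V k u| ∂μ := integral_nonneg fun u => abs_nonneg _
      have h2 := hWb n k h
      have h3 := le_abs_self (b k)
      linarith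
    · simp only [hD, h, if_false, hB, zero_sub, abs_neg]
      have := abs_nonneg (b k)
      linarith
  have hDn : ∀ n k, 0 ≤ ∫ u, |D n k u| ∂μ := fun n k => integral_nonneg fun u => abs_nonneg _
  have hDs : ∀ n, Summable fun k => ∫ u, |D n k u| ∂μ := fun n =>
    Summable.of_nonneg_of_le (hDn n) (hDb n) hBs
  have hDl : ∀ k, Tendsto (fun n => ∫ u, |D n k u| ∂μ) atTop (𝓝 0) := fun k => by
    refine (hlim k).congr' ?_
    filter_upwards [eventually_gt_atTop k] with n hn
    simp only [hD, hn, if_true]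
  have hT : Tendsto (fun n => ∑' k, ∫ u, |D n k u| ∂μ) atTop (𝓝 0) := by
    have := tendsto_tsum_of_dominated_convergence hBs hDl (Eventually.of_forall fun n k => by
      rw [Real.norm_of_nonneg (hDn n k)]; exact hDb n k)
    simpa using this
  refine squeeze_zero (fun n => integral_nonneg fun u => abs_nonneg _) (fun n => ?_) hT
  refine le_trans (le_of_eq ?_) (integral_abs_tsum_le (hDi n) (hDs n))
  refine integral_congr_ae ?_
  filter_upwards [ae_summable_of_summable_integral_abs hV hVs] with u hu
  have h1 : Summable fun k => if k < n then W n k u else 0 :=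
    summable_of_ne_finset_zero (s := Finset.range n) fun k hk => by
      rw [Finset.mem_range] at hk
      simp [hk]
  simp only [hD]
  have h2 : ∑' k, (if k < n then W n k u else 0) = ∑ k ∈ Finset.range n, W n k u := by
    rw [tsum_eq_sum (s := Finset.range n) fun k hk => if_neg (by simpa using hk)]
    exact Finset.sum_congr rfl fun k hk => if_pos (Finset.mem_range.1 hk)
  rw [h1.tsum_sub hu.of_abs, h2]

theorem integral_abs_mul_le_sqrt_mul_sqrt {f g : α → ℝ} (hf : MemLp f 2 μ) (hg : MemLp g 2 μ) :
    ∫ u, |f u * g u| ∂μ ≤ √(∫ u, f u ^ 2 ∂μ) * √(∫ u, g u ^ 2 ∂μ) := by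
  have h := integral_mul_norm_le_Lp_mul_Lq (μ := μ) (f := f) (g := g) Real.HolderConjugate.two_two
    (by simpa using hf) (by simpa using hg)
  simpa only [Real.norm_eq_abs, ← abs_mul, Real.rpow_two, sq_abs, ← Real.sqrt_eq_rpow] using h

/-- `g² - f² = (g - f)² + 2f(g - f)`, and Cauchy-Schwarz for the second term. -/
theorem integral_abs_sq_sub_sq_le {f g : α → ℝ} (hf : MemLp f 2 μ) (hg : MemLp g 2 μ) :
    ∫ u, |g u ^ 2 - f u ^ 2| ∂μ ≤ ∫ u, (g u - f u) ^ 2 ∂μ +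
      2 * (√(∫ u, f u ^ 2 ∂μ) * √(∫ u, (g u - f u) ^ 2 ∂μ)) := by
  have hgf : MemLp (fun u => g u - f u) 2 μ := hg.sub hf
  have i1 : Integrable (fun u => |f u * (g u - f u)|) μ := (hf.integrable_mul hgf).abs
  refine le_trans ?_ (add_le_add le_rfl (mul_le_mul_of_nonneg_left
    (integral_abs_mul_le_sqrt_mul_sqrt hf hgf) two_pos.le))
  rw [← integral_const_mul, ← integral_add hgf.integrable_sq (i1.const_mul 2)]
  refine integral_mono (hg.integrable_sq.sub hf.integrable_sq).abs
    (hgf.integrable_sq.add (i1.const_mul 2)) fun u => ?_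
  change |g u ^ 2 - f u ^ 2| ≤ (g u - f u) ^ 2 + 2 * |f u * (g u - f u)|
  have e : g u ^ 2 - f u ^ 2 = (g u - f u) ^ 2 + 2 * (f u * (g u - f u)) := by ring
  rw [e]
  refine (abs_add_le _ _).trans (le_of_eq ?_)
  rw [abs_of_nonneg (sq_nonneg (g u - f u)), abs_mul, abs_two]

theorem tendsto_integral_abs_sq_sub_sq {f : α → ℝ} {g : ℕ → α → ℝ} (hf : MemLp f 2 μ)
    (hg : ∀ n, MemLp (g n) 2 μ)
    (h : Tendsto (fun n => ∫ u, (g n u - f u) ^ 2 ∂μ) atTop (𝓝 0)) :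
    Tendsto (fun n => ∫ u, |g n u ^ 2 - f u ^ 2| ∂μ) atTop (𝓝 0) := by
  refine squeeze_zero (fun n => integral_nonneg fun u => abs_nonneg _)
    (fun n => integral_abs_sq_sub_sq_le hf (hg n)) ?_
  have h1 := h.add (((Real.continuous_sqrt.tendsto 0).comp h).const_mul
    √(∫ u, f u ^ 2 ∂μ) |>.const_mul 2)
  simpa using h1

theorem tendsto_integral_of_tendsto_integral_abs_sub {f : α → ℝ} {g : ℕ → α → ℝ}
    (hf : Integrable f μ) (hg : ∀ n, Integrable (g n) μ)
    (h : Tendsto (fun n => ∫ u, |g n u - f u| ∂μ) atTop (𝓝 0)) :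
    Tendsto (fun n => ∫ u, g n u ∂μ) atTop (𝓝 (∫ u, f u ∂μ)) := by
  rw [tendsto_iff_norm_sub_tendsto_zero]
  refine squeeze_zero (fun n => norm_nonneg _) (fun n => ?_) h
  rw [← integral_sub (hg n) hf]
  exact norm_integral_le_integral_norm _

/-- A uniform bound on the distance to the normal distribution function passes to limits in
probability. -/
theorem abs_measureReal_le_sub_stdCdf_le_of_tendsto [IsProbabilityMeasure μ] {X : α → ℝ}
    {Y : ℕ → α → ℝ} (hX : MemLp X 2 μ) (hY : ∀ n, MemLp (Y n) 2 μ)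
    (h : Tendsto (fun n => ∫ u, (Y n u - X u) ^ 2 ∂μ) atTop (𝓝 0)) {B : ℕ → ℝ} {b : ℝ}
    (hB : Tendsto B atTop (𝓝 b))
    (hYB : ∀ n x, |μ.real {u | Y n u ≤ x} - stdCdf x| ≤ B n) (x : ℝ) :
    |μ.real {u | X u ≤ x} - stdCdf x| ≤ b := by
  -- Chebyshev's inequality. The thresholds are shifted by `ε`, and continuity of the normal
  -- distribution function removes the shift at the end.
  have hM : ∀ ε > 0, ∀ n, μ.real {u | ε ^ 2 ≤ (Y n u - X u) ^ 2} ≤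
      (∫ u, (Y n u - X u) ^ 2 ∂μ) / ε ^ 2 := fun ε hε n => by
    rw [le_div_iff₀ (by positivity), mul_comm]
    exact mul_meas_ge_le_integral_of_nonneg (ae_of_all _ fun u => sq_nonneg _)
      ((hY n).sub hX).integrable_sq _
  have hup : ∀ ε > 0, μ.real {u | X u ≤ x} ≤ stdCdf (x + ε) + b := fun ε hε => by
    have hl := (hB.const_add (stdCdf (x + ε))).add (h.div_const (ε ^ 2))
    rw [zero_div, add_zero] at hl
    refine ge_of_tendsto' hl fun n => ?_
    have h1 : μ.real {u | X u ≤ x} ≤ μ.real ({u | Y n u ≤ x + ε} ∪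
        {u | ε ^ 2 ≤ (Y n u - X u) ^ 2}) := by
      refine measureReal_mono fun u hu => ?_
      rw [Set.mem_union]
      by_cases hc : Y n u ≤ x + ε
      · exact Or.inl hc
      · refine Or.inr ?_
        rw [Set.mem_ofPred_eq] at hu ⊢
        rw [not_le] at hc
        exact pow_le_pow_left₀ hε.le (by linarith) 2
    have h2 := measureReal_union_le (μ := μ) {u | Y n u ≤ x + ε}
        {u | ε ^ 2 ≤ (Y n u - X u) ^ 2}
    have h3 := (abs_le.1 (hYB n (x + ε))).2
    have h4 := hM ε hε n
    linarith
  have hlo : ∀ ε > 0, stdCdf (x - ε) - b ≤ μ.real {u | X u ≤ x} := fun ε hε => by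
    have hl := (hB.const_sub (stdCdf (x - ε))).sub (h.div_const (ε ^ 2))
    rw [zero_div, sub_zero] at hl
    refine le_of_tendsto' hl fun n => ?_
    have h1 : μ.real {u | Y n u ≤ x - ε} ≤ μ.real ({u | X u ≤ x} ∪
        {u | ε ^ 2 ≤ (Y n u - X u) ^ 2}) := by
      refine measureReal_mono fun u hu => ?_
      rw [Set.mem_union]
      by_cases hc : X u ≤ x
      · exact Or.inl hc
      · refine Or.inr ?_
        rw [Set.mem_ofPred_eq] at hu ⊢
        rw [not_le] at hc
        nlinarith
    have h2 := measureReal_union_le (μ := μ) {u | X u ≤ x} {u | ε ^ 2 ≤ (Y n u - X u) ^ 2}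
    have h3 := (abs_le.1 (hYB n (x - ε))).1
    have h4 := hM ε hε n
    linarith
  have c1 : Tendsto (fun ε => stdCdf (x + ε) + b) (𝓝[>] 0) (𝓝 (stdCdf x + b)) := by
    have : Continuous fun ε => stdCdf (x + ε) + b := by
      have := continuous_stdCdf; fun_prop
    simpa using (this.tendsto 0).mono_left nhdsWithin_le_nhds
  have c2 : Tendsto (fun ε => stdCdf (x - ε) - b) (𝓝[>] 0) (𝓝 (stdCdf x - b)) := by
    have : Continuous fun ε => stdCdf (x - ε) - b := by
      have := continuous_stdCdf; fun_prop
    simpa using (this.tendsto 0).mono_left nhdsWithin_le_nhds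
  have d1 := ge_of_tendsto c1 (eventually_nhdsWithin_of_forall fun ε hε => hup ε hε)
  have d2 := le_of_tendsto c2 (eventually_nhdsWithin_of_forall fun ε hε => hlo ε hε)
  rw [abs_le]
  constructor <;> linarith

end Series

/-! ### From finitely many coordinates to infinitely many. -/

section ChaosLimit

variable {E : Type*} [MeasurableSpace E] {ν : Measure E} [IsProbabilityMeasure ν]

local notation "μ∞" => Measure.infinitePi (fun _ : ℕ => ν)

/-- `X` is square integrable and belongs to the eigenspace of the number operator
`∑_k (1 - E_k)` with eigenvalue `d`. -/
structure IsChaos (μ : Measure (ℕ → E)) (d : ℝ) (X : (ℕ → E) → ℝ) : Prop where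
  memLp : MemLp X 2 μ
  eigen : ∀ N : ℕ, IsEigen μ (Finset.range N) d (avg μ (Set.Ici N) X)
  tendsto : Tendsto (fun N : ℕ => ∫ u, (avg μ (Set.Ici N) X u - X u) ^ 2 ∂μ) atTop (𝓝 0)

theorem integral_avg_pow_four_le {F : (ℕ → E) → ℝ} (S : Set ℕ) (hF : MemLp F 4 μ∞) :
    ∫ u, avg μ∞ S F u ^ 4 ∂μ∞ ≤ ∫ u, F u ^ 4 ∂μ∞ := by
  have hA : MemLp (avg μ∞ S F) 4 μ∞ := memLp_avg (n := 4) S (by norm_num) hF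
  have h := lintegral_enorm_avg_pow_le S (n := 4) (by norm_num) hF.1
  have e : ∀ G : (ℕ → E) → ℝ, MemLp G 4 μ∞ →
      ∫⁻ u, ‖G u‖ₑ ^ 4 ∂μ∞ = ENNReal.ofReal (∫ u, G u ^ 4 ∂μ∞) := fun G hG => by
    rw [ofReal_integral_eq_lintegral_ofReal (integrable_pow_four hG)
      (ae_of_all _ fun u => (even_two_mul 2).pow_nonneg (G u))]
    refine lintegral_congr fun u => ?_
    rw [← enorm_pow, Real.enorm_of_nonneg (by positivity)]
  rw [e _ hA, e _ hF] at h
  exact (ENNReal.ofReal_le_ofReal_iff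
    (integral_nonneg fun u => (even_two_mul 2).pow_nonneg (F u))).1 h

theorem coordVar_nonneg (μ : Measure (ℕ → E)) (k : ℕ) (X : (ℕ → E) → ℝ) (u : ℕ → E) :
    0 ≤ coordVar μ k X u :=
  integral_nonneg fun _ => sq_nonneg _

theorem integral_coordVar {X : (ℕ → E) → ℝ} (k : ℕ) (hX : MemLp X 2 μ∞) :
    ∫ u, coordVar μ∞ k X u ∂μ∞ = ∫ u, coordDiff μ∞ k X u ^ 2 ∂μ∞ :=
  integral_avg {k} (memLp_coordDiff (n := 2) k two_ne_zero hX).integrable_sq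

/-- Averaging over coordinate `k` contracts `L¹`. -/
theorem integral_abs_coordVar_sub_le {X Y : (ℕ → E) → ℝ} (k : ℕ) (hX : MemLp X 2 μ∞)
    (hY : MemLp Y 2 μ∞) :
    ∫ u, |coordVar μ∞ k Y u - coordVar μ∞ k X u| ∂μ∞ ≤
      ∫ u, |coordDiff μ∞ k Y u ^ 2 - coordDiff μ∞ k X u ^ 2| ∂μ∞ := by
  have h1 := (memLp_coordDiff (n := 2) k two_ne_zero hX).integrable_sq
  have h2 := (memLp_coordDiff (n := 2) k two_ne_zero hY).integrable_sq
  have h3 : Integrable (fun u => |coordDiff μ∞ k Y u ^ 2 - coordDiff μ∞ k X u ^ 2|) μ∞ :=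
    (h2.sub h1).abs
  rw [← integral_avg {k} h3]
  refine integral_mono_ae ((integrable_coordVar k hY).sub (integrable_coordVar k hX)).abs
    (integrable_avg {k} h3) ?_
  filter_upwards [avg_sub {k} h2 h1] with u hu
  simp only [coordVar, ← hu]
  exact abs_integral_le_integral_abs

/-- Each `E[(D_k X)²]` equals `E[D_k X · X]`, and the sum over `k` is given by the eigenvalue
relation. -/
theorem IsEigen.sum_integral_sq {K : Finset ℕ} {d : ℝ} {X : (ℕ → E) → ℝ} (h : IsEigen μ∞ K d X)
    (hX : MemLp X 2 μ∞) :
    ∑ k ∈ K, ∫ u, IndepChaos.coordDiff μ∞ k X u ^ 2 ∂μ∞ = d * ∫ u, X u ^ 2 ∂μ∞ := by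
  have hD : ∀ k, MemLp (IndepChaos.coordDiff μ∞ k X) 2 μ∞ := fun k =>
    memLp_coordDiff (n := 2) k two_ne_zero hX
  simp only [fun k => integral_coordDiff_sq k hX]
  rw [← integral_finsetSum K fun k _ => integrable_mul_of_memLp_two (hD k) hX,
    ← integral_const_mul]
  refine integral_congr_ae ?_
  filter_upwards [h] with u hu
  rw [← Finset.sum_mul, hu, sq, mul_assoc]

variable {d : ℝ} {X : (ℕ → E) → ℝ}

theorem IsChaos.memLp_avg (h : IsChaos μ∞ d X) (N : ℕ) : MemLp (avg μ∞ (Set.Ici N) X) 2 μ∞ :=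
  IndepChaos.memLp_avg (n := 2) _ two_ne_zero h.memLp

theorem IsChaos.tendsto_integral_sq (h : IsChaos μ∞ d X) :
    Tendsto (fun N : ℕ => ∫ u, avg μ∞ (Set.Ici N) X u ^ 2 ∂μ∞) atTop (𝓝 (∫ u, X u ^ 2 ∂μ∞)) :=
  tendsto_integral_of_tendsto_integral_abs_sub h.memLp.integrable_sq
    (fun N => (h.memLp_avg N).integrable_sq)
    (tendsto_integral_abs_sq_sub_sq h.memLp h.memLp_avg h.tendsto)

theorem IsChaos.tendsto_coordDiff_sq (h : IsChaos μ∞ d X) (k : ℕ) :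
    Tendsto (fun N : ℕ => ∫ u, |coordDiff μ∞ k (avg μ∞ (Set.Ici N) X) u ^ 2 -
      coordDiff μ∞ k X u ^ 2| ∂μ∞) atTop (𝓝 0) := by
  refine tendsto_integral_abs_sq_sub_sq (memLp_coordDiff (n := 2) k two_ne_zero h.memLp)
    (fun N => memLp_coordDiff (n := 2) k two_ne_zero (h.memLp_avg N)) ?_
  refine squeeze_zero (fun N => integral_nonneg fun u => sq_nonneg _) (fun N => ?_) h.tendsto
  refine le_trans (le_of_eq ?_)
    (integral_coordDiff_sq_le_integral_sq k ((h.memLp_avg N).sub h.memLp))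
  refine integral_congr_ae ?_
  filter_upwards [coordDiff_sub k ((h.memLp_avg N).integrable one_le_two)
    (h.memLp.integrable one_le_two)] with u hu
  rw [← hu]

/-- Averaging over the tail commutes with `D_k` and contracts `L²`. The resulting bound is uniform
in `N` and serves as domination. -/
theorem IsChaos.integral_coordDiff_sq_avg_le (h : IsChaos μ∞ d X) (N k : ℕ) :
    ∫ u, coordDiff μ∞ k (avg μ∞ (Set.Ici N) X) u ^ 2 ∂μ∞ ≤ ∫ u, coordDiff μ∞ k X u ^ 2 ∂μ∞ := by
  have hD : MemLp (coordDiff μ∞ k X) 2 μ∞ := memLp_coordDiff (n := 2) k two_ne_zero h.memLp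
  have h1 : ∫ u, coordDiff μ∞ k (avg μ∞ (Set.Ici N) X) u ^ 2 ∂μ∞ =
      ∫ u, avg μ∞ (Set.Ici N) (coordDiff μ∞ k X) u ^ 2 ∂μ∞ := by
    refine integral_congr_ae ?_
    filter_upwards [avg_coordDiff_comm (Set.Ici N) k (h.memLp.integrable one_le_two)] with u hu
    rw [hu]
  have hA : MemLp (avg μ∞ (Set.Ici N) (coordDiff μ∞ k X)) 2 μ∞ :=
    IndepChaos.memLp_avg (n := 2) _ two_ne_zero hD
  have h2 := lintegral_enorm_avg_pow_le (Set.Ici N) (n := 2) two_ne_zero hD.1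
  have e : ∀ G : (ℕ → E) → ℝ, MemLp G 2 μ∞ →
      ∫⁻ u, ‖G u‖ₑ ^ 2 ∂μ∞ = ENNReal.ofReal (∫ u, G u ^ 2 ∂μ∞) := fun G hG => by
    rw [ofReal_integral_eq_lintegral_ofReal hG.integrable_sq (ae_of_all _ fun u => sq_nonneg (G u))]
    refine lintegral_congr fun u => ?_
    rw [← enorm_pow, Real.enorm_of_nonneg (sq_nonneg (G u))]
  rw [e _ hA, e _ hD] at h2
  rw [h1]
  exact (ENNReal.ofReal_le_ofReal_iff (integral_nonneg fun u => sq_nonneg _)).1 h2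

/-- For the truncation at `N` the full sum over `k < N` is `d E[X_N²]`; finite partial sums pass to
the limit in `N`. -/
theorem IsChaos.summable_integral_coordDiff_sq (h : IsChaos μ∞ d X) :
    Summable fun k => ∫ u, coordDiff μ∞ k X u ^ 2 ∂μ∞ := by
  refine summable_of_sum_le (c := d * ∫ u, X u ^ 2 ∂μ∞)
    (fun k => integral_nonneg fun u => sq_nonneg _) fun K => ?_
  have h1 : ∀ k, Tendsto (fun N : ℕ => ∫ u, coordDiff μ∞ k (avg μ∞ (Set.Ici N) X) u ^ 2 ∂μ∞) atTop
      (𝓝 (∫ u, coordDiff μ∞ k X u ^ 2 ∂μ∞)) := fun k =>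
    tendsto_integral_of_tendsto_integral_abs_sub
      (memLp_coordDiff (n := 2) k two_ne_zero h.memLp).integrable_sq
      (fun N => (memLp_coordDiff (n := 2) k two_ne_zero (h.memLp_avg N)).integrable_sq)
      (h.tendsto_coordDiff_sq k)
  refine le_of_tendsto_of_tendsto (tendsto_finsetSum K fun k _ => h1 k)
    (h.tendsto_integral_sq.const_mul d) ?_
  obtain ⟨M, hM⟩ := K.exists_nat_subset_range
  filter_upwards [eventually_ge_atTop M] with N hN
  rw [← (h.eigen N).sum_integral_sq (h.memLp_avg N)]
  exact Finset.sum_le_sum_of_subset_of_nonneg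
    (hM.trans (Finset.range_mono hN)) fun k _ _ => integral_nonneg fun u => sq_nonneg _

theorem IsChaos.summable_integral_coordVar (h : IsChaos μ∞ d X) :
    Summable fun k => ∫ u, |coordVar μ∞ k X u| ∂μ∞ := by
  simp only [fun k u => abs_of_nonneg (coordVar_nonneg μ∞ k X u),
    fun k => integral_coordVar k h.memLp]
  exact h.summable_integral_coordDiff_sq

theorem IsChaos.tendsto_integral_abs_sum_coordVar (h : IsChaos μ∞ d X) :
    Tendsto (fun N : ℕ => ∫ u, |∑ k ∈ Finset.range N, coordVar μ∞ k (avg μ∞ (Set.Ici N) X) u -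
      ∑' k, coordVar μ∞ k X u| ∂μ∞) atTop (𝓝 0) := by
  refine tendsto_integral_abs_sum_range_sub_tsum
    (V := fun k => coordVar μ∞ k X) (W := fun N k => coordVar μ∞ k (avg μ∞ (Set.Ici N) X))
    -- Conditional variances are nonnegative, so their difference is at most their sum in `L¹`, and
    -- each has mean at most `E[(D_k X)²]`.
    (b := fun k => 2 * ∫ u, coordDiff μ∞ k X u ^ 2 ∂μ∞)
    (fun k => integrable_coordVar k h.memLp) h.summable_integral_coordVar
    (fun N k => integrable_coordVar k (h.memLp_avg N))
    (h.summable_integral_coordDiff_sq.mul_left 2) (fun N k _ => ?_) fun k => ?_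
  · have i1 := integrable_coordVar k (h.memLp_avg N)
    have i2 := integrable_coordVar k h.memLp
    have h1 : ∫ u, |coordVar μ∞ k (avg μ∞ (Set.Ici N) X) u - coordVar μ∞ k X u| ∂μ∞ ≤
        ∫ u, (coordVar μ∞ k (avg μ∞ (Set.Ici N) X) u + coordVar μ∞ k X u) ∂μ∞ :=
      integral_mono (i1.sub i2).abs (i1.add i2) fun u => by
        have h1 := coordVar_nonneg μ∞ k (avg μ∞ (Set.Ici N) X) u
        have h2 := coordVar_nonneg μ∞ k X u
        change |coordVar μ∞ k (avg μ∞ (Set.Ici N) X) u - coordVar μ∞ k X u| ≤ _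
        rw [abs_le]
        constructor <;> linarith
    rw [integral_add i1 i2, integral_coordVar k h.memLp, integral_coordVar k (h.memLp_avg N)] at h1
    have h2 := h.integral_coordDiff_sq_avg_le N k
    linarith
  · exact squeeze_zero (fun N => integral_nonneg fun u => abs_nonneg _)
      (fun N => integral_abs_coordVar_sub_le k h.memLp (h.memLp_avg N)) (h.tendsto_coordDiff_sq k)

theorem IsChaos.integrable_tsum_coordVar (h : IsChaos μ∞ d X) :
    Integrable (fun u => ∑' k, coordVar μ∞ k X u) μ∞ :=
  integrable_tsum_of_summable_integral_abs (fun k => integrable_coordVar k h.memLp)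
    h.summable_integral_coordVar

theorem IsChaos.integral_tsum_coordVar (h : IsChaos μ∞ d X) :
    ∫ u, ∑' k, coordVar μ∞ k X u ∂μ∞ = d * ∫ u, X u ^ 2 ∂μ∞ := by
  have h1 := tendsto_integral_of_tendsto_integral_abs_sub h.integrable_tsum_coordVar
    (fun N => integrable_finsetSum (Finset.range N)
      fun k _ => integrable_coordVar k (h.memLp_avg N)) h.tendsto_integral_abs_sum_coordVar
  refine tendsto_nhds_unique h1 ((h.tendsto_integral_sq.const_mul d).congr fun N => ?_)
  rw [integral_finsetSum _ fun k _ => integrable_coordVar k (h.memLp_avg N),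
    ← (h.eigen N).sum_integral_sq (h.memLp_avg N)]
  exact Finset.sum_congr rfl fun k _ => (integral_coordVar k (h.memLp_avg N)).symm

/-- Berry-Esseen bound for an element of a chaos. -/
theorem IsChaos.abs_measureReal_le_sub_stdCdf_le (hd : 0 < d) (h : IsChaos μ∞ d X)
    (h4 : ∀ k, MemLp (coordDiff μ∞ k X) 4 μ∞)
    (hs : Summable fun k => ∫ u, coordDiff μ∞ k X u ^ 4 ∂μ∞) (x : ℝ) :
    |μ∞.real {u | X u ≤ x} - stdCdf x| ≤ ∫ u, |1 - d⁻¹ * ∑' k, coordVar μ∞ k X u| ∂μ∞ +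
      2 * d⁻¹ * √(4 / 3 * (d * ∑' k, ∫ u, coordDiff μ∞ k X u ^ 4 ∂μ∞)) := by
  have hpow : ∀ k, 0 ≤ ∫ u, coordDiff μ∞ k X u ^ 4 ∂μ∞ := fun k =>
    integral_nonneg fun u => (even_two_mul 2).pow_nonneg _
  -- The fourth moment is assumed for `D_k X`, not for `X`: `D_k` is moved inside the tail average,
  -- which contracts `L⁴`.
  have hN4 : ∀ N k, MemLp (coordDiff μ∞ k (avg μ∞ (Set.Ici N) X)) 4 μ∞ := fun N k =>
    (IndepChaos.memLp_avg (n := 4) (Set.Ici N) (by norm_num) (h4 k)).ae_eq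
      (avg_coordDiff_comm (Set.Ici N) k (h.memLp.integrable one_le_two))
  have hN4le : ∀ N k, ∫ u, coordDiff μ∞ k (avg μ∞ (Set.Ici N) X) u ^ 4 ∂μ∞ ≤
      ∫ u, coordDiff μ∞ k X u ^ 4 ∂μ∞ := fun N k => by
    refine le_trans (le_of_eq (integral_congr_ae ?_))
      (integral_avg_pow_four_le (Set.Ici N) (h4 k))
    filter_upwards [avg_coordDiff_comm (Set.Ici N) k (h.memLp.integrable one_le_two)] with u hu
    rw [hu]
  have hVi : ∀ N, Integrable (fun u => ∑ k ∈ Finset.range N,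
      coordVar μ∞ k (avg μ∞ (Set.Ici N) X) u) μ∞ := fun N =>
    integrable_finsetSum (Finset.range N) fun k _ => integrable_coordVar k (h.memLp_avg N)
  have hlim : Tendsto (fun N : ℕ => ∫ u, |1 - d⁻¹ * ∑ k ∈ Finset.range N,
      coordVar μ∞ k (avg μ∞ (Set.Ici N) X) u| ∂μ∞) atTop
      (𝓝 (∫ u, |1 - d⁻¹ * ∑' k, coordVar μ∞ k X u| ∂μ∞)) := by
    refine tendsto_integral_of_tendsto_integral_abs_sub
      ((integrable_const 1).sub (h.integrable_tsum_coordVar.const_mul _)).abs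
      (fun N => ((integrable_const 1).sub ((hVi N).const_mul _)).abs) ?_
    have h1 := h.tendsto_integral_abs_sum_coordVar.const_mul d⁻¹
    rw [mul_zero] at h1
    refine squeeze_zero (fun N => integral_nonneg fun u => abs_nonneg _) (fun N => ?_) h1
    rw [← integral_const_mul]
    refine integral_mono_of_nonneg (ae_of_all _ fun u => abs_nonneg _)
      (((hVi N).sub h.integrable_tsum_coordVar).abs.const_mul d⁻¹) (ae_of_all _ fun u => ?_)
    refine (abs_abs_sub_abs_le_abs_sub _ _).trans (le_of_eq ?_)
    simp only
    rw [← abs_of_pos (inv_pos.2 hd), ← abs_mul, abs_of_pos (inv_pos.2 hd), abs_sub_comm]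
    congr 1
    ring
  refine abs_measureReal_le_sub_stdCdf_le_of_tendsto h.memLp h.memLp_avg h.tendsto
    (hlim.add_const _) (fun N x => ?_) x
  refine (IndepChaos.abs_measureReal_le_sub_stdCdf_le hd (h.eigen N) (h.memLp_avg N)
    (fun k _ => hN4 N k) x).trans ?_
  gcongr
  exact (Finset.sum_le_sum fun k _ => hN4le N k).trans
    (hs.sum_le_tsum (Finset.range N) fun k _ => hpow k)

end ChaosLimit

/-! ### The chaos of order `d` is closed in `L²`. -/

section Closure

variable {E : Type*} [MeasurableSpace E] {ν : Measure E} [IsProbabilityMeasure ν]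

local notation "μ∞" => Measure.infinitePi (fun _ : ℕ => ν)

theorem eLpNorm_two_eq {α : Type*} [MeasurableSpace α] (μ : Measure α) (F : α → ℝ) :
    eLpNorm F 2 μ = (∫⁻ u, ‖F u‖ₑ ^ 2 ∂μ) ^ (1 / 2 : ℝ) := by
  rw [eLpNorm_eq_lintegral_rpow_enorm_toReal two_ne_zero ENNReal.ofNat_ne_top]
  simp

theorem eLpNorm_avg_le {F : (ℕ → E) → ℝ} (S : Set ℕ) (hF : AEStronglyMeasurable F μ∞) :
    eLpNorm (avg μ∞ S F) 2 μ∞ ≤ eLpNorm F 2 μ∞ := by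
  rw [eLpNorm_two_eq, eLpNorm_two_eq]
  exact ENNReal.rpow_le_rpow (lintegral_enorm_avg_pow_le S two_ne_zero hF) (by norm_num)

theorem eLpNorm_coordDiff_le {F : (ℕ → E) → ℝ} (k : ℕ) (hF : AEStronglyMeasurable F μ∞) :
    eLpNorm (coordDiff μ∞ k F) 2 μ∞ ≤ 2 * eLpNorm F 2 μ∞ := by
  refine (eLpNorm_sub_le hF (aestronglyMeasurable_avg {k} hF) one_le_two).trans ?_
  rw [two_mul]
  exact add_le_add le_rfl (eLpNorm_avg_le {k} hF)

theorem tendsto_integral_sq_of_tendsto_eLpNorm {α : Type*} [MeasurableSpace α] {μ : Measure α}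
    {F : ℕ → α → ℝ} (hF : ∀ n, MemLp (F n) 2 μ)
    (h : Tendsto (fun n => eLpNorm (F n) 2 μ) atTop (𝓝 0)) :
    Tendsto (fun n => ∫ u, F n u ^ 2 ∂μ) atTop (𝓝 0) := by
  have e : ∀ n, ∫ u, F n u ^ 2 ∂μ = ((eLpNorm (F n) 2 μ) ^ 2).toReal := fun n => by
    rw [integral_eq_lintegral_of_nonneg_ae (ae_of_all _ fun u => sq_nonneg _)
      (hF n).integrable_sq.1, eLpNorm_two_eq, ← ENNReal.rpow_natCast, ← ENNReal.rpow_mul]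
    congr 1
    simp only [Nat.cast_ofNat, one_div, isUnit_iff_ne_zero, ne_eq, OfNat.ofNat_ne_zero,
      not_false_eq_true, IsUnit.inv_mul_cancel, ENNReal.rpow_one]
    refine lintegral_congr fun u => ?_
    rw [← enorm_pow, Real.enorm_of_nonneg (sq_nonneg _)]
  simp only [e]
  have h1 := ((ENNReal.continuous_pow 2).tendsto 0).comp h
  have h2 := (ENNReal.tendsto_toReal (a := 0 ^ 2) (by simp)).comp h1
  simpa [Function.comp_def] using h2

/-- Averaging over the coordinates from `N` on commutes with `D_k` for `k < N` and annihilates `D_k`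
for `k ≥ N`. -/
theorem isEigen_avg_of_isEigen {d : ℝ} {X : (ℕ → E) → ℝ} {N N' : ℕ} (hN : N ≤ N')
    (hX : Integrable X μ∞) (h : IsEigen μ∞ (Finset.range N') d X) :
    IsEigen μ∞ (Finset.range N) d (avg μ∞ (Set.Ici N) X) := by
  have h1 := avg_congr (Set.Ici N) h
  have h2 := avg_finsetSum (Finset.range N') (F := fun k => coordDiff μ∞ k X) (Set.Ici N)
    fun k _ => integrable_coordDiff k hX
  have h3 : ∀ᵐ u ∂μ∞, ∀ k, avg μ∞ (Set.Ici N) (coordDiff μ∞ k X) u =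
      coordDiff μ∞ k (avg μ∞ (Set.Ici N) X) u :=
    ae_all_iff.2 fun k => avg_coordDiff_comm (Set.Ici N) k hX
  have h4 : ∀ᵐ u ∂μ∞, ∀ k, N ≤ k → avg μ∞ (Set.Ici N) (coordDiff μ∞ k X) u = 0 := by
    refine ae_all_iff.2 fun k => ?_
    by_cases hk : N ≤ k
    · filter_upwards [avg_coordDiff (S := Set.Ici N) (k := k) hk hX] with u hu _
      exact hu
    · exact ae_of_all _ fun u h => absurd h hk
  filter_upwards [h1, h2, h3, h4] with u e1 e2 e3 e4
  rw [avg_const_mul] at e1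
  beta_reduce at e1
  rw [← e1, e2]
  simp only [← e3]
  refine Finset.sum_subset (Finset.range_mono hN) fun k _ hk => e4 k ?_
  simpa using hk

/-- The chaos of order `d` is closed: it contains the limits of functionals of finitely many
coordinates that satisfy the spectral relation. -/
theorem isChaos_of_tendsto {d : ℝ} {X : (ℕ → E) → ℝ} {Y : ℕ → (ℕ → E) → ℝ}
    (hX : MemLp X 2 μ∞) (hY : ∀ m, MemLp (Y m) 2 μ∞)
    (hYE : ∀ m, ∃ M, ∀ N ≥ M, IsEigen μ∞ (Finset.range N) d (Y m) ∧
      avg μ∞ (Set.Ici N) (Y m) =ᵐ[μ∞] Y m)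
    (hlim : Tendsto (fun m => eLpNorm (fun u => Y m u - X u) 2 μ∞) atTop (𝓝 0)) :
    IsChaos μ∞ d X := by
  have hX1 := hX.integrable one_le_two
  have hY1 := fun m => (hY m).integrable one_le_two
  have hYX : ∀ m, MemLp (fun u => Y m u - X u) 2 μ∞ := fun m => (hY m).sub hX
  have hA : ∀ N, MemLp (avg μ∞ (Set.Ici N) X) 2 μ∞ := fun N =>
    memLp_avg (n := 2) _ two_ne_zero hX
  refine ⟨hX, fun N => ?_, ?_⟩
  -- The defect in the truncated eigenvalue relation is a bounded linear operator on `L²` that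
  -- vanishes on every `Y m`, hence on their limit.
  · set T : ((ℕ → E) → ℝ) → (ℕ → E) → ℝ := fun F u =>
      ∑ k ∈ Finset.range N, coordDiff μ∞ k (avg μ∞ (Set.Ici N) F) u -
        d * avg μ∞ (Set.Ici N) F u with hT
    have hTsub : ∀ m, T (fun u => Y m u - X u) =ᵐ[μ∞] fun u => T (Y m) u - T X u := fun m => by
      have h1 := avg_sub (Set.Ici N) (hY1 m) hX1
      have h2 : ∀ᵐ u ∂μ∞, ∀ k, coordDiff μ∞ k (avg μ∞ (Set.Ici N) fun u => Y m u - X u) u =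
          coordDiff μ∞ k (avg μ∞ (Set.Ici N) (Y m)) u -
          coordDiff μ∞ k (avg μ∞ (Set.Ici N) X) u := ae_all_iff.2 fun k =>
        (coordDiff_congr k h1).trans
          (coordDiff_sub k (integrable_avg _ (hY1 m)) (integrable_avg _ hX1))
      filter_upwards [h1, h2] with u e1 e2
      simp only [hT, e1, e2, Finset.sum_sub_distrib]
      ring
    have hTY : ∀ m, T (Y m) =ᵐ[μ∞] 0 := fun m => by
      obtain ⟨M, hM⟩ := hYE m
      have := isEigen_avg_of_isEigen (le_max_left N M) (hY1 m) (hM _ (le_max_right N M)).1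
      filter_upwards [this] with u hu
      simp only [hT, hu, sub_self, Pi.zero_apply]
    have hTle : ∀ F : (ℕ → E) → ℝ, MemLp F 2 μ∞ →
        eLpNorm (T F) 2 μ∞ ≤ (N * 2 + ‖d‖ₑ) * eLpNorm F 2 μ∞ := fun F hF => by
      have hAF : MemLp (avg μ∞ (Set.Ici N) F) 2 μ∞ := memLp_avg (n := 2) _ two_ne_zero hF
      have hDF : ∀ k, MemLp (coordDiff μ∞ k (avg μ∞ (Set.Ici N) F)) 2 μ∞ := fun k =>
        memLp_coordDiff (n := 2) k two_ne_zero hAF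
      have e : T F = (∑ k ∈ Finset.range N, coordDiff μ∞ k (avg μ∞ (Set.Ici N) F)) -
          d • avg μ∞ (Set.Ici N) F := by
        funext u
        simp [hT]
      rw [e]
      refine (eLpNorm_sub_le (memLp_finsetSum' _ fun k _ => hDF k).1 (hAF.1.const_smul d)
        one_le_two).trans ?_
      rw [add_mul, eLpNorm_const_smul]
      refine add_le_add ?_ (mul_le_mul_right (eLpNorm_avg_le _ hF.1) _)
      refine (eLpNorm_sum_le (fun k _ => (hDF k).1) one_le_two).trans ?_
      refine (Finset.sum_le_sum fun k _ => (eLpNorm_coordDiff_le k hAF.1).trans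
        (mul_le_mul_right (eLpNorm_avg_le _ hF.1) 2)).trans (le_of_eq ?_)
      simp [mul_assoc]
    have hTX : eLpNorm (T X) 2 μ∞ = 0 := by
      have h1 : Tendsto (fun m => (N * 2 + ‖d‖ₑ) * eLpNorm (fun u => Y m u - X u) 2 μ∞) atTop
          (𝓝 0) := by
        have := ENNReal.Tendsto.const_mul (a := (N * 2 + ‖d‖ₑ)) hlim
          (Or.inr (by finiteness))
        simpa using this
      refine le_antisymm (ge_of_tendsto' h1 fun m => ?_) zero_le
      refine le_trans (le_of_eq ?_) (hTle _ (hYX m))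
      have h2 : T X =ᵐ[μ∞] -T (fun u => Y m u - X u) := by
        filter_upwards [hTsub m, hTY m] with u e1 e2
        simp [e1, e2]
      rw [eLpNorm_congr_ae h2, eLpNorm_neg]
    have hTXm : AEStronglyMeasurable (T X) μ∞ :=
      (memLp_finsetSum (Finset.range N) fun k _ =>
        memLp_coordDiff (n := 2) k two_ne_zero (hA N)).1.sub ((hA N).1.const_mul d)
    rw [eLpNorm_eq_zero_iff hTXm two_ne_zero] at hTX
    filter_upwards [hTX] with u hu
    simp only [hT, Pi.zero_apply] at hu
    linarith
  · refine tendsto_integral_sq_of_tendsto_eLpNorm (fun N => (hA N).sub hX) ?_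
    rw [ENNReal.tendsto_nhds_zero]
    intro ε hε
    have h1 : Tendsto (fun m => 2 * eLpNorm (fun u => Y m u - X u) 2 μ∞) atTop (𝓝 0) := by
      simpa using ENNReal.Tendsto.const_mul (a := 2) hlim (Or.inr ENNReal.ofNat_ne_top)
    obtain ⟨m, hm⟩ := ((ENNReal.tendsto_nhds_zero.1 h1) ε hε).exists
    obtain ⟨M, hM⟩ := hYE m
    filter_upwards [eventually_ge_atTop M] with N hN
    refine le_trans ?_ hm
    -- Since tail averaging fixes `Y m` for large `N`, the truncation error of `X` is at most `2 ‖Y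
    -- m - X‖` in `L²`.
    have e : (fun u => avg μ∞ (Set.Ici N) X u - X u) =ᵐ[μ∞]
        (fun u => Y m u - X u) - avg μ∞ (Set.Ici N) (fun u => Y m u - X u) := by
      filter_upwards [avg_sub (Set.Ici N) (hY1 m) hX1, (hM N hN).2] with u e1 e2
      simp only [Pi.sub_apply, e1, e2]
      ring
    rw [eLpNorm_congr_ae e, two_mul]
    exact (eLpNorm_sub_le (hYX m).1 (aestronglyMeasurable_avg _ (hYX m).1) one_le_two).trans
      (add_le_add le_rfl (eLpNorm_avg_le _ (hYX m).1))

end Closure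

/-! ### The alternating sum of partial averages is an eigenvector with eigenvalue `n`. -/

section Expansion

variable {E : Type*} [MeasurableSpace E] {ν : Measure E} [IsProbabilityMeasure ν]

local notation "μ∞" => Measure.infinitePi (fun _ : ℕ => ν)

open Classical in
/-- The injective multi-indices `Fin n → ℕ` with values in `{0, …, M - 1}`. -/
noncomputable def injIndices (n M : ℕ) : Finset (Fin n → ℕ) :=
  (Fintype.piFinset fun _ => Finset.range M).filter Function.Injective

theorem mem_injIndices {n M : ℕ} {κ : Fin n → ℕ} :
    κ ∈ injIndices n M ↔ (∀ i, κ i < M) ∧ Function.Injective κ := by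
  simp [injIndices]

/-- The sum over the multi-indices `κ` of the functionals `G κ`, where the coordinates
`κ r, …, κ (n - 1)` are integrated out. -/
noncomputable def partialAvg (μ : Measure (ℕ → E)) {n : ℕ} (M : ℕ)
    (G : (Fin n → ℕ) → (ℕ → E) → ℝ) (r : ℕ) (u : ℕ → E) : ℝ :=
  ∑ κ ∈ injIndices n M, avg μ (κ '' {i | r ≤ i}) (G κ) u

/-- The functional `∑_r (-1)^(n - r) (n choose r) partialAvg r`. -/
noncomputable def chaosSum (μ : Measure (ℕ → E)) {n : ℕ} (M : ℕ)
    (G : (Fin n → ℕ) → (ℕ → E) → ℝ) (u : ℕ → E) : ℝ :=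
  ∑ r ∈ Finset.range (n + 1), (-1 : ℝ) ^ (n - r) * (n.choose r : ℝ) * partialAvg μ M G r u

theorem avg_eq_self_of_disjoint {S : Set ℕ} {F : (ℕ → E) → ℝ}
    (h : ∀ u w, F (resample S u w) = F u) : avg μ∞ S F = F := by
  funext u
  simp [avg, h]

theorem coordDiff_avg_of_mem {S : Set ℕ} {j : ℕ} (hj : j ∈ S) {F : (ℕ → E) → ℝ}
    (hF : Integrable F μ∞) : coordDiff μ∞ j (avg μ∞ S F) =ᵐ[μ∞] 0 := by
  filter_upwards [avg_coordDiff hj hF, avg_coordDiff_comm S j hF] with u h1 h2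
  rw [← h2, h1]

theorem coordDiff_avg_eq {S : Set ℕ} {j : ℕ} {F : (ℕ → E) → ℝ} (hF : Integrable F μ∞) :
    coordDiff μ∞ j (avg μ∞ S F) =ᵐ[μ∞] fun u => avg μ∞ S F u - avg μ∞ (insert j S) F u := by
  filter_upwards [avg_avg {j} S hF] with u hu
  rw [coordDiff, hu, Set.singleton_union]

variable {n : ℕ} {M : ℕ} {G : (Fin n → ℕ) → (ℕ → E) → ℝ}

theorem memLp_partialAvg (hG : ∀ κ ∈ injIndices n M, MemLp (G κ) 2 μ∞) (r : ℕ) :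
    MemLp (partialAvg μ∞ M G r) 2 μ∞ :=
  memLp_finsetSum _ fun κ hκ => memLp_avg (n := 2) _ two_ne_zero (hG κ hκ)

theorem memLp_chaosSum (hG : ∀ κ ∈ injIndices n M, MemLp (G κ) 2 μ∞) :
    MemLp (chaosSum μ∞ M G) 2 μ∞ :=
  memLp_finsetSum _ fun r _ => (memLp_partialAvg hG r).const_mul _

theorem avg_Ici_partialAvg (hG : ∀ κ ∈ injIndices n M, MemLp (G κ) 2 μ∞)
    (hloc : ∀ κ (S : Set ℕ), Disjoint S (Set.range κ) → ∀ u w, G κ (resample S u w) = G κ u)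
    {N : ℕ} (hN : M ≤ N) (r : ℕ) :
    avg μ∞ (Set.Ici N) (partialAvg μ∞ M G r) =ᵐ[μ∞] partialAvg μ∞ M G r := by
  have hG1 : ∀ κ ∈ injIndices n M, Integrable (G κ) μ∞ := fun κ hκ =>
    (hG κ hκ).integrable one_le_two
  have h1 := avg_finsetSum (injIndices n M)
    (F := fun κ => avg μ∞ (κ '' {i | r ≤ i}) (G κ)) (Set.Ici N)
    fun κ hκ => integrable_avg _ (hG1 κ hκ)
  have h2 : ∀ᵐ u ∂μ∞, ∀ κ ∈ injIndices n M,
      avg μ∞ (Set.Ici N) (avg μ∞ (κ '' {i | r ≤ i}) (G κ)) u =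
        avg μ∞ (κ '' {i | r ≤ i}) (G κ) u := by
    refine (ae_ball_iff (injIndices n M).countable_toSet).2 fun κ hκ => ?_
    refine (avg_comm _ _ (hG1 κ hκ)).trans (ae_of_all _ fun u => ?_)
    rw [avg_eq_self_of_disjoint (hloc κ (Set.Ici N) ?_)]
    rw [Set.disjoint_left]
    rintro _ hx ⟨i, rfl⟩
    have := (mem_injIndices.1 hκ).1 i
    have : N ≤ κ i := hx
    omega
  filter_upwards [h1, h2] with u e1 e2
  exact e1.trans (Finset.sum_congr rfl e2)

/-- `D_j` kills the term when `j` is already averaged, and also when `G κ` does not depend on `j`.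
What remains is `j = κ i` with `i < r`, where `D_j E_S = E_S - E_{S ∪ {j}}`. -/
theorem sum_coordDiff_avg (hloc : ∀ κ (S : Set ℕ), Disjoint S (Set.range κ) →
      ∀ u w, G κ (resample S u w) = G κ u)
    {N : ℕ} (hN : M ≤ N) {κ : Fin n → ℕ} (hκ : κ ∈ injIndices n M) (hG : Integrable (G κ) μ∞)
    (r : ℕ) :
    (fun u => ∑ j ∈ Finset.range N, coordDiff μ∞ j (avg μ∞ (κ '' {i | r ≤ i}) (G κ)) u) =ᵐ[μ∞]
      fun u => ∑ i ∈ Finset.univ.filter (fun i : Fin n => (i : ℕ) < r), (avg μ∞ (κ '' {i | r ≤ i}) (G κ) u -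
        avg μ∞ (insert (κ i) (κ '' {i | r ≤ i})) (G κ) u) := by
  obtain ⟨hlt, hinj⟩ := mem_injIndices.1 hκ
  have h1 : ∀ᵐ u ∂μ∞, ∀ j, j ∉ Set.range κ →
      coordDiff μ∞ j (avg μ∞ (κ '' {i | r ≤ i}) (G κ)) u = 0 := by
    refine ae_all_iff.2 fun j => ?_
    by_cases hj : j ∈ Set.range κ
    · exact ae_of_all _ fun u h => absurd hj h
    · filter_upwards [avg_coordDiff_comm (κ '' {i | r ≤ i}) j hG] with u hu _
      rw [← hu]
      have : coordDiff μ∞ j (G κ) = fun _ => 0 := by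
        funext v
        rw [coordDiff, avg_eq_self_of_disjoint (hloc κ {j} (by simpa using hj)), sub_self]
      rw [this]
      simp [avg]
  have h2 : ∀ᵐ u ∂μ∞, ∀ i : Fin n, r ≤ i →
      coordDiff μ∞ (κ i) (avg μ∞ (κ '' {i | r ≤ i}) (G κ)) u = 0 := by
    refine ae_all_iff.2 fun i => ?_
    by_cases hi : r ≤ (i : ℕ)
    · filter_upwards [coordDiff_avg_of_mem (S := κ '' {i | r ≤ (i : ℕ)}) ⟨i, hi, rfl⟩ hG] with u hu _
      exact hu
    · exact ae_of_all _ fun u h => absurd h hi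
  have h3 : ∀ᵐ u ∂μ∞, ∀ i : Fin n, coordDiff μ∞ (κ i) (avg μ∞ (κ '' {i | r ≤ i}) (G κ)) u =
      avg μ∞ (κ '' {i | r ≤ i}) (G κ) u -
        avg μ∞ (insert (κ i) (κ '' {i | r ≤ i})) (G κ) u :=
    ae_all_iff.2 fun i => coordDiff_avg_eq hG
  filter_upwards [h1, h2, h3] with u e1 e2 e3
  have hsub : Finset.univ.image κ ⊆ Finset.range N := by
    intro j hj
    obtain ⟨i, _, rfl⟩ := Finset.mem_image.1 hj
    exact Finset.mem_range.2 ((hlt i).trans_le hN)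
  rw [← Finset.sum_subset hsub fun j _ hj => e1 j (by simpa using hj),
    Finset.sum_image hinj.injOn]
  rw [Finset.sum_filter]
  refine Finset.sum_congr rfl fun i _ => ?_
  split_ifs with hi
  · exact e3 i
  · exact e2 i (not_lt.1 hi)

theorem sum_avg_insert (hsymm : ∀ κ (σ : Equiv.Perm (Fin n)), G (fun i => κ (σ i)) = G κ)
    {r : ℕ} (hr : r < n) {i : Fin n} (hi : i ≤ r) (μ : Measure (ℕ → E)) (u : ℕ → E) :
    ∑ κ ∈ injIndices n M, avg μ (insert (κ i) (κ '' {i | r + 1 ≤ i})) (G κ) u =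
      partialAvg μ M G r u := by
  -- Relabelling by the transposition of `i` and `r` moves the extra averaged coordinate to position
  -- `r`; symmetry of the kernel leaves `G κ` unchanged.
  set σ : Equiv.Perm (Fin n) := Equiv.swap i ⟨r, hr⟩ with hσ
  refine Finset.sum_bij' (fun κ _ => fun a => κ (σ a)) (fun κ _ => fun a => κ (σ a)) ?_ ?_ ?_ ?_ ?_
  · intro κ hκ
    rw [mem_injIndices] at hκ ⊢
    exact ⟨fun a => hκ.1 _, hκ.2.comp σ.injective⟩
  · intro κ hκ
    rw [mem_injIndices] at hκ ⊢
    exact ⟨fun a => hκ.1 _, hκ.2.comp σ.injective⟩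
  · intro κ _
    funext a
    simp [hσ]
  · intro κ _
    funext a
    simp [hσ]
  · intro κ _
    rw [hsymm κ σ]
    congr 1
    have e : (fun a => κ (σ a)) '' {a | r ≤ (a : ℕ)} = κ '' (σ '' {a | r ≤ (a : ℕ)}) := by
      rw [Set.image_image]
    rw [e, ← Set.image_insert_eq]
    congr 1
    ext a
    simp only [Set.mem_insert_iff, Set.mem_ofPred_eq, Set.mem_image]
    constructor
    · rintro (rfl | ha)
      · exact ⟨⟨r, hr⟩, le_rfl, by simp [hσ]⟩
      · refine ⟨a, by omega, ?_⟩
        rw [hσ, Equiv.swap_apply_of_ne_of_ne]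
        · rintro rfl; omega
        · rintro rfl; simp at ha
    · rintro ⟨b, hb, rfl⟩
      by_cases hbr : b = ⟨r, hr⟩
      · left; simp [hσ, hbr]
      · have hb' : r ≠ (b : ℕ) := fun h => hbr (Fin.ext h.symm)
        right
        rw [hσ, Equiv.swap_apply_of_ne_of_ne]
        · omega
        · rintro rfl; omega
        · exact hbr

/-- Each multi-index has `r` coordinates still free, and averaging any one of them gives the same
total `partialAvg (r - 1)`. At `r = 0` the truncated `r - 1` is harmless because its coefficient is
zero. -/
theorem sum_coordDiff_partialAvg (hG : ∀ κ ∈ injIndices n M, Integrable (G κ) μ∞)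
    (hsymm : ∀ κ (σ : Equiv.Perm (Fin n)), G (fun i => κ (σ i)) = G κ)
    (hloc : ∀ κ (S : Set ℕ), Disjoint S (Set.range κ) → ∀ u w, G κ (resample S u w) = G κ u)
    {N : ℕ} (hN : M ≤ N) {r : ℕ} (hr : r ≤ n) :
    (fun u => ∑ j ∈ Finset.range N, coordDiff μ∞ j (partialAvg μ∞ M G r) u) =ᵐ[μ∞]
      fun u => r * partialAvg μ∞ M G r u - r * partialAvg μ∞ M G (r - 1) u := by
  have h1 : ∀ᵐ u ∂μ∞, ∀ j, coordDiff μ∞ j (partialAvg μ∞ M G r) u =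
      ∑ κ ∈ injIndices n M, coordDiff μ∞ j (avg μ∞ (κ '' {i | r ≤ i}) (G κ)) u :=
    ae_all_iff.2 fun j => coordDiff_finsetSum (injIndices n M)
      (F := fun κ => avg μ∞ (κ '' {i | r ≤ i}) (G κ)) j
      fun κ hκ => integrable_avg _ (hG κ hκ)
  have h2 := (ae_ball_iff (injIndices n M).countable_toSet).2 fun κ hκ =>
    sum_coordDiff_avg hloc hN hκ (hG κ hκ) r
  filter_upwards [h1, h2] with u e1 e2
  simp only [e1]
  rw [Finset.sum_comm, Finset.sum_congr rfl e2, Finset.sum_comm]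
  simp only [Finset.sum_sub_distrib]
  have hcard : (Finset.univ.filter fun i : Fin n => (i : ℕ) < r).card = r := by
    rw [Fin.card_filter_val_lt, min_eq_right hr]
  congr 1
  · rw [Finset.sum_const, hcard, nsmul_eq_mul]
    rfl
  · rcases Nat.eq_zero_or_pos r with rfl | hr0
    · simp
    · obtain ⟨q, rfl⟩ : ∃ q, r = q + 1 := ⟨r - 1, by omega⟩
      rw [Finset.sum_congr rfl fun i hi => sum_avg_insert (M := M) hsymm (r := q) (by omega)
        (by have := (Finset.mem_filter.1 hi).2; omega) μ∞ u, Finset.sum_const, hcard,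
        nsmul_eq_mul]
      rfl

/-- Shifting the index in the second part and using `(r + 1) (n choose r+1) = (n - r) (n choose r)`
turns its coefficient into `n - r`, which adds up with `r` to `n`. -/
theorem sum_alternating_choose_mul (n : ℕ) (a : ℕ → ℝ) :
    ∑ r ∈ Finset.range (n + 1), (-1 : ℝ) ^ (n - r) * (n.choose r : ℝ) *
      (r * a r - r * a (r - 1)) =
    n * ∑ r ∈ Finset.range (n + 1), (-1 : ℝ) ^ (n - r) * (n.choose r : ℝ) * a r := by
  have h1 : ∑ r ∈ Finset.range (n + 1), (-1 : ℝ) ^ (n - r) * (n.choose r : ℝ) *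
      (r * a (r - 1)) = ∑ r ∈ Finset.range n, (-1 : ℝ) ^ (n - (r + 1)) *
      (n.choose (r + 1) : ℝ) * ((r + 1 : ℕ) * a r) := by
    rw [Finset.sum_range_succ']
    simp
  have h2 : ∑ r ∈ Finset.range n, (-1 : ℝ) ^ (n - (r + 1)) * (n.choose (r + 1) : ℝ) *
      ((r + 1 : ℕ) * a r) = -∑ r ∈ Finset.range (n + 1), (-1 : ℝ) ^ (n - r) * (n.choose r : ℝ) *
      ((n - r : ℝ) * a r) := by
    rw [Finset.sum_range_succ, sub_self, zero_mul, mul_zero, add_zero, ← Finset.sum_neg_distrib]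
    refine Finset.sum_congr rfl fun r hr => ?_
    have hr' : r < n := Finset.mem_range.1 hr
    have h3 : ((n.choose (r + 1) : ℝ)) * ((r + 1 : ℕ) : ℝ) = (n.choose r : ℝ) * (n - r : ℝ) := by
      have := Nat.choose_succ_right_eq n r
      rw [← Nat.cast_sub hr'.le]
      exact_mod_cast this
    have h4 : (-1 : ℝ) ^ (n - r) = -(-1 : ℝ) ^ (n - (r + 1)) := by
      have : n - r = (n - (r + 1)) + 1 := by omega
      rw [this, pow_succ]
      ring
    rw [h4]
    linear_combination (-1 : ℝ) ^ (n - (r + 1)) * a r * h3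
  simp only [mul_sub, Finset.sum_sub_distrib]
  rw [h1, h2, sub_neg_eq_add, ← Finset.sum_add_distrib, Finset.mul_sum]
  exact Finset.sum_congr rfl fun r _ => by ring

theorem avg_Ici_chaosSum (hG : ∀ κ ∈ injIndices n M, MemLp (G κ) 2 μ∞)
    (hloc : ∀ κ (S : Set ℕ), Disjoint S (Set.range κ) → ∀ u w, G κ (resample S u w) = G κ u)
    {N : ℕ} (hN : M ≤ N) :
    avg μ∞ (Set.Ici N) (chaosSum μ∞ M G) =ᵐ[μ∞] chaosSum μ∞ M G := by
  have h1 := avg_finsetSum (Finset.range (n + 1)) (F := fun r u =>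
      (-1 : ℝ) ^ (n - r) * (n.choose r : ℝ) * partialAvg μ∞ M G r u) (Set.Ici N)
      fun r _ => ((memLp_partialAvg hG r).integrable one_le_two).const_mul _
  have h2 : ∀ᵐ u ∂μ∞, ∀ r, avg μ∞ (Set.Ici N) (partialAvg μ∞ M G r) u = partialAvg μ∞ M G r u :=
    ae_all_iff.2 fun r => avg_Ici_partialAvg hG hloc hN r
  filter_upwards [h1, h2] with u e1 e2
  refine e1.trans (Finset.sum_congr rfl fun r _ => ?_)
  rw [avg_const_mul]
  beta_reduce
  rw [e2]

theorem isEigen_chaosSum (hG : ∀ κ ∈ injIndices n M, MemLp (G κ) 2 μ∞)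
    (hsymm : ∀ κ (σ : Equiv.Perm (Fin n)), G (fun i => κ (σ i)) = G κ)
    (hloc : ∀ κ (S : Set ℕ), Disjoint S (Set.range κ) → ∀ u w, G κ (resample S u w) = G κ u)
    {N : ℕ} (hN : M ≤ N) :
    IsEigen μ∞ (Finset.range N) n (chaosSum μ∞ M G) := by
  have h1 : ∀ᵐ u ∂μ∞, ∀ j, coordDiff μ∞ j (chaosSum μ∞ M G) u =
      ∑ r ∈ Finset.range (n + 1), (-1 : ℝ) ^ (n - r) * (n.choose r : ℝ) *
        coordDiff μ∞ j (partialAvg μ∞ M G r) u := by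
    refine ae_all_iff.2 fun j => ?_
    have := coordDiff_finsetSum (Finset.range (n + 1)) (F := fun r u =>
      (-1 : ℝ) ^ (n - r) * (n.choose r : ℝ) * partialAvg μ∞ M G r u) j
      fun r _ => ((memLp_partialAvg hG r).integrable one_le_two).const_mul _
    filter_upwards [this] with u hu
    refine hu.trans (Finset.sum_congr rfl fun r _ => ?_)
    rw [coordDiff_const_mul]
  have h2 := (ae_ball_iff (Finset.range (n + 1)).countable_toSet).2 fun r hr =>
    sum_coordDiff_partialAvg (fun κ hκ => (hG κ hκ).integrable one_le_two) hsymm hloc hN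
      (Nat.lt_succ_iff.1 (Finset.mem_range.1 hr))
  filter_upwards [h1, h2] with u e1 e2
  simp only [e1]
  rw [Finset.sum_comm]
  simp only [← Finset.mul_sum]
  rw [Finset.sum_congr rfl fun r hr => by rw [e2 r hr]]
  exact sum_alternating_choose_mul n fun r => partialAvg μ∞ M G r u

end Expansion

/-! ### The uniform product law and its blocks on the half-line. -/

section Uniform

/-- The uniform distribution on `[-1, 1]`. -/
noncomputable def uniformLaw : Measure ℝ := cond volume (Set.Icc (-1 : ℝ) 1)

instance : SigmaFinite halfLebesgue := by
  have h : halfLebesgue = (2⁻¹ : NNReal) • volume.restrict (Set.Ici (0 : ℝ)) := by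
    rw [halfLebesgue, ← ENNReal.coe_two, ← ENNReal.coe_inv two_ne_zero]
    rfl
  rw [h]
  infer_instance

instance : IsProbabilityMeasure uniformLaw :=
  cond_isProbabilityMeasure_of_finite (by simp) (by simp)

/-- The law of an i.i.d. sequence of uniform random variables on `[-1, 1]`. -/
noncomputable def uniformSeq : Measure (ℕ → ℝ) := Measure.infinitePi fun _ => uniformLaw

instance : IsProbabilityMeasure uniformSeq := by
  unfold uniformSeq; infer_instance

theorem uniformLaw_eq : uniformLaw = (2⁻¹ : ℝ≥0∞) • volume.restrict (Set.Icc (-1 : ℝ) 1) := by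
  rw [uniformLaw, ProbabilityTheory.cond, Real.volume_Icc]
  norm_num

theorem map_add_uniformLaw (j : ℕ) :
    uniformLaw.map (fun v => 2 * (j : ℝ) + 1 + v) =
      (2⁻¹ : ℝ≥0∞) • volume.restrict (Set.Ico (2 * (j : ℝ)) (2 * j + 2)) := by
  have h := (measurePreserving_add_left volume (2 * (j : ℝ) + 1)).restrict_preimage
    (s := Set.Icc (2 * (j : ℝ)) (2 * j + 2)) measurableSet_Icc
  have e : (fun v => 2 * (j : ℝ) + 1 + v) ⁻¹' Set.Icc (2 * (j : ℝ)) (2 * j + 2) =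
      Set.Icc (-1) 1 := by
    ext v
    simp only [Set.mem_preimage, Set.mem_Icc]
    constructor <;> rintro ⟨h1, h2⟩ <;> constructor <;> linarith
  rw [e] at h
  rw [uniformLaw_eq, Measure.map_smul, h.map_eq, Measure.restrict_congr_set Ico_ae_eq_Icc]

theorem ae_uniformSeq_mem_Ioo : ∀ᵐ u ∂uniformSeq, ∀ j, -1 < u j ∧ u j < 1 := by
  refine ae_all_iff.2 fun j => ?_
  have h : ∀ᵐ v ∂uniformLaw, -1 < v ∧ v < 1 := by
    rw [uniformLaw_eq]
    refine Measure.ae_smul_measure ?_ _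
    rw [← Measure.restrict_congr_set Ioo_ae_eq_Icc]
    exact ae_restrict_mem measurableSet_Ioo
  exact (measurePreserving_eval_infinitePi (fun _ : ℕ => uniformLaw) j).quasiMeasurePreserving.ae h

theorem halfLebesgue_restrict_Ico (j : ℕ) :
    halfLebesgue.restrict (Set.Ico (2 * (j : ℝ)) (2 * j + 2)) =
      (2⁻¹ : ℝ≥0∞) • volume.restrict (Set.Ico (2 * (j : ℝ)) (2 * j + 2)) := by
  have h : Set.Ico (2 * (j : ℝ)) (2 * j + 2) ⊆ Set.Ici 0 := fun v hv =>
    le_trans (by positivity) hv.1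
  rw [halfLebesgue, Measure.restrict_smul, Measure.restrict_restrict measurableSet_Ico,
    Set.inter_eq_left.2 h]

/-- The points of `ℝ^s` that correspond to the coordinates `l` of a sequence. -/
def blockPoint {s : ℕ} (l : Fin s → ℕ) (u : ℕ → ℝ) (i : Fin s) : ℝ := 2 * (l i : ℝ) + 1 + u (l i)

/-- The half-open box that corresponds to the coordinates `l`. -/
def blockBox {s : ℕ} (l : Fin s → ℕ) : Set (Fin s → ℝ) :=
  Set.univ.pi fun i => Set.Ico (2 * (l i : ℝ)) (2 * l i + 2)

theorem measurable_blockPoint {s : ℕ} (l : Fin s → ℕ) : Measurable (blockPoint l) :=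
  measurable_pi_iff.2 fun i => (measurable_pi_apply (l i)).const_add _

theorem measurableSet_blockBox {s : ℕ} (l : Fin s → ℕ) : MeasurableSet (blockBox l) :=
  MeasurableSet.univ_pi fun _ => measurableSet_Ico

/-- Distinct indices give independent coordinates, each with law `dx/2` on its block. Distinctness
is indispensable: a repeated index would give a law concentrated on a diagonal. -/
theorem map_blockPoint {s : ℕ} {l : Fin s → ℕ} (hl : Function.Injective l) :
    uniformSeq.map (blockPoint l) = (halfLebesguePi s).restrict (blockBox l) := by
  have h1 : iIndepFun (fun (j : ℕ) (w : ℕ → ℝ) => 2 * (j : ℝ) + 1 + w j) uniformSeq :=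
    iIndepFun_infinitePi (P := fun _ => uniformLaw) (X := fun (j : ℕ) (v : ℝ) => 2 * (j : ℝ) + 1 + v)
      fun j => measurable_id.const_add _
  have h2 := h1.precomp hl
  have hm : ∀ i, AEMeasurable (fun w : ℕ → ℝ => 2 * (l i : ℝ) + 1 + w (l i)) uniformSeq := fun i =>
    (measurable_pi_iff.1 (measurable_blockPoint l) i).aemeasurable
  replace h2 := (iIndepFun_iff_map_fun_eq_pi_map hm).1 h2
  change uniformSeq.map (fun w i => 2 * (l i : ℝ) + 1 + w (l i)) = _
  rw [h2, halfLebesguePi, blockBox, Measure.restrict_pi_pi]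
  congr 1
  funext i
  have h3 : uniformSeq.map (fun w => 2 * (l i : ℝ) + 1 + w (l i)) =
      uniformLaw.map (fun v => 2 * (l i : ℝ) + 1 + v) := by
    have h4 := (measurePreserving_eval_infinitePi (fun _ : ℕ => uniformLaw) (l i)).map_eq
    conv_rhs => rw [← h4]
    rw [Measure.map_map (by fun_prop) (by fun_prop)]
    rfl
  rw [h3, map_add_uniformLaw, halfLebesgue_restrict_Ico]

theorem halfLebesguePi_restrict_blockBox {s : ℕ} (l : Fin s → ℕ) :
    (halfLebesguePi s).restrict (blockBox l) =
      ((2⁻¹ : ℝ≥0∞) ^ s) • volume.restrict (blockBox l) := by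
  rw [halfLebesguePi, blockBox, Measure.restrict_pi_pi, volume_pi, Measure.restrict_pi_pi]
  symm
  refine (Measure.pi_eq fun t _ => ?_).symm
  rw [Measure.smul_apply, Measure.pi_pi, smul_eq_mul]
  have h : ∀ i, (halfLebesgue.restrict (Set.Ico (2 * (l i : ℝ)) (2 * l i + 2))) (t i) =
      2⁻¹ * (volume.restrict (Set.Ico (2 * (l i : ℝ)) (2 * l i + 2))) (t i) := fun i => by
    rw [halfLebesgue_restrict_Ico]
    rfl
  simp only [h, Finset.prod_mul_distrib, Finset.prod_const, Finset.card_univ, Fintype.card_fin]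

theorem measurePreserving_blockPoint {s : ℕ} {l : Fin s → ℕ} (hl : Function.Injective l) :
    MeasurePreserving (blockPoint l) uniformSeq ((halfLebesguePi s).restrict (blockBox l)) :=
  ⟨measurable_blockPoint l, map_blockPoint hl⟩

end Uniform

/-! ### Concatenation of index tuples and of points. -/

section Join

/-- Concatenation of two tuples of lengths `r` and `n - r`. -/
def joinFun {α : Type*} (n r : ℕ) (p : Fin r → α) (y : Fin (n - r) → α) : Fin n → α := fun i =>
  if h : (i : ℕ) < r then p ⟨i, h⟩ else y ⟨(i : ℕ) - r, by have := i.isLt; omega⟩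

theorem joinFun_of_lt {α : Type*} {n r : ℕ} (p : Fin r → α) (y : Fin (n - r) → α) {i : Fin n}
    (h : (i : ℕ) < r) : joinFun n r p y i = p ⟨i, h⟩ := by
  simp [joinFun, h]

theorem joinFun_of_ge {α : Type*} {n r : ℕ} (p : Fin r → α) (y : Fin (n - r) → α) {i : Fin n}
    (h : r ≤ (i : ℕ)) :
    joinFun n r p y i = y ⟨(i : ℕ) - r, by have := i.isLt; omega⟩ := by
  simp [joinFun, not_lt.2 h]

/-- Concatenation of tuples as an equivalence. -/
def joinEquiv (α : Type*) {n r : ℕ} (hr : r ≤ n) :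
    (Fin r → α) × (Fin (n - r) → α) ≃ (Fin n → α) where
  toFun q := joinFun n r q.1 q.2
  invFun x := (fun i => x ⟨i, by have := i.isLt; omega⟩,
    fun i => x ⟨r + i, by have := i.isLt; omega⟩)
  left_inv q := by
    refine Prod.ext (funext fun i => ?_) (funext fun i => ?_)
    · exact joinFun_of_lt q.1 q.2 i.isLt
    · simp only
      rw [joinFun_of_ge q.1 q.2 (by simp)]
      exact congrArg q.2 (Fin.ext (by simp))
  right_inv x := by
    funext i
    rcases lt_or_ge (i : ℕ) r with h | h
    · exact joinFun_of_lt _ _ h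
    · refine (joinFun_of_ge _ _ h).trans (congrArg x (Fin.ext ?_))
      simp only
      omega

/-- Reading the integration variables `y` as an independent copy `w` makes them a resampling of the
last `n - r` coordinates; injectivity keeps the first `r` out of the resampled set. -/
theorem joinCoords_blockPoint {n r : ℕ} {k : Fin r → ℕ} {l : Fin (n - r) → ℕ}
    (hinj : Function.Injective (joinFun n r k l)) (u w : ℕ → ℝ) :
    joinCoords n r (blockPoint k u) (blockPoint l w) =
      blockPoint (joinFun n r k l) (resample (joinFun n r k l '' {i | r ≤ i}) u w) := by
  funext i
  rcases lt_or_ge (i : ℕ) r with h | h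
  · have hn : joinFun n r k l i ∉ joinFun n r k l '' {i | r ≤ (i : ℕ)} := by
      rintro ⟨j, hj, hji⟩
      rw [hinj hji] at hj
      exact absurd hj (not_le.2 h)
    rw [blockPoint, resample_notMem hn, joinFun_of_lt k l h]
    simp only [joinCoords, h, dif_pos, blockPoint]
  · have hm : joinFun n r k l i ∈ joinFun n r k l '' {i | r ≤ (i : ℕ)} := ⟨i, h, rfl⟩
    rw [blockPoint, resample_mem hm, joinFun_of_ge k l h]
    simp only [joinCoords, not_lt.2 h, dif_neg, not_false_eq_true, blockPoint]

/-- The inequalities on `x` must be strict: the boxes defining `offDiagonal` are closed, so a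
boundary point can belong to a neighbouring box with distinct indices. -/
theorem notMem_offDiagonal {n : ℕ} {κ : Fin n → ℕ} (hκ : ¬ Function.Injective κ) {x : Fin n → ℝ}
    (hx : ∀ i, 2 * (κ i : ℝ) < x i ∧ x i < 2 * κ i + 2) : x ∉ offDiagonal n := by
  rintro ⟨k, hk⟩
  refine hκ ?_
  have : κ = k := by
    funext i
    have h1 := hx i
    have h2 := hk i
    have h3 : (k i : ℝ) < κ i + 1 := by linarith [h2.1]
    have h4 : (κ i : ℝ) < k i + 1 := by linarith [h2.2]
    have h5 : k i < κ i + 1 := by exact_mod_cast h3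
    have h6 : κ i < k i + 1 := by exact_mod_cast h4
    omega
  rw [this]
  exact k.injective

end Join

/-! ### The explicit multiple integral as a combination of partial averages. -/

section Elementary

theorem measurable_joinCoords {n r : ℕ} (p : Fin r → ℝ) : Measurable (joinCoords n r p) := by
  refine measurable_pi_iff.2 fun i => ?_
  by_cases h : (i : ℕ) < r
  · simp only [joinCoords, h, dif_pos]
    exact measurable_const
  · simp only [joinCoords, h, dif_neg, not_false_eq_true]
    exact measurable_pi_apply _

theorem mem_Ioo_joinCoords {n r : ℕ} {k : Fin r → ℕ} {l : Fin (n - r) → ℕ} {p : Fin r → ℝ}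
    {y : Fin (n - r) → ℝ} (hp : ∀ i, 2 * (k i : ℝ) < p i ∧ p i < 2 * k i + 2)
    (hy : ∀ i, 2 * (l i : ℝ) < y i ∧ y i < 2 * l i + 2) (i : Fin n) :
    2 * ((joinFun n r k l i : ℕ) : ℝ) < joinCoords n r p y i ∧
      joinCoords n r p y i < 2 * ((joinFun n r k l i : ℕ) : ℝ) + 2 := by
  by_cases h : (i : ℕ) < r
  · simp only [joinCoords, joinFun, h, dif_pos]
    exact hp _
  · simp only [joinCoords, joinFun, h, dif_neg, not_false_eq_true]
    exact hy _

theorem blockPoint_mem_Ioo {r : ℕ} (k : Fin r → ℕ) {u : ℕ → ℝ} (hu : ∀ j, -1 < u j ∧ u j < 1)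
    (i : Fin r) : 2 * (k i : ℝ) < blockPoint k u i ∧ blockPoint k u i < 2 * k i + 2 := by
  have := hu (k i)
  simp only [blockPoint]
  constructor <;> linarith [this.1, this.2]

theorem joinFun_injective_right {n r : ℕ} (hr : r ≤ n) {k : Fin r → ℕ} {l : Fin (n - r) → ℕ}
    (h : Function.Injective (joinFun n r k l)) : Function.Injective l := by
  intro a b hab
  have e : ∀ c : Fin (n - r), joinFun n r k l ⟨r + c, by have := c.isLt; omega⟩ = l c := fun c => by
    rw [joinFun_of_ge k l (by simp)]
    exact congrArg l (Fin.ext (by simp))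
  rw [← e a, ← e b] at hab
  have := congrArg Fin.val (h hab)
  exact Fin.ext (by simpa using this)

open Classical in
/-- The average of `g ∘ blockPoint κ` over the coordinates `κ r, …, κ (n - 1)`, for injective `κ`. -/
noncomputable def injAvg {n : ℕ} (g : (Fin n → ℝ) → ℝ) (r : ℕ) (u : ℕ → ℝ) (κ : Fin n → ℕ) : ℝ :=
  if Function.Injective κ then
    avg uniformSeq (κ '' {i | r ≤ i}) (fun v => g (blockPoint κ v)) u
  else 0

/-- For distinct indices, `dy` on the box is `2^(n - r)` times the law of the resampled points.
Otherwise the kernel vanishes on the open box. The null set `A` carries the gap between `g` and a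
measurable version, since a section of `g` need not be measurable for every `u`. -/
theorem integral_blockBox {n r : ℕ} (hr : r ≤ n) {g gm : (Fin n → ℝ) → ℝ}
    (hv : ∀ x, x ∉ offDiagonal n → g x = 0) (hgm : Measurable gm) {A : Set (Fin n → ℝ)}
    (hA : MeasurableSet A) (hgA : ∀ x, x ∉ A → g x = gm x) {u : ℕ → ℝ}
    (hu : ∀ j, -1 < u j ∧ u j < 1) (k : Fin r → ℕ) (l : Fin (n - r) → ℕ)
    (h1 : Function.Injective (joinFun n r k l) → ∀ᵐ w ∂uniformSeq, blockPoint (joinFun n r k l)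
      (resample (joinFun n r k l '' {i | r ≤ i}) u w) ∉ A)
    (h2 : Function.Injective (joinFun n r k l) → Integrable (fun w => g (blockPoint
      (joinFun n r k l) (resample (joinFun n r k l '' {i | r ≤ i}) u w))) uniformSeq) :
    IntegrableOn (fun y => g (joinCoords n r (blockPoint k u) y)) (blockBox l) ∧
      ∫ y in blockBox l, g (joinCoords n r (blockPoint k u) y) =
        2 ^ (n - r) * injAvg g r u (joinFun n r k l) := by
  by_cases hinj : Function.Injective (joinFun n r k l)
  · have hmap := map_blockPoint (joinFun_injective_right hr hinj)
    have hT := measurable_blockPoint l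
    have hJ := measurable_joinCoords (n := n) (blockPoint k u)
    have e := joinCoords_blockPoint hinj u
    have hae : ∀ᵐ y ∂(uniformSeq.map (blockPoint l)), joinCoords n r (blockPoint k u) y ∉ A := by
      refine (ae_map_iff hT.aemeasurable
        (p := fun y => joinCoords n r (blockPoint k u) y ∉ A) (hJ hA.compl)).2 ?_
      filter_upwards [h1 hinj] with w hw
      rwa [e]
    have hmeas : AEStronglyMeasurable (fun y => g (joinCoords n r (blockPoint k u) y))
        (uniformSeq.map (blockPoint l)) := by
      refine AEStronglyMeasurable.congr (hgm.comp hJ).aestronglyMeasurable ?_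
      filter_upwards [hae] with y hy
      exact (hgA _ hy).symm
    have hint : Integrable (fun y => g (joinCoords n r (blockPoint k u) y))
        (uniformSeq.map (blockPoint l)) := by
      rw [integrable_map_measure hmeas hT.aemeasurable]
      simpa only [Function.comp_def, e] using h2 hinj
    have hval := integral_map hT.aemeasurable hmeas
    simp only [e] at hval
    rw [hmap, halfLebesguePi_restrict_blockBox] at hint hval
    rw [integrable_smul_measure (by simp) (by simp)] at hint
    rw [integral_smul_measure] at hval
    refine ⟨hint, ?_⟩
    rw [injAvg, if_pos hinj, avg, ← hval]
    simp only [ENNReal.toReal_pow, ENNReal.toReal_inv, ENNReal.toReal_ofNat, smul_eq_mul]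
    rw [← mul_assoc, ← mul_pow]
    norm_num
  · have hz : (fun y => g (joinCoords n r (blockPoint k u) y)) =ᵐ[volume.restrict (blockBox l)]
        fun _ => 0 := by
      -- The left faces of the half-open box are discarded to reach the open box.
      have hne : ∀ᵐ y : Fin (n - r) → ℝ, ∀ i, y i ≠ 2 * (l i : ℝ) :=
        ae_all_iff.2 fun i => Measure.ae_eval_ne (μ := fun _ : Fin (n - r) => (volume : Measure ℝ)) i _
      filter_upwards [ae_restrict_of_ae hne, ae_restrict_mem (measurableSet_blockBox l)] with y hy hb
      refine hv _ (notMem_offDiagonal hinj (mem_Ioo_joinCoords (blockPoint_mem_Ioo k hu) fun i => ?_))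
      have := hb i (Set.mem_univ i)
      exact ⟨lt_of_le_of_ne this.1 (hy i).symm, this.2⟩
    refine ⟨(integrable_congr hz).2 (integrable_zero _ _ _), ?_⟩
    rw [integral_congr_ae hz, injAvg, if_neg hinj]
    simp

/-- The box integrals add up to the integral over the orthant. -/
theorem integral_orthant_eq_sum {s M : ℕ} {H : (Fin s → ℝ) → ℝ}
    (hH : ∀ y, (∀ i, 0 ≤ y i) → (∃ i, 2 * (M : ℝ) ≤ y i) → H y = 0)
    (hint : ∀ l : Fin s → ℕ, (∀ i, l i < M) → IntegrableOn H (blockBox l)) :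
    ∫ y in {y : Fin s → ℝ | ∀ i, 0 ≤ y i}, H y =
      ∑ l ∈ Fintype.piFinset (fun _ : Fin s => Finset.range M), ∫ y in blockBox l, H y := by
  have hU : (⋃ l ∈ Fintype.piFinset (fun _ : Fin s => Finset.range M), blockBox l) ⊆
      {y : Fin s → ℝ | ∀ i, 0 ≤ y i} := by
    refine Set.iUnion₂_subset fun l _ y hy i => ?_
    exact le_trans (by positivity) (hy i (Set.mem_univ i)).1
  have hms : MeasurableSet {y : Fin s → ℝ | ∀ i, 0 ≤ y i} := by
    have : {y : Fin s → ℝ | ∀ i, 0 ≤ y i} = Set.univ.pi fun _ => Set.Ici 0 := by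
      ext y; simp [Pi.le_def]
    rw [this]
    exact MeasurableSet.univ_pi fun _ => measurableSet_Ici
  rw [← integral_biUnion_finset _ (fun l _ => measurableSet_blockBox l) ?_
    fun l hl => hint l fun i => by simpa using Fintype.mem_piFinset.1 hl i]
  · refine (setIntegral_eq_of_subset_of_forall_sdiff_eq_zero hms hU fun y hy => ?_)
    refine hH y hy.1 ?_
    by_contra hcon
    push Not at hcon
    -- The box containing `y` has indices `⌊y i / 2⌋`.
    refine hy.2 (Set.mem_iUnion₂.2 ⟨fun i => ⌊y i / 2⌋₊, ?_, fun i _ => ?_⟩)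
    · refine Fintype.mem_piFinset.2 fun i => Finset.mem_range.2 ?_
      rw [Nat.floor_lt (by have := hy.1 i; positivity)]
      linarith [hcon i]
    · have h1 := Nat.floor_le (show 0 ≤ y i / 2 by have := hy.1 i; positivity)
      have h2 := Nat.lt_floor_add_one (y i / 2)
      constructor <;> linarith
  · intro l _ l' _ hne
    rw [Function.onFun, Set.disjoint_left]
    intro y hy hy'
    refine hne (funext fun i => ?_)
    have h1 := hy i (Set.mem_univ i)
    have h2 := hy' i (Set.mem_univ i)
    have h3 : (l i : ℝ) < l' i + 1 := by linarith [h1.1, h2.2]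
    have h4 : (l' i : ℝ) < l i + 1 := by linarith [h1.2, h2.1]
    have h5 : l i < l' i + 1 := by exact_mod_cast h3
    have h6 : l' i < l i + 1 := by exact_mod_cast h4
    omega

theorem sum_piFinset_joinFun {n r M : ℕ} (hr : r ≤ n) (a : (Fin n → ℕ) → ℝ) :
    ∑ k ∈ Fintype.piFinset (fun _ : Fin r => Finset.range M),
      ∑ l ∈ Fintype.piFinset (fun _ : Fin (n - r) => Finset.range M), a (joinFun n r k l) =
    ∑ κ ∈ Fintype.piFinset (fun _ : Fin n => Finset.range M), a κ := by
  rw [← Finset.sum_product']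
  refine Finset.sum_equiv (joinEquiv ℕ hr) (fun q => ?_) fun q _ => rfl
  simp only [Finset.mem_product, Fintype.mem_piFinset, Finset.mem_range]
  constructor
  · rintro ⟨h1, h2⟩ i
    change joinFun n r q.1 q.2 i < M
    unfold joinFun
    split_ifs
    exacts [h1 _, h2 _]
  · intro h
    have hs : (joinEquiv ℕ hr).symm (joinEquiv ℕ hr q) = q := Equiv.symm_apply_apply _ _
    rw [← hs]
    exact ⟨fun i => h _, fun i => h _⟩

theorem sum_injAvg {n M r : ℕ} (g : (Fin n → ℝ) → ℝ) (u : ℕ → ℝ) :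
    ∑ κ ∈ Fintype.piFinset (fun _ : Fin n => Finset.range M), injAvg g r u κ =
      partialAvg uniformSeq M (fun κ v => g (blockPoint κ v)) r u := by
  rw [partialAvg, injIndices, Finset.sum_filter]
  rfl

variable {n : ℕ} {g : (Fin n → ℝ) → ℝ}

theorem memLp_comp_blockPoint (hg : MemLp g 2 (halfLebesguePi n)) {κ : Fin n → ℕ}
    (hκ : Function.Injective κ) : MemLp (fun v => g (blockPoint κ v)) 2 uniformSeq :=
  (hg.restrict _).comp_measurePreserving (measurePreserving_blockPoint hκ)

theorem mem_offDiagonal_of_joinCoords {r : ℕ} (hr : r ≤ n) {p : Fin r → ℝ} {y : Fin (n - r) → ℝ}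
    (h : joinCoords n r p y ∈ offDiagonal n) : p ∈ offDiagonal r := by
  obtain ⟨κ, hκ⟩ := h
  refine ⟨⟨fun i => κ (Fin.castLE hr i), fun i j hij => ?_⟩, fun i => ?_⟩
  · exact Fin.castLE_injective hr (κ.injective hij)
  · have := hκ (Fin.castLE hr i)
    have e : joinCoords n r p y (Fin.castLE hr i) = p i := by
      simp [joinCoords]
    rw [e] at this
    exact this

/-- Non-injective indices may be added since they contribute zero, and indices beyond `M` dropped;
the free finite sum can then be merged with the sum over boxes. -/
theorem tsum_embedding_eq_sum {r M : ℕ} {J : (Fin r → ℕ) → ℝ}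
    (h1 : ∀ k, ¬ Function.Injective k → J k = 0) (h2 : ∀ k, (∃ i, M ≤ k i) → J k = 0) :
    ∑' k : Fin r ↪ ℕ, J k = ∑ k ∈ Fintype.piFinset (fun _ : Fin r => Finset.range M), J k := by
  have hinj : Function.Injective (fun k : Fin r ↪ ℕ => (k : Fin r → ℕ)) := DFunLike.coe_injective
  rw [hinj.tsum_eq (f := J), tsum_eq_sum]
  · intro k hk
    refine h2 k ?_
    by_contra hcon
    push Not at hcon
    exact hk (Fintype.mem_piFinset.2 fun i => Finset.mem_range.2 (hcon i))
  · intro k hk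
    by_contra hcon
    refine hk (h1 k fun hi => hcon ⟨⟨k, hi⟩, rfl⟩)

/-- The explicit multiple integral of a kernel with bounded support is a combination of averages. -/
theorem multipleIntegralElem_ae_eq (hg : IsSymmKernel n g) {R : ℝ}
    (hR : ∀ x, (∃ i, R < x i) → g x = 0) {M : ℕ} (hM : R < 2 * M) :
    multipleIntegralElem n g =ᵐ[uniformSeq]
      chaosSum uniformSeq M (fun κ v => g (blockPoint κ v)) := by
  have hsm := hg.memLp.1
  -- A measurable null set is needed so that, for almost every `u`, the resampled points avoid it
  -- almost surely, for all the countably many `κ` and `r` at once.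
  obtain ⟨A, hsub, hA, hA0⟩ := exists_measurable_superset_of_null (ae_iff.1 hsm.ae_eq_mk)
  have hgA : ∀ x, x ∉ A → g x = hsm.mk g x := fun x hx => by
    by_contra hne
    exact hx (hsub hne)
  have c1 : ∀ᵐ u ∂uniformSeq, ∀ (κ : Fin n → ℕ) (r : ℕ), Function.Injective κ →
      ∀ᵐ w ∂uniformSeq, blockPoint κ (resample (κ '' {i | r ≤ (i : ℕ)}) u w) ∉ A := by
    refine ae_all_iff.2 fun κ => ae_all_iff.2 fun r => ?_
    by_cases hκ : Function.Injective κ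
    · have h0 : ∀ᵐ x ∂(halfLebesguePi n).restrict (blockBox κ), x ∉ A :=
        ae_restrict_of_ae (measure_eq_zero_iff_ae_notMem.1 hA0)
      have h1 : ∀ᵐ v ∂uniformSeq, blockPoint κ v ∉ A :=
        (measurePreserving_blockPoint hκ).quasiMeasurePreserving.ae h0
      filter_upwards [ae_resample (ν := uniformLaw) (κ '' {i | r ≤ (i : ℕ)}) h1] with u hu _
      exact hu
    · exact ae_of_all _ fun u h => absurd h hκ
  have c2 : ∀ᵐ u ∂uniformSeq, ∀ (κ : Fin n → ℕ) (r : ℕ), Function.Injective κ →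
      Integrable (fun w => g (blockPoint κ (resample (κ '' {i | r ≤ (i : ℕ)}) u w)))
        uniformSeq := by
    refine ae_all_iff.2 fun κ => ae_all_iff.2 fun r => ?_
    by_cases hκ : Function.Injective κ
    · filter_upwards [ae_integrable_comp_resample (ν := uniformLaw) (κ '' {i | r ≤ (i : ℕ)})
        ((memLp_comp_blockPoint hg.memLp hκ).integrable one_le_two)] with u hu _
      exact hu
    · exact ae_of_all _ fun u h => absurd h hκ
  filter_upwards [c1, c2, ae_uniformSeq_mem_Ioo] with u h1 h2 h3
  rw [multipleIntegralElem, chaosSum]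
  refine Finset.sum_congr rfl fun r hr => ?_
  replace hr : r ≤ n := Nat.lt_succ_iff.1 (Finset.mem_range.1 hr)
  have hsum := tsum_embedding_eq_sum (r := r) (M := M)
    (J := fun k => ∫ y in {y : Fin (n - r) → ℝ | ∀ i, 0 ≤ y i},
      g (joinCoords n r (blockPoint k u) y)) (fun k hk => ?_) fun k hk => ?_
  · have hbox := fun (k : Fin r → ℕ) (l : Fin (n - r) → ℕ) =>
      integral_blockBox hr hg.vanish hsm.stronglyMeasurable_mk.measurable hA hgA h3 k l
        (h1 (joinFun n r k l) r) (h2 (joinFun n r k l) r)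
    have hJ : ∀ k : Fin r → ℕ, ∫ y in {y : Fin (n - r) → ℝ | ∀ i, 0 ≤ y i},
        g (joinCoords n r (blockPoint k u) y) =
        2 ^ (n - r) * ∑ l ∈ Fintype.piFinset (fun _ : Fin (n - r) => Finset.range M),
          injAvg g r u (joinFun n r k l) := fun k => by
      rw [integral_orthant_eq_sum (M := M) (fun y _ hy => ?_) fun l _ => (hbox k l).1,
        Finset.mul_sum]
      · exact Finset.sum_congr rfl fun l _ => (hbox k l).2
      · obtain ⟨i, hi⟩ := hy
        refine hR _ ⟨⟨r + i, by have := i.isLt; omega⟩, ?_⟩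
        simp only [joinCoords, not_lt.2 (Nat.le_add_right r i), dif_neg, not_false_eq_true,
          Nat.add_sub_cancel_left]
        exact hM.trans_le hi
    change _ * ∑' k : Fin r ↪ ℕ, (fun k : Fin r → ℕ =>
      ∫ y in {y : Fin (n - r) → ℝ | ∀ i, 0 ≤ y i}, g (joinCoords n r (blockPoint k u) y)) k = _
    rw [hsum]
    simp only [hJ]
    rw [← Finset.mul_sum, sum_piFinset_joinFun hr, sum_injAvg]
    -- The weights `(-1/2)^(n-r)` of the definition exactly compensate Lebesgue measure on blocks of
    -- length 2.
    have e : (-(1 / 2) : ℝ) ^ (n - r) * 2 ^ (n - r) = (-1) ^ (n - r) := by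
      rw [← mul_pow]; norm_num
    rw [← e]
    ring
  · have hz : ∀ y, g (joinCoords n r (blockPoint k u) y) = 0 := fun y =>
      hg.vanish _ fun hy => notMem_offDiagonal hk (blockPoint_mem_Ioo k h3)
        (mem_offDiagonal_of_joinCoords hr hy)
    simp [hz]
  · obtain ⟨i, hi⟩ := hk
    have hz : ∀ y, g (joinCoords n r (blockPoint k u) y) = 0 := fun y => by
      refine hR _ ⟨Fin.castLE hr i, ?_⟩
      have e : joinCoords n r (blockPoint k u) y (Fin.castLE hr i) = blockPoint k u i := by
        simp [joinCoords]
      rw [e]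
      have h5 : (M : ℝ) ≤ k i := by exact_mod_cast hi
      linarith [(blockPoint_mem_Ioo k h3 i).1]
    simp [hz]

theorem comp_blockPoint_perm (hg : IsSymmKernel n g) (κ : Fin n → ℕ) (σ : Equiv.Perm (Fin n)) :
    (fun v => g (blockPoint (fun i => κ (σ i)) v)) = fun v => g (blockPoint κ v) :=
  funext fun v => hg.symm σ (blockPoint κ v)

theorem blockPoint_resample {κ : Fin n → ℕ} {S : Set ℕ} (h : Disjoint S (Set.range κ))
    (u w : ℕ → ℝ) : blockPoint κ (resample S u w) = blockPoint κ u := by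
  funext i
  rw [blockPoint, resample_notMem (fun hi => Set.disjoint_left.1 h hi ⟨i, rfl⟩)]
  rfl

/-- A limit of explicit multiple integrals of order `n` belongs to the chaos of order `n`. -/
theorem isChaos_of_tendsto_multipleIntegralElem {F : (ℕ → ℝ) → ℝ} (hF : MemLp F 2 uniformSeq)
    {g : ℕ → (Fin n → ℝ) → ℝ}
    (hg : ∀ m, IsSymmKernel n (g m) ∧ ∃ R : ℝ, ∀ x, (∃ i, R < x i) → g m x = 0)
    (hlim : Tendsto (fun m => eLpNorm (fun u => multipleIntegralElem n (g m) u - F u) 2 uniformSeq)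
      atTop (𝓝 0)) : IsChaos uniformSeq n F := by
  have hM : ∀ m, ∃ M : ℕ, multipleIntegralElem n (g m) =ᵐ[uniformSeq]
      chaosSum uniformSeq M (fun κ v => g m (blockPoint κ v)) := fun m => by
    obtain ⟨R, hR⟩ := (hg m).2
    obtain ⟨M, hM⟩ := exists_nat_gt R
    exact ⟨M, multipleIntegralElem_ae_eq (hg m).1 hR
      (by linarith [(Nat.cast_nonneg M : (0 : ℝ) ≤ M)])⟩
  choose M hM using hM
  have hL : ∀ m, ∀ κ ∈ injIndices n (M m), MemLp (fun v => g m (blockPoint κ v)) 2 uniformSeq :=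
    fun m κ hκ => memLp_comp_blockPoint (hg m).1.memLp (mem_injIndices.1 hκ).2
  have hloc : ∀ (m : ℕ) (κ : Fin n → ℕ) (S : Set ℕ), Disjoint S (Set.range κ) → ∀ u w,
      g m (blockPoint κ (resample S u w)) = g m (blockPoint κ u) := fun m κ S h u w => by
    rw [blockPoint_resample h]
  refine isChaos_of_tendsto (ν := uniformLaw)
    (Y := fun m => chaosSum uniformSeq (M m) (fun κ v => g m (blockPoint κ v))) hF
    (fun m => memLp_chaosSum (hL m)) (fun m => ⟨M m, fun N hN => ⟨?_, ?_⟩⟩) ?_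
  · exact isEigen_chaosSum (hL m) (fun κ σ => comp_blockPoint_perm (hg m).1 κ σ) (hloc m) hN
  · exact avg_Ici_chaosSum (hL m) (hloc m) hN
  · refine hlim.congr fun m => eLpNorm_congr_ae ?_
    filter_upwards [hM m] with u hu
    rw [hu]

end Elementary

/-! ### The gradient in continuous time in terms of the differences `D_k`. -/

section Gradient

variable {F : (ℕ → ℝ) → ℝ}

theorem resample_singleton {E : Type*} (k : ℕ) (u w : ℕ → E) :
    resample {k} u w = Function.update u k (w k) := by
  classical
  funext j
  by_cases h : j = k
  · subst h
    rw [resample_mem (Set.mem_singleton _), Function.update_self]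
  · rw [resample_notMem (by simpa using h), Function.update_of_ne h]

theorem measurable_update_right (k : ℕ) (u : ℕ → ℝ) :
    Measurable fun v : ℝ => Function.update u k v :=
  measurable_update u

theorem avg_singleton_eq (hF : Measurable F) (k : ℕ) (u : ℕ → ℝ) :
    avg uniformSeq {k} F u = ∫ v, F (Function.update u k v) ∂uniformLaw := by
  have h := measurePreserving_eval_infinitePi (fun _ : ℕ => uniformLaw) k
  simp only [avg, resample_singleton]
  have hm : AEStronglyMeasurable (fun v => F (Function.update u k v)) (uniformSeq.map fun w => w k) :=
    (hF.comp (measurable_update_right k u)).aestronglyMeasurable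
  exact (integral_map h.aemeasurable hm).symm.trans
    (congrArg (fun μ => ∫ v, F (Function.update u k v) ∂μ) h.map_eq)

theorem lintegral_uniformLaw_eq {φ : ℝ → ℝ≥0∞} (hφ : Measurable φ) (k : ℕ) :
    ∫⁻ v, φ v ∂uniformLaw =
      ∫⁻ t in Set.Ico (2 * (k : ℝ)) (2 * k + 2), φ (t - 1 - 2 * k) ∂halfLebesgue := by
  have hm : Measurable fun t : ℝ => φ (t - 1 - 2 * (k : ℝ)) := by fun_prop
  rw [halfLebesgue_restrict_Ico, ← map_add_uniformLaw, lintegral_map hm (by fun_prop)]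
  refine lintegral_congr fun v => ?_
  congr 1
  ring

theorem floor_half_eq {k : ℕ} {t : ℝ} (ht : t ∈ Set.Ico (2 * (k : ℝ)) (2 * k + 2)) :
    ⌊t / 2⌋₊ = k := by
  rw [Nat.floor_eq_iff (by have := ht.1; have : (0 : ℝ) ≤ k := Nat.cast_nonneg k; linarith)]
  constructor <;> linarith [ht.1, ht.2]

theorem shift_eq {k : ℕ} {t : ℝ} (ht : t ∈ Set.Ico (2 * (k : ℝ)) (2 * k + 2)) (u : ℕ → ℝ) :
    shift t u = Function.update u k (t - 1 - 2 * (k : ℝ)) := by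
  rw [shift, floor_half_eq ht]

theorem half_integral_shift (hF : Measurable F) (k : ℕ) (u : ℕ → ℝ) :
    (1 / 2 : ℝ) * ∫ s in (2 * (k : ℝ))..(2 * (k : ℝ) + 2), F (shift s u) =
      avg uniformSeq {k} F u := by
  have hm : Measurable fun t : ℝ => F (Function.update u k (t - 1 - 2 * (k : ℝ))) :=
    hF.comp ((measurable_update_right k u).comp (by fun_prop))
  rw [intervalIntegral.integral_of_le (by linarith), ← integral_Ico_eq_integral_Ioc,
    setIntegral_congr_fun measurableSet_Ico fun t ht => by rw [shift_eq ht u], avg_singleton_eq hF]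
  have h := integral_map (μ := uniformLaw) (φ := fun v => 2 * (k : ℝ) + 1 + v)
    (by fun_prop) hm.aestronglyMeasurable
  rw [map_add_uniformLaw, integral_smul_measure] at h
  simp only [ENNReal.toReal_inv, ENNReal.toReal_ofNat, smul_eq_mul] at h
  rw [one_div, h]
  refine integral_congr_ae (ae_of_all _ fun v => ?_)
  beta_reduce
  congr 2
  ring

theorem avg_singleton_update (k : ℕ) (u : ℕ → ℝ) (v : ℝ) :
    avg uniformSeq {k} F (Function.update u k v) = avg uniformSeq {k} F u := by
  simp only [avg, resample_singleton, Function.update_idem]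

/-- On the block of `k` the shift by `t` overwrites coordinate `k`, and the subtracted mean is `E_k
F`, which is insensitive to this overwriting. -/
theorem discreteGradient_eq (hF : Measurable F) {k : ℕ} {t : ℝ}
    (ht : t ∈ Set.Ico (2 * (k : ℝ)) (2 * k + 2)) (u : ℕ → ℝ) :
    discreteGradient F t u =
      coordDiff uniformSeq k F (Function.update u k (t - 1 - 2 * (k : ℝ))) := by
  rw [discreteGradient, floor_half_eq ht, half_integral_shift hF, shift_eq ht, coordDiff,
    avg_singleton_update]

theorem iUnion_Ico_two_mul : ⋃ k : ℕ, Set.Ico (2 * (k : ℝ)) (2 * k + 2) = Set.Ici 0 := by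
  ext t
  simp only [Set.mem_iUnion, Set.mem_Ici]
  constructor
  · rintro ⟨k, hk⟩
    exact le_trans (by positivity) hk.1
  · intro ht
    have h1 := Nat.floor_le (show 0 ≤ t / 2 by positivity)
    have h2 := Nat.lt_floor_add_one (t / 2)
    exact ⟨⌊t / 2⌋₊, by constructor <;> linarith⟩

theorem pairwise_disjoint_Ico_two_mul :
    Pairwise (Function.onFun Disjoint fun k : ℕ => Set.Ico (2 * (k : ℝ)) (2 * k + 2)) := by
  intro k l hkl
  refine Set.disjoint_left.2 fun t hk hl => hkl ?_
  rw [← floor_half_eq hk, floor_half_eq hl]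

theorem halfLebesgue_restrict_Ici : halfLebesgue.restrict (Set.Ici 0) = halfLebesgue := by
  rw [halfLebesgue, Measure.restrict_smul, Measure.restrict_restrict measurableSet_Ici,
    Set.inter_self]

theorem measurable_coordDiff_uniformSeq (hF : Measurable F) (k : ℕ) :
    Measurable (coordDiff uniformSeq k F) :=
  measurable_coordDiff (ν := uniformLaw) k hF

/-- As `t` runs through the block of `k` under `dt/2`, the inserted value `t - 1 - 2k` is uniform on
`[-1, 1]`, that is, a resampled coordinate. -/
theorem lintegral_discreteGradient (hF : Measurable F) {φ : ℝ → ℝ≥0∞} (hφ : Measurable φ)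
    (u : ℕ → ℝ) :
    ∫⁻ t, φ (discreteGradient F t u) ∂halfLebesgue =
      ∑' k, ∫⁻ w, φ (coordDiff uniformSeq k F (resample {k} u w)) ∂uniformSeq := by
  rw [← halfLebesgue_restrict_Ici, ← iUnion_Ico_two_mul,
    lintegral_iUnion (fun k => measurableSet_Ico) pairwise_disjoint_Ico_two_mul]
  refine tsum_congr fun k => ?_
  have hm : Measurable fun v => φ (coordDiff uniformSeq k F (Function.update u k v)) :=
    hφ.comp ((measurable_coordDiff_uniformSeq hF k).comp (measurable_update_right k u))
  have h := measurePreserving_eval_infinitePi (fun _ : ℕ => uniformLaw) k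
  simp only [resample_singleton]
  rw [setLIntegral_congr_fun measurableSet_Ico fun t ht => by rw [discreteGradient_eq hF ht u],
    ← lintegral_uniformLaw_eq hm]
  exact (h.lintegral_comp hm).symm

theorem aestronglyMeasurable_discreteGradient (hF : Measurable F) (u : ℕ → ℝ) :
    AEStronglyMeasurable (fun t => discreteGradient F t u) halfLebesgue := by
  rw [← halfLebesgue_restrict_Ici, ← iUnion_Ico_two_mul, aestronglyMeasurable_iUnion_iff]
  intro k
  have hm : Measurable fun t : ℝ => coordDiff uniformSeq k F
      (Function.update u k (t - 1 - 2 * (k : ℝ))) :=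
    (measurable_coordDiff_uniformSeq hF k).comp
      ((measurable_update_right k u).comp (by fun_prop))
  refine hm.aestronglyMeasurable.congr ?_
  filter_upwards [ae_restrict_mem measurableSet_Ico] with t ht
  rw [discreteGradient_eq hF ht]

theorem integral_discreteGradient_sq_ae_eq (hF : Measurable F) (hF2 : MemLp F 2 uniformSeq) :
    (fun u => ∫ t, discreteGradient F t u ^ 2 ∂halfLebesgue) =ᵐ[uniformSeq]
      fun u => ∑' k, coordVar uniformSeq k F u := by
  have hint : ∀ᵐ u ∂uniformSeq, ∀ k, Integrable
      (fun w => coordDiff uniformSeq k F (resample {k} u w) ^ 2) uniformSeq :=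
    ae_all_iff.2 fun k => ae_integrable_comp_resample (ν := uniformLaw)
      (F := fun v => coordDiff uniformSeq k F v ^ 2) {k}
      (memLp_coordDiff (ν := uniformLaw) (n := 2) k two_ne_zero hF2).integrable_sq
  filter_upwards [hint] with u hu
  rw [integral_eq_lintegral_of_nonneg_ae (ae_of_all _ fun t => sq_nonneg _)
    ((aestronglyMeasurable_discreteGradient hF u).pow 2),
    lintegral_discreteGradient hF (φ := fun x => ENNReal.ofReal (x ^ 2)) (by fun_prop)]
  have e : ∀ k, ∫⁻ w, ENNReal.ofReal (coordDiff uniformSeq k F (resample {k} u w) ^ 2)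
      ∂uniformSeq = ENNReal.ofReal (coordVar uniformSeq k F u) := fun k => by
    rw [← ofReal_integral_eq_lintegral_ofReal (hu k) (ae_of_all _ fun w => sq_nonneg _)]
    rfl
  simp only [e]
  rw [ENNReal.tsum_toReal_eq fun k => ENNReal.ofReal_ne_top]
  exact tsum_congr fun k => ENNReal.toReal_ofReal (coordVar_nonneg _ k F u)

theorem volume_restrict_Ici_eq : volume.restrict (Set.Ici (0 : ℝ)) = (2 : ℝ≥0∞) • halfLebesgue := by
  rw [halfLebesgue, smul_smul, ENNReal.mul_inv_cancel two_ne_zero ENNReal.ofNat_ne_top, one_smul]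

theorem measurable_lintegral_coordDiff_resample (hF : Measurable F) {φ : ℝ → ℝ≥0∞}
    (hφ : Measurable φ) (k : ℕ) :
    Measurable fun u => ∫⁻ w, φ (coordDiff uniformSeq k F (resample {k} u w)) ∂uniformSeq :=
  ((hφ.comp (measurable_coordDiff_uniformSeq hF k)).comp
    (measurable_resample {k})).lintegral_prod_right'

theorem lintegral_lintegral_coordDiff_resample (hF : Measurable F) {φ : ℝ → ℝ≥0∞}
    (hφ : Measurable φ) (k : ℕ) :
    ∫⁻ u, ∫⁻ w, φ (coordDiff uniformSeq k F (resample {k} u w)) ∂uniformSeq ∂uniformSeq =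
      ∫⁻ u, φ (coordDiff uniformSeq k F u) ∂uniformSeq := by
  have hm := hφ.comp (measurable_coordDiff_uniformSeq hF k)
  exact (lintegral_prod _ (hm.comp (measurable_resample {k})).aemeasurable).symm.trans
    ((measurePreserving_resample uniformLaw {k}).lintegral_comp hm)

theorem setLIntegral_discreteGradient (hF : Measurable F) {φ : ℝ → ℝ≥0∞} (hφ : Measurable φ)
    (u : ℕ → ℝ) :
    ∫⁻ t in Set.Ici (0 : ℝ), φ (discreteGradient F t u) =
      2 * ∑' k, ∫⁻ w, φ (coordDiff uniformSeq k F (resample {k} u w)) ∂uniformSeq := by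
  rw [volume_restrict_Ici_eq, lintegral_smul_measure, lintegral_discreteGradient hF hφ, smul_eq_mul]

theorem measurable_setLIntegral_discreteGradient (hF : Measurable F) {φ : ℝ → ℝ≥0∞}
    (hφ : Measurable φ) :
    Measurable fun u => ∫⁻ t in Set.Ici (0 : ℝ), φ (discreteGradient F t u) := by
  simp only [setLIntegral_discreteGradient hF hφ]
  exact (Measurable.tsum fun k => measurable_lintegral_coordDiff_resample hF hφ k).const_mul _

/-- The factor 2 comes from `dt` in place of `dt/2`; averaging over `u` as well absorbs the
resampling. -/
theorem lintegral_setLIntegral_discreteGradient (hF : Measurable F) {φ : ℝ → ℝ≥0∞}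
    (hφ : Measurable φ) :
    ∫⁻ u, (∫⁻ t in Set.Ici (0 : ℝ), φ (discreteGradient F t u)) ∂uniformSeq =
      2 * ∑' k, ∫⁻ u, φ (coordDiff uniformSeq k F u) ∂uniformSeq := by
  have hm := fun k => measurable_lintegral_coordDiff_resample hF hφ k
  simp only [setLIntegral_discreteGradient hF hφ]
  rw [lintegral_const_mul _ (Measurable.tsum hm), lintegral_tsum fun k => (hm k).aemeasurable]
  simp only [lintegral_lintegral_coordDiff_resample hF hφ]

end Gradient

/-! ### Bounds in `[0, ∞]` for functionals of the uniform sequence. -/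

section Transfer

theorem IsIIDUniform.measurePreserving {Ω : Type*} [MeasurableSpace Ω] {P : Measure Ω}
    {U : ℕ → Ω → ℝ} (hU : IsIIDUniform P U) :
    MeasurePreserving (fun ω k => U k ω) P uniformSeq := by
  refine ⟨measurable_pi_iff.2 hU.measurable, ?_⟩
  rw [hU.indep.map_fun_eq_infinitePi_map₀ (measurable_pi_iff.2 hU.measurable).aemeasurable,
    uniformSeq]
  congr 1
  funext k
  exact hU.uniform k

theorem evariance_comp_measurePreserving {α β : Type*} [MeasurableSpace α] [MeasurableSpace β]
    {μ : Measure α} {ν : Measure β} {T : α → β} (hT : MeasurePreserving T μ ν) {B : β → ℝ}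
    (hB : AEStronglyMeasurable B ν) : evariance (fun a => B (T a)) μ = evariance B ν := by
  have hm := hB
  rw [← hT.map_eq] at hm
  have h1 : ∫ a, B (T a) ∂μ = ∫ b, B b ∂ν := by
    rw [← integral_map hT.aemeasurable hm, hT.map_eq]
  rw [evariance, evariance, h1]
  have h2 := lintegral_map' (μ := μ) (f := fun b => ‖B b - ∫ b, B b ∂ν‖ₑ ^ 2)
    ((hm.sub aestronglyMeasurable_const).enorm.pow_const 2) hT.aemeasurable
  rw [hT.map_eq] at h2
  exact h2.symm

/-- Triangle inequality around the mean, then `L¹ ≤ L²`. With `c = 1/d` and `E[B] = d E[X²]` this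
produces the first two terms of the bound. -/
theorem ofReal_integral_abs_sub_le {α : Type*} [MeasurableSpace α] {μ : Measure α}
    [IsProbabilityMeasure μ] {B : α → ℝ} (hB : Integrable B μ) (c : ℝ) (hc : 0 ≤ c) :
    ENNReal.ofReal (∫ a, |1 - c * B a| ∂μ) ≤ ENNReal.ofReal |1 - c * ∫ a, B a ∂μ| +
      ENNReal.ofReal c * evariance B μ ^ (1 / 2 : ℝ) := by
  have h1 : ∫ a, |1 - c * B a| ∂μ ≤ |1 - c * ∫ a, B a ∂μ| + c * ∫ a, |B a - ∫ b, B b ∂μ| ∂μ := by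
    have hi : Integrable (fun a => |B a - ∫ b, B b ∂μ|) μ := (hB.sub (integrable_const _)).abs
    calc ∫ a, |1 - c * B a| ∂μ
        ≤ ∫ a, (|1 - c * ∫ b, B b ∂μ| + c * |B a - ∫ b, B b ∂μ|) ∂μ := by
          refine integral_mono ((integrable_const _).sub (hB.const_mul c)).abs
            ((integrable_const _).add (hi.const_mul c)) fun a => ?_
          have e : 1 - c * B a = (1 - c * ∫ b, B b ∂μ) - c * (B a - ∫ b, B b ∂μ) := by ring
          beta_reduce
          rw [e]
          refine (abs_sub _ _).trans ?_
          rw [abs_mul, abs_of_nonneg hc]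
      _ = _ := by
          rw [integral_add (integrable_const _) (hi.const_mul c), integral_const_mul]
          simp
  refine (ENNReal.ofReal_le_ofReal h1).trans ?_
  rw [ENNReal.ofReal_add (abs_nonneg _) (mul_nonneg hc (integral_nonneg fun a => abs_nonneg _)),
    ENNReal.ofReal_mul hc]
  gcongr
  have h2 := eLpNorm_le_eLpNorm_of_exponent_le (μ := μ) (p := 1) (q := 2) one_le_two
    (hB.sub (integrable_const (∫ b, B b ∂μ))).1
  rw [eLpNorm_one_eq_lintegral_enorm, eLpNorm_two_eq] at h2
  refine le_trans (le_of_eq ?_) h2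
  refine (ofReal_integral_eq_lintegral_ofReal (hB.sub (integrable_const _)).abs
    (ae_of_all _ fun a => abs_nonneg _)).trans ?_
  exact lintegral_congr fun a => (Real.enorm_eq_ofReal_abs _).symm

theorem ofReal_sqrt (x : ℝ) (hx : 0 ≤ x) :
    ENNReal.ofReal √x = ENNReal.ofReal x ^ (1 / 2 : ℝ) := by
  rw [Real.sqrt_eq_rpow, ENNReal.ofReal_rpow_of_nonneg hx (by norm_num)]

theorem ofReal_fourth_term_le {d : ℕ} (hd : 1 ≤ d) {s : ℝ} (hs : 0 ≤ s) :
    ENNReal.ofReal (2 * (d : ℝ)⁻¹ * √(4 / 3 * (d * s))) ≤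
      12 / (d : ℝ≥0∞) ^ (1 / 2 : ℝ) * (2 * ENNReal.ofReal s) ^ (1 / 2 : ℝ) := by
  have hd' : (0 : ℝ) < d := by exact_mod_cast hd
  have hsd : 0 < √(d : ℝ) := Real.sqrt_pos.2 hd'
  have e1 : (d : ℝ≥0∞) ^ (1 / 2 : ℝ) = ENNReal.ofReal √(d : ℝ) := by
    rw [ofReal_sqrt _ hd'.le, ENNReal.ofReal_natCast]
  have e2 : (2 * ENNReal.ofReal s) ^ (1 / 2 : ℝ) = ENNReal.ofReal √(2 * s) := by
    rw [ofReal_sqrt _ (by positivity), ENNReal.ofReal_mul zero_le_two, ENNReal.ofReal_ofNat]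
  have e3 : (12 : ℝ≥0∞) = ENNReal.ofReal 12 := (ENNReal.ofReal_ofNat 12).symm
  rw [e1, e2, e3, ← ENNReal.ofReal_div_of_pos hsd, ← ENNReal.ofReal_mul (by positivity)]
  refine ENNReal.ofReal_le_ofReal ?_
  -- Only `4/3 ≤ 2` is used; this gives the constant 2, which is then relaxed to 12.
  have h1 : √(4 / 3 * (d * s)) ≤ √(d : ℝ) * √(2 * s) := by
    rw [← Real.sqrt_mul hd'.le]
    refine Real.sqrt_le_sqrt ?_
    nlinarith [mul_nonneg hd'.le hs]
  have h2 : (d : ℝ)⁻¹ * √(d : ℝ) = 1 / √(d : ℝ) := by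
    rw [eq_div_iff hsd.ne', mul_assoc, Real.mul_self_sqrt hd'.le, inv_mul_cancel₀ hd'.ne']
  calc 2 * (d : ℝ)⁻¹ * √(4 / 3 * (d * s)) ≤ 2 * (d : ℝ)⁻¹ * (√(d : ℝ) * √(2 * s)) := by gcongr
    _ = 2 * ((d : ℝ)⁻¹ * √(d : ℝ)) * √(2 * s) := by ring
    _ = 2 / √(d : ℝ) * √(2 * s) := by rw [h2]; ring
    _ ≤ 12 / √(d : ℝ) * √(2 * s) := by gcongr; norm_num

/-- Berry-Esseen bound for a functional in the chaos of order `d` of a uniform sequence, in terms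
of its discrete gradient. -/
theorem ofReal_iSup_le {d : ℕ} (hd : 1 ≤ d) {F : (ℕ → ℝ) → ℝ} (hF : Measurable F)
    (h : IsChaos uniformSeq d F) :
    ENNReal.ofReal (⨆ x : ℝ, |uniformSeq.real {u | F u ≤ x} - stdCdf x|) ≤
      ENNReal.ofReal |1 - ∫ u, F u ^ 2 ∂uniformSeq| +
        1 / (d : ℝ≥0∞) *
          evariance (fun u => ∑' k, coordVar uniformSeq k F u) uniformSeq ^ (1 / 2 : ℝ) +
        12 / (d : ℝ≥0∞) ^ (1 / 2 : ℝ) *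
          (2 * ∑' k, ∫⁻ u, ENNReal.ofReal (coordDiff uniformSeq k F u ^ 4) ∂uniformSeq) ^
            (1 / 2 : ℝ) := by
  have hd' : (0 : ℝ) < d := by exact_mod_cast hd
  have hdt : (d : ℝ≥0∞) ^ (1 / 2 : ℝ) ≠ ⊤ :=
    ENNReal.rpow_ne_top_of_nonneg (by norm_num) (ENNReal.natCast_ne_top d)
  -- If the fourth order term is infinite there is nothing to prove; otherwise its finiteness
  -- supplies the integrability and summability that the real-valued bound requires.
  by_cases htop : ∑' k, ∫⁻ u, ENNReal.ofReal (coordDiff uniformSeq k F u ^ 4) ∂uniformSeq = ⊤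
  · rw [htop, ENNReal.mul_top two_ne_zero, ENNReal.top_rpow_of_pos (by norm_num),
      ENNReal.mul_top (ENNReal.div_ne_zero.2 ⟨by norm_num, hdt⟩), add_top]
    exact le_top
  have hpos : ∀ k u, 0 ≤ coordDiff uniformSeq k F u ^ 4 := fun k u => (even_two_mul 2).pow_nonneg _
  have hD := fun k => measurable_coordDiff_uniformSeq hF k
  have hi : ∀ k, Integrable (fun u => coordDiff uniformSeq k F u ^ 4) uniformSeq := fun k => by
    refine ⟨((hD k).pow_const 4).aestronglyMeasurable, ?_⟩
    rw [hasFiniteIntegral_iff_ofReal (ae_of_all _ (hpos k))]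
    exact (ENNReal.ne_top_of_tsum_ne_top htop k).lt_top
  have he : ∀ k, ∫⁻ u, ENNReal.ofReal (coordDiff uniformSeq k F u ^ 4) ∂uniformSeq =
      ENNReal.ofReal (∫ u, coordDiff uniformSeq k F u ^ 4 ∂uniformSeq) := fun k =>
    (ofReal_integral_eq_lintegral_ofReal (hi k) (ae_of_all _ (hpos k))).symm
  have hint : ∀ k, 0 ≤ ∫ u, coordDiff uniformSeq k F u ^ 4 ∂uniformSeq := fun k =>
    integral_nonneg (hpos k)
  simp only [he] at htop ⊢
  have hs : Summable fun k => ∫ u, coordDiff uniformSeq k F u ^ 4 ∂uniformSeq := by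
    have := ENNReal.summable_toReal htop
    simpa only [ENNReal.toReal_ofReal (hint _)] using this
  rw [← ENNReal.ofReal_tsum_of_nonneg hint hs]
  have hm : MeasureTheory.Integrable (fun u => ∑' k, coordVar uniformSeq k F u) uniformSeq :=
    h.integrable_tsum_coordVar (ν := uniformLaw)
  have hB := ofReal_integral_abs_sub_le hm (d : ℝ)⁻¹ (by positivity)
  have hE : ∫ u, ∑' k, coordVar uniformSeq k F u ∂uniformSeq = d * ∫ u, F u ^ 2 ∂uniformSeq :=
    h.integral_tsum_coordVar (ν := uniformLaw)
  rw [hE, ← mul_assoc, inv_mul_cancel₀ hd'.ne', one_mul, ENNReal.ofReal_inv_of_pos hd',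
    ENNReal.ofReal_natCast, ← one_div (d : ℝ≥0∞)] at hB
  have hfin := fun x => h.abs_measureReal_le_sub_stdCdf_le (ν := uniformLaw) hd'
    (fun k => memLp_four_of_integrable_pow (hD k).aestronglyMeasurable (hi k)) hs x
  refine (ENNReal.ofReal_le_ofReal (ciSup_le hfin)).trans ?_
  rw [ENNReal.ofReal_add (integral_nonneg fun u => abs_nonneg _) (by positivity)]
  exact add_le_add hB (ofReal_fourth_term_le hd (tsum_nonneg hint))

end Transfer

/-! ### Transport to the given probability space and conclusion. -/

section Main

variable {Ω : Type*} [MeasurableSpace Ω] {P : Measure Ω} {U : ℕ → Ω → ℝ} {F : (ℕ → ℝ) → ℝ}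

theorem kolmogorovDistNormal_eq (hU : IsIIDUniform P U) (hF : Measurable F) {X : Ω → ℝ}
    (hXF : ∀ᵐ ω ∂P, X ω = F fun k => U k ω) :
    kolmogorovDistNormal P X = ⨆ x : ℝ, |uniformSeq.real {u | F u ≤ x} - stdCdf x| := by
  refine iSup_congr fun x => ?_
  have h1 : P.real {ω | X ω ≤ x} = P.real ((fun ω k => U k ω) ⁻¹' {u | F u ≤ x}) := by
    refine measureReal_congr ?_
    filter_upwards [hXF] with ω hω
    exact congrArg (· ≤ x) hω
  rw [h1, hU.measurePreserving.measureReal_preimage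
    (measurableSet_le hF measurable_const).nullMeasurableSet]
  rfl

theorem varGradientSq_eq (hU : IsIIDUniform P U) (hF : Measurable F)
    (h : IsChaos uniformSeq d F) :
    varGradientSq P U F =
      evariance (fun u => ∑' k, coordVar uniformSeq k F u) uniformSeq := by
  have hm : Integrable (fun u => ∑' k, coordVar uniformSeq k F u) uniformSeq :=
    h.integrable_tsum_coordVar (ν := uniformLaw)
  rw [← evariance_comp_measurePreserving hU.measurePreserving hm.1]
  exact evariance_congr (hU.measurePreserving.quasiMeasurePreserving.ae
    (integral_discreteGradient_sq_ae_eq hF h.memLp))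

theorem gradientFourth_eq (hU : IsIIDUniform P U) (hF : Measurable F) :
    gradientFourth P U F =
      2 * ∑' k, ∫⁻ u, ENNReal.ofReal (coordDiff uniformSeq k F u ^ 4) ∂uniformSeq := by
  have hφ : Measurable fun x : ℝ => ENNReal.ofReal (x ^ 4) := by fun_prop
  rw [← lintegral_setLIntegral_discreteGradient hF hφ]
  exact hU.measurePreserving.lintegral_comp (measurable_setLIntegral_discreteGradient hF hφ)

/-- The approximation in `L²(P)` becomes one in `L²` of the sequence law, because the sequence of
variables is measure preserving; the explicit integrals are measurable there as almost sure versions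
of a `chaosSum`. -/
theorem isChaos_of_isMultipleIntegral (hU : IsIIDUniform P U) (hF : Measurable F) {d : ℕ}
    {f : (Fin d → ℝ) → ℝ} {X : Ω → ℝ} (hXF : ∀ᵐ ω ∂P, X ω = F fun k => U k ω)
    (hX : IsMultipleIntegral P U d f X) : IsChaos uniformSeq d F := by
  obtain ⟨_, hX2, g, hg, _, hlim⟩ := hX
  have hT := hU.measurePreserving
  have hF2 : MemLp F 2 uniformSeq := by
    rw [← hT.map_eq, memLp_map_measure_iff hF.aestronglyMeasurable hT.aemeasurable]
    exact hX2.ae_eq hXF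
  refine isChaos_of_tendsto_multipleIntegralElem hF2 hg (hlim.congr fun m => ?_)
  obtain ⟨R, hR⟩ := (hg m).2
  obtain ⟨M, hM⟩ := exists_nat_gt R
  have hae := multipleIntegralElem_ae_eq (hg m).1 hR
    (show R < 2 * M by linarith [(Nat.cast_nonneg M : (0 : ℝ) ≤ M)])
  have hmeas : AEStronglyMeasurable (multipleIntegralElem d (g m)) uniformSeq :=
    (memLp_chaosSum (ν := uniformLaw) fun κ hκ =>
      memLp_comp_blockPoint (hg m).1.memLp (mem_injIndices.1 hκ).2).1.congr hae.symm
  refine (eLpNorm_congr_ae ?_).trans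
    (eLpNorm_comp_measurePreserving (hmeas.sub hF.aestronglyMeasurable) hT)
  filter_upwards [hXF] with ω hω
  simp [hω]

end Main

end IndepChaos

theorem proposition5p2 {Ω : Type*} [MeasurableSpace Ω] (P : Measure Ω) [IsProbabilityMeasure P]
    (U : ℕ → Ω → ℝ) (hU : IndepChaos.IsIIDUniform P U)
    (d : ℕ) (hd : 1 ≤ d) (f : (Fin d → ℝ) → ℝ)
    (F : (ℕ → ℝ) → ℝ) (hF : Measurable F)
    (X : Ω → ℝ) (hXF : ∀ᵐ ω ∂P, X ω = F fun k => U k ω)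
    (hX : IndepChaos.IsMultipleIntegral P U d f X) :
    ENNReal.ofReal (IndepChaos.kolmogorovDistNormal P X) ≤
        ENNReal.ofReal |1 - ∫ ω, X ω ^ 2 ∂P|
          + (1 / (d : ℝ≥0∞)) * IndepChaos.varGradientSq P U F ^ (1 / 2 : ℝ)
          + ((12 + 5 * IndepChaos.fourthMoment P X ^ (1 / 4 : ℝ)) / (d : ℝ≥0∞) ^ (1 / 2 : ℝ))
            * IndepChaos.gradientFourth P U F ^ (1 / 2 : ℝ) ∧
    ENNReal.ofReal (IndepChaos.kolmogorovDistNormal P X) ≤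
        ENNReal.ofReal |1 - ∫ ω, X ω ^ 2 ∂P|
          + IndepChaos.varGradientSq P U F ^ (1 / 2 : ℝ)
          + 24 * IndepChaos.gradientFourth P U F ^ (1 / 2 : ℝ) := by
  have h := IndepChaos.isChaos_of_isMultipleIntegral hU hF hXF hX
  have hT := hU.measurePreserving
  have hsq : ∫ ω, X ω ^ 2 ∂P = ∫ u, F u ^ 2 ∂IndepChaos.uniformSeq := by
    rw [← hT.map_eq, integral_map hT.aemeasurable (hF.pow_const 2).aestronglyMeasurable]
    refine integral_congr_ae ?_
    filter_upwards [hXF] with ω hω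
    rw [hω]
  have key := IndepChaos.ofReal_iSup_le hd hF h
  rw [← IndepChaos.kolmogorovDistNormal_eq hU hF hXF, ← hsq, ← IndepChaos.varGradientSq_eq hU hF h,
    ← IndepChaos.gradientFourth_eq hU hF] at key
  have hd1 : (1 : ℝ≥0∞) ≤ d := by exact_mod_cast hd
  -- The first bound drops the fourth moment of `X`; the second uses `1/d ≤ 1` and `12/√d ≤ 24`.
  refine ⟨key.trans ?_, key.trans ?_⟩
  · gcongr
    exact le_self_add
  · gcongr
    · refine mul_le_of_le_one_left zero_le (ENNReal.div_le_of_le_mul ?_)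
      rwa [one_mul]
    · refine ENNReal.div_le_of_le_mul ?_
      calc (12 : ℝ≥0∞) ≤ 24 * 1 := by norm_num
        _ ≤ 24 * (d : ℝ≥0∞) ^ (1 / 2 : ℝ) := by
          gcongr
          exact ENNReal.one_le_rpow hd1 (by norm_num)
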